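/- **Definitions.** A *CAT(0) cube complex* $X$ is a simply connected cube complex in which the link of every vertex is a flag complex; it carries the $\ell^1$ path metric (each cube $[0,1]^n$ has the $\ell^1$ metric), which on vertices is the edge-path metric. A *hyperplane* is a class of edges for the equivalence relation generated by being opposite edges of a square; $H$ denotes the set of hyperplanes of $X$. The *halfspaces* of a hyperplane $h$ are the vertex sets of the components of the 1-skeleton after deletion of the edges crossed by $h$. Fix a base vertex $x_0$ of $X$. An edge path is *inward* if each of its edges decreases the edge-path distance to $x_0$. Given $c:H\to\{0,1\}$, an edge geodesic is *monochromatic* if it only crosses hyperplanes of a single colour, and for an integer $l\ge 0$ the map $c$ is an *$l$-controlled colouring* if no monochromatic inward geodesic has length greater than $l$. For $\hat H\subseteq H$ let $\hat X$ be the following cube complex. Its vertices are the choices of one halfspace for each hyperplane in $\hat H$ such that the chosen halfspaces have a common vertex; two vertices are joined by an edge if they differ on exactly one hyperplane, and a cube is attached wherever the 1-skeleton of a cube occurs. A map $\phi:A\to B$ of metric spaces is *cobornologous* if for every $R>0$ there is $S>0$ such that $d(\phi(x),\phi(y))\le R$ implies $d(x,y)\le S$. **Theorem.** Let $X$ be a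 CAT(0) cube complex of dimension $D<\infty$ with set of hyperplanes $H$ and base vertex $x_0$, let $l\ge 0$ be an integer, and let $c:H\to\{0,1\}$ be an $l$-controlled colouring. Put $\hat H=c^{-1}(\{0\})$, and let $\hat X$ be the cube complex constructed from $\hat H$ as above. Then $\hat X$ is a CAT(0) cube complex; its hyperplanes correspond bijectively to the elements of $\hat H$, in such a way that an edge of $\hat X$ crosses the hyperplane corresponding to $h$ if and only if its endpoints differ on $h$; and there exists a cobornologous, $\frac{l}{l+1}$-Lipschitz map from $X$ to $\hat X$, both with the $\ell^1$ path metric. -/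

import Mathlib

open scoped ENNReal NNReal

universe u

/-- The combinatorial `n`-cube is `Fin n → Bool`. A face map is the inclusion of a `k`-dimensional
face of the `n`-cube, possibly precomposed with a symmetry of the `k`-cube: there are distinct
coordinates `σ i` of the `n`-cube such that the coordinate `σ i` of `a x` is `x i` or its
negation, and all the other coordinates of `a x` are constant. -/
def IsFaceMap {k n : ℕ} (a : (Fin k → Bool) → (Fin n → Bool)) : Prop :=
  ∃ σ : Fin k → Fin n, Function.Injective σ ∧
    ∀ x y j, a x j ≠ a y j ↔ ∃ i, σ i = j ∧ x i ≠ y i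

/-- A cube complex with vertex set `V`, given by the characteristic maps of its cubes, restricted
to the vertices of the standard cubes. Cubes are embedded, faces of cubes are cubes, and two cubes
that meet do so in exactly one common face. -/
structure CubeComplex (V : Type u) where
  IsCube : ∀ {n : ℕ}, ((Fin n → Bool) → V) → Prop
  injective : ∀ {n : ℕ} {f : (Fin n → Bool) → V}, IsCube f → Function.Injective f
  vertex : ∀ v : V, IsCube (fun _ : Fin 0 → Bool => v)
  face : ∀ {k n : ℕ} {f : (Fin n → Bool) → V} {a : (Fin k → Bool) → (Fin n → Bool)},
    IsCube f → IsFaceMap a → IsCube (f ∘ a)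
  inter : ∀ {m n : ℕ} {f : (Fin m → Bool) → V} {g : (Fin n → Bool) → V} (x : Fin m → Bool)
    (y : Fin n → Bool), IsCube f → IsCube g → f x = g y →
    ∃ (k : ℕ) (a : (Fin k → Bool) → (Fin m → Bool)) (b : (Fin k → Bool) → (Fin n → Bool)),
      IsFaceMap a ∧ IsFaceMap b ∧ f ∘ a = g ∘ b ∧ Set.range f ∩ Set.range g = Set.range (f ∘ a)

namespace CubeComplex

variable {V : Type u}

/-- The dimension of the complex is `D`. -/
def HasDimension (X : CubeComplex V) (D : ℕ) : Prop :=
  (∃ f : (Fin D → Bool) → V, X.IsCube f) ∧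
    ∀ (n : ℕ) (f : (Fin n → Bool) → V), X.IsCube f → n ≤ D

/-! ### The one-skeleton, squares, and the CAT(0) condition -/

theorem isFaceMap_not : IsFaceMap (fun (x : Fin 1 → Bool) i => !(x i)) := by
  refine ⟨id, Function.injective_id, fun x y j => ?_⟩
  simp

/-- The one-skeleton. Its graph distance is the edge-path metric. -/
def skeleton (X : CubeComplex V) : SimpleGraph V where
  Adj u v := ∃ f : (Fin 1 → Bool) → V, X.IsCube f ∧ f ![false] = u ∧ f ![true] = v
  symm := ⟨by
    rintro u v ⟨f, hf, rfl, rfl⟩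
    refine ⟨_, X.face hf isFaceMap_not, ?_, ?_⟩ <;>
      exact congrArg f (by funext i; fin_cases i; rfl)⟩
  loopless := ⟨by
    rintro u ⟨f, hf, h1, h2⟩
    have h := congrFun (X.injective hf (h1.trans h2.symm)) 0
    simp at h⟩

/-- The vertices `p, q, r, s`, in this cyclic order, are the vertices of a 2-cube. -/
def IsSquare (X : CubeComplex V) (p q r s : V) : Prop :=
  ∃ f : (Fin 2 → Bool) → V, X.IsCube f ∧ f ![false, false] = p ∧ f ![true, false] = q ∧
    f ![true, true] = r ∧ f ![false, true] = s

/-- Homotopy of edge paths with fixed endpoints in the 2-skeleton: the congruence generated by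
removing a backtrack and by pushing a path across a 2-cube. -/
inductive Homotopic (X : CubeComplex V) :
    ∀ {u v : V}, X.skeleton.Walk u v → X.skeleton.Walk u v → Prop
  | refl {u v : V} (p : X.skeleton.Walk u v) : Homotopic X p p
  | symm {u v : V} {p q : X.skeleton.Walk u v} : Homotopic X p q → Homotopic X q p
  | trans {u v : V} {p q r : X.skeleton.Walk u v} :
      Homotopic X p q → Homotopic X q r → Homotopic X p r
  | cons {u v w : V} (h : X.skeleton.Adj u v) {p q : X.skeleton.Walk v w} :
      Homotopic X p q → Homotopic X (SimpleGraph.Walk.cons h p) (SimpleGraph.Walk.cons h q)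
  | backtrack {u v w : V} (h : X.skeleton.Adj u v) (p : X.skeleton.Walk u w) :
      Homotopic X (SimpleGraph.Walk.cons h (SimpleGraph.Walk.cons h.symm p)) p
  | square {p q r s w : V} (hpq : X.skeleton.Adj p q) (hqr : X.skeleton.Adj q r)
      (hps : X.skeleton.Adj p s) (hsr : X.skeleton.Adj s r) (t : X.skeleton.Walk r w) :
      X.IsSquare p q r s →
      Homotopic X (SimpleGraph.Walk.cons hpq (SimpleGraph.Walk.cons hqr t))
        (SimpleGraph.Walk.cons hps (SimpleGraph.Walk.cons hsr t))

/-- The complex is non-empty, connected, and has trivial edge-path group. -/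
def IsSimplyConnected (X : CubeComplex V) : Prop :=
  X.skeleton.Connected ∧
    ∀ (u : V) (p : X.skeleton.Walk u u), X.Homotopic p SimpleGraph.Walk.nil

/-- The link of every vertex `v` is a flag complex. The vertices of the link are the edges at `v`,
that is, the neighbours of `v`; finitely many of them span a simplex of the link when they are the
neighbours of `v` in some cube. -/
def HasFlagLinks (X : CubeComplex V) : Prop :=
  ∀ (v : V) (n : ℕ) (w : Fin n → V), Function.Injective w →
    (∀ i, X.skeleton.Adj v (w i)) →
    (∀ i j, i ≠ j → ∃ r, X.IsSquare v (w i) r (w j)) →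
    ∃ f : (Fin n → Bool) → V, X.IsCube f ∧ f (fun _ => false) = v ∧
      ∀ i, f (fun j => decide (j = i)) = w i

/-- A CAT(0) cube complex: a simply connected cube complex in which the link of every vertex is a
flag complex. -/
structure IsCAT0 (X : CubeComplex V) : Prop where
  simplyConnected : X.IsSimplyConnected
  flagLinks : X.HasFlagLinks

/-! ### Hyperplanes and halfspaces -/

/-- Two edges are opposite edges of some 2-cube. -/
def OppositeEdges (X : CubeComplex V) (e e' : X.skeleton.edgeSet) : Prop :=
  ∃ p q r s : V, X.IsSquare p q r s ∧ (e : Sym2 V) = s(p, q) ∧ (e' : Sym2 V) = s(s, r)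

/-- Hyperplanes, as classes of edges (the edges they cross) for the equivalence relation that is
generated by being opposite in a 2-cube. -/
def Hyperplane (X : CubeComplex V) : Type u := Quot X.OppositeEdges

/-- The hyperplane crossed by a directed edge. -/
def dual (X : CubeComplex V) (d : X.skeleton.Dart) : X.Hyperplane :=
  Quot.mk _ ⟨d.edge, d.edge_mem⟩

/-- The edges crossed by a hyperplane. -/
def dualEdges (X : CubeComplex V) (h : X.Hyperplane) : Set (Sym2 V) :=
  {e | ∃ d : X.skeleton.Dart, d.edge = e ∧ X.dual d = h}

/-- The side of the hyperplane `h` on which the vertex `x` lies: the vertices that can be reached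
from `x` along edge paths that do not cross `h`. -/
def side (X : CubeComplex V) (h : X.Hyperplane) (x : V) : Set V :=
  {y | (X.skeleton.deleteEdges (X.dualEdges h)).Reachable x y}

/-- The halfspaces (sides) of a hyperplane. -/
def IsHalfspace (X : CubeComplex V) (h : X.Hyperplane) (s : Set V) : Prop :=
  ∃ x, s = X.side h x

/-! ### Controlled colourings -/

/-- An edge path that realises the edge-path distance between its endpoints. -/
def IsGeodesic (X : CubeComplex V) {u v : V} (p : X.skeleton.Walk u v) : Prop :=
  p.length = X.skeleton.dist u v

/-- Every edge of the path brings it closer to the basepoint `x₀`. -/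
def IsInward (X : CubeComplex V) (x₀ : V) {u v : V} (p : X.skeleton.Walk u v) : Prop :=
  ∀ d ∈ p.darts, X.skeleton.dist x₀ d.snd < X.skeleton.dist x₀ d.fst

/-- The path only crosses hyperplanes of a single colour. -/
def IsMonochromatic (X : CubeComplex V) (c : X.Hyperplane → Fin 2) {u v : V}
    (p : X.skeleton.Walk u v) : Prop :=
  ∃ a : Fin 2, ∀ d ∈ p.darts, c (X.dual d) = a

/-- No monochromatic inward geodesic has length greater than `l`. -/
def IsControlledColouring (X : CubeComplex V) (x₀ : V) (l : ℕ) (c : X.Hyperplane → Fin 2) : Prop :=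
  ∀ (u v : V) (p : X.skeleton.Walk u v),
    X.IsGeodesic p → X.IsInward x₀ p → X.IsMonochromatic c p → p.length ≤ l

/-! ### The complex with a prescribed set of hyperplanes -/

/-- A choice of one halfspace for each hyperplane in `K`, such that the chosen halfspaces have a
common vertex. -/
def Orientation (X : CubeComplex V) (K : Set X.Hyperplane) : Type u :=
  {σ : K → Set V // (∀ h : K, X.IsHalfspace h (σ h)) ∧ (⋂ h : K, σ h).Nonempty}

/-- The maps `f` that send the vertices of the `n`-cube to orientations such that there are `n`
distinct hyperplanes `k i` in `K`, with the following property: `f x` and `f y` differ exactly on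
the hyperplanes `k i` for which the coordinates `x i`, `y i` differ. -/
def IsOrientationCube (X : CubeComplex V) (K : Set X.Hyperplane) {n : ℕ}
    (f : (Fin n → Bool) → X.Orientation K) : Prop :=
  ∃ k : Fin n → K, Function.Injective k ∧
    ∀ x y h, (f x).1 h ≠ (f y).1 h ↔ ∃ i, k i = h ∧ x i ≠ y i

/-- The cube complex with hyperplanes `K`. Its vertices are the orientations of `K`; two of them
are joined by an edge when they differ on exactly one hyperplane, and a cube is inserted wherever
the vertices and edges of a cube occur. -/
def restrict (X : CubeComplex V) (K : Set X.Hyperplane) : CubeComplex (X.Orientation K) where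
  IsCube f := X.IsOrientationCube K f
  injective := by
    rintro n f ⟨k, hk, hf⟩ x y hxy
    funext i
    by_contra hi
    exact (hf x y (k i)).2 ⟨i, rfl, hi⟩ (by rw [hxy])
  vertex v := ⟨fun i => i.elim0, fun i => i.elim0, fun x y h => by simp⟩
  face := by
    rintro m n f a ⟨k, hk, hf⟩ ⟨σ, hσ, ha⟩
    refine ⟨k ∘ σ, hk.comp hσ, fun x y h => ?_⟩
    simp only [Function.comp]
    rw [hf]
    constructor
    · rintro ⟨j, rfl, hj⟩
      obtain ⟨i, rfl, hi⟩ := (ha x y j).1 hj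
      exact ⟨i, rfl, hi⟩
    · rintro ⟨i, rfl, hi⟩
      exact ⟨σ i, rfl, (ha x y _).2 ⟨i, rfl, hi⟩⟩
  inter := by
    classical
    rintro m n f g x₀ y₀ ⟨k, hk, hf⟩ ⟨k', hk', hg⟩ h₀
    have hf' : ∀ x y i, x i = y i → (f x).1 (k i) = (f y).1 (k i) := by
      intro x y i hi
      by_contra hc
      obtain ⟨i', hi', hd⟩ := (hf x y _).1 hc
      rw [hk hi'] at hd
      exact hd hi
    have hg' : ∀ x y i, x i = y i → (g x).1 (k' i) = (g y).1 (k' i) := by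
      intro x y i hi
      by_contra hc
      obtain ⟨i', hi', hd⟩ := (hg x y _).1 hc
      rw [hk' hi'] at hd
      exact hd hi
    let P : Fin m → Fin n → Prop := fun i j => k i = k' j ∧
      (f (Function.update x₀ i (!x₀ i))).1 (k i) = (g (Function.update y₀ j (!y₀ j))).1 (k i)
    let J : Finset (Fin m) := Finset.univ.filter fun i => ∃ j, P i j
    let σ : Fin J.card → Fin m := fun i => J.equivFin.symm i
    have hσ : Function.Injective σ := Subtype.val_injective.comp J.equivFin.symm.injective
    have hσJ : ∀ i ∈ J, ∃ z, σ z = i := fun i hi => ⟨J.equivFin ⟨i, hi⟩, by simp [σ]⟩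
    have hex : ∀ i, ∃ j, P (σ i) j := fun i =>
      (Finset.mem_filter.1 (J.equivFin.symm i).2).2
    choose τ hτP using hex
    have hτ : Function.Injective τ := fun i j hij =>
      hσ (hk ((hτP i).1.trans ((congrArg k' hij).trans (hτP j).1.symm)))
    let F : ∀ {N : ℕ} (_ : Fin J.card → Fin N) (_ : Fin N → Bool), (Fin J.card → Bool) →
      (Fin N → Bool) := fun ρ v z j => xor (v j) (decide (∃ i, ρ i = j ∧ z i = true))
    have hFv : ∀ {N : ℕ} (ρ : Fin J.card → Fin N) (v : Fin N → Bool), Function.Injective ρ →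
        ∀ z i, F ρ v z (ρ i) = xor (v (ρ i)) (z i) := by
      intro N ρ v hρ z i
      simp only [F]
      congr 1
      by_cases hz : z i = true
      · rw [hz]; exact decide_eq_true ⟨i, rfl, hz⟩
      · rw [Bool.not_eq_true] at hz
        rw [hz, decide_eq_false_iff_not]
        rintro ⟨i', hi', h⟩
        rw [hρ hi', hz] at h
        exact absurd h (by simp)
    have hFn : ∀ {N : ℕ} (ρ : Fin J.card → Fin N) (v : Fin N → Bool) z j,
        (∀ i, ρ i = j → z i = false) → F ρ v z j = v j := by
      intro N ρ v z j hj
      have hd : decide (∃ i, ρ i = j ∧ z i = true) = false := by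
        rw [decide_eq_false_iff_not]
        rintro ⟨i, hi, h⟩
        rw [hj i hi] at h
        exact absurd h (by simp)
      simp only [F, hd, Bool.xor_false]
    have hFface : ∀ {N : ℕ} (ρ : Fin J.card → Fin N) (v : Fin N → Bool), Function.Injective ρ →
        IsFaceMap (F ρ v) := by
      intro N ρ v hρ
      refine ⟨ρ, hρ, fun x y j => ⟨fun h => ?_, ?_⟩⟩
      · by_contra hc
        push Not at hc
        refine h ?_
        by_cases hj : ∃ i, ρ i = j
        · obtain ⟨i, rfl⟩ := hj
          rw [hFv ρ v hρ, hFv ρ v hρ, hc i rfl]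
        · push Not at hj
          rw [hFn ρ v x j fun i hi => absurd hi (hj i), hFn ρ v y j fun i hi => absurd hi (hj i)]
      · rintro ⟨i, rfl, hi⟩
        rw [hFv ρ v hρ, hFv ρ v hρ]
        simpa using hi
    have hcomp : f ∘ F σ x₀ = g ∘ F τ y₀ := by
      funext z
      refine Subtype.ext (funext fun h => ?_)
      simp only [Function.comp]
      by_cases hz : ∃ i, k (σ i) = h ∧ z i = true
      · obtain ⟨i, rfl, hi⟩ := hz
        have e1 := hf' (F σ x₀ z) (Function.update x₀ (σ i) (!x₀ (σ i))) (σ i)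
          (by rw [hFv σ x₀ hσ]; simp [hi])
        have e2 := hg' (F τ y₀ z) (Function.update y₀ (τ i) (!y₀ (τ i))) (τ i)
          (by rw [hFv τ y₀ hτ]; simp [hi])
        rw [← (hτP i).1] at e2
        rw [e1, e2, (hτP i).2]
      · push Not at hz
        have e1 : (f (F σ x₀ z)).1 h = (f x₀).1 h := by
          by_contra hc
          obtain ⟨j, rfl, hj⟩ := (hf _ _ _).1 hc
          refine hj (hFn σ x₀ z j fun i hi => ?_)
          simpa using hz i (congrArg k hi)
        have e2 : (g (F τ y₀ z)).1 h = (g y₀).1 h := by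
          by_contra hc
          obtain ⟨j, rfl, hj⟩ := (hg _ _ _).1 hc
          refine hj (hFn τ y₀ z j fun i hi => ?_)
          simpa using hz i ((hτP i).1.trans (congrArg k' hi))
        rw [e1, e2, h₀]
    refine ⟨J.card, F σ x₀, F τ y₀, hFface σ x₀ hσ, hFface τ y₀ hτ, hcomp, ?_⟩
    apply Set.Subset.antisymm
    · rintro _ ⟨⟨x, rfl⟩, ⟨y, hy⟩⟩
      refine ⟨fun i => xor (x₀ (σ i)) (x (σ i)), congrArg f (funext fun j => ?_)⟩
      by_cases hj : ∃ i, σ i = j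
      · obtain ⟨i, rfl⟩ := hj
        rw [hFv σ x₀ hσ]
        simp
      · rw [hFn σ x₀ _ j fun i hi => absurd ⟨i, hi⟩ hj]
        by_contra hne
        have h1 : (f x).1 (k j) ≠ (f x₀).1 (k j) := (hf _ _ _).2 ⟨j, rfl, fun h => hne h.symm⟩
        rw [← hy, h₀] at h1
        obtain ⟨j', hj', hd⟩ := (hg _ _ _).1 h1
        refine hj (hσJ j (Finset.mem_filter.2 ⟨Finset.mem_univ _, j', hj'.symm, ?_⟩))
        have e1 := hf' (Function.update x₀ j (!x₀ j)) x j (by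
          rw [Function.update_self]
          exact (Bool.eq_not_of_ne (fun h => hne h.symm)).symm)
        have e2 := hg' (Function.update y₀ j' (!y₀ j')) y j' (by
          rw [Function.update_self]
          exact (Bool.eq_not_of_ne hd).symm)
        rw [hj'] at e2
        rw [e1, e2, hy]
    · rintro _ ⟨z, rfl⟩
      exact ⟨⟨_, rfl⟩, ⟨F τ y₀ z, (congrFun hcomp z).symm⟩⟩

/-! ### The geometric realization with the `ℓ¹` path metric -/

/-- The multilinear weight of the vertex `x` of the cube `[0,1]ⁿ` at the point `t`. -/
noncomputable def vertexWeight {n : ℕ} (t : Fin n → unitInterval) (x : Fin n → Bool) : ℝ :=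
  ∏ i, if x i then (t i : ℝ) else 1 - (t i : ℝ)

open Classical in
/-- The point with coordinates `t` in the cube `f`, recorded by its weights on the vertices of the
complex. The weights vanish outside the vertices of the smallest face containing the point, and
determine the coordinates of the point in this face. Hence points of two cubes have the
same weights if and only if they are identified in the complex. -/
noncomputable def cubePoint {n : ℕ} (f : (Fin n → Bool) → V) (t : Fin n → unitInterval) : V → ℝ :=
  fun v => ∑ x : Fin n → Bool, if f x = v then vertexWeight t x else 0

/-- The geometric realization: the union of the cubes `[0,1]ⁿ` of the complex, glued along
faces. -/
def Realization (X : CubeComplex V) : Type u :=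
  {p : V → ℝ // ∃ (n : ℕ) (f : (Fin n → Bool) → V) (t : Fin n → unitInterval),
    X.IsCube f ∧ p = cubePoint f t}

/-- The `ℓ¹` distance of two points measured in a cube that contains both of them (infinite if
there is no such cube). -/
noncomputable def cubeDist (X : CubeComplex V) (p q : X.Realization) : ℝ≥0∞ :=
  ⨅ (n : ℕ) (f : (Fin n → Bool) → V) (s : Fin n → unitInterval) (t : Fin n → unitInterval)
    (_ : X.IsCube f ∧ p.1 = cubePoint f s ∧ q.1 = cubePoint f t),
    ENNReal.ofReal (∑ i, |(s i : ℝ) - (t i : ℝ)|)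

/-- The length of the string of points `p, L₁, L₂, …`. -/
noncomputable def stringLength (X : CubeComplex V) : X.Realization → List X.Realization → ℝ≥0∞
  | _, [] => 0
  | p, q :: L => X.cubeDist p q + stringLength X q L

/-- The `ℓ¹` path metric: the infimum of the lengths of strings of points from `p` to `q` with
consecutive points in a common cube. -/
noncomputable def pathDist (X : CubeComplex V) (p q : X.Realization) : ℝ≥0∞ :=
  ⨅ (L : List X.Realization) (_ : L.getLastD p = q), X.stringLength p L

theorem cubeDist_comm (X : CubeComplex V) (p q : X.Realization) :
    X.cubeDist p q = X.cubeDist q p := by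
  have key : ∀ p q : X.Realization, X.cubeDist p q ≤ X.cubeDist q p := by
    intro p q
    refine le_iInf fun n => le_iInf fun f => le_iInf fun s => le_iInf fun t => le_iInf fun h => ?_
    refine iInf_le_of_le n (iInf_le_of_le f (iInf_le_of_le t (iInf_le_of_le s
      (iInf_le_of_le ⟨h.1, h.2.2, h.2.1⟩ ?_))))
    simp only [abs_sub_comm]
    exact le_rfl
  exact le_antisymm (key p q) (key q p)

theorem pathDist_self (X : CubeComplex V) (p : X.Realization) : X.pathDist p p = 0 :=
  le_antisymm (iInf_le_of_le [] (iInf_le_of_le rfl le_rfl)) bot_le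

theorem stringLength_append (X : CubeComplex V) (p : X.Realization) (L M : List X.Realization) :
    X.stringLength p (L ++ M) = X.stringLength p L + X.stringLength (L.getLastD p) M := by
  induction L generalizing p with
  | nil => simp [stringLength]
  | cons a L ih =>
    simp only [List.cons_append, stringLength, ih, add_assoc, List.getLastD_cons]

theorem getLastD_append {α : Type*} (p : α) (L M : List α) :
    (L ++ M).getLastD p = M.getLastD (L.getLastD p) := by
  induction L generalizing p with
  | nil => rfl
  | cons a L ih => simp only [List.cons_append, List.getLastD_cons, ih]

theorem pathDist_triangle (X : CubeComplex V) (p q r : X.Realization) :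
    X.pathDist p r ≤ X.pathDist p q + X.pathDist q r := by
  unfold pathDist
  simp only [ENNReal.iInf_add, ENNReal.add_iInf]
  refine le_iInf fun M => le_iInf fun hM => le_iInf fun L => le_iInf fun hL => ?_
  refine iInf_le_of_le (L ++ M) (iInf_le_of_le ?_ ?_)
  · rw [getLastD_append, hL, hM]
  · rw [stringLength_append, hL]

theorem pathDist_le_cubeDist (X : CubeComplex V) (p q : X.Realization) :
    X.pathDist p q ≤ X.cubeDist p q :=
  iInf_le_of_le [q] (iInf_le_of_le rfl (by simp [stringLength]))

theorem pathDist_le_stringLength (X : CubeComplex V) (p : X.Realization)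
    (L : List X.Realization) : X.pathDist (L.getLastD p) p ≤ X.stringLength p L := by
  induction L generalizing p with
  | nil => simp [pathDist_self]
  | cons a L ih =>
    simp only [stringLength, List.getLastD_cons]
    calc X.pathDist (L.getLastD a) p ≤ X.pathDist (L.getLastD a) a + X.pathDist a p :=
          X.pathDist_triangle _ _ _
      _ ≤ X.stringLength a L + X.cubeDist p a :=
          add_le_add (ih a) ((X.pathDist_le_cubeDist a p).trans_eq (X.cubeDist_comm a p))
      _ = _ := add_comm _ _

theorem pathDist_comm (X : CubeComplex V) (p q : X.Realization) :
    X.pathDist p q = X.pathDist q p := by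
  have key : ∀ p q : X.Realization, X.pathDist q p ≤ X.pathDist p q := by
    intro p q
    refine le_iInf fun L => le_iInf fun hL => ?_
    subst hL
    exact X.pathDist_le_stringLength p L
  exact le_antisymm (key q p) (key p q)

noncomputable instance (X : CubeComplex V) : PseudoEMetricSpace X.Realization where
  edist := X.pathDist
  edist_self := X.pathDist_self
  edist_comm := X.pathDist_comm
  edist_triangle := X.pathDist_triangle

end CubeComplex

/-- For all `R > 0` there is `S > 0` such that points whose images are at distance at most `R` are
at distance at most `S`. -/
def IsCobornologous {A B : Type*} [PseudoEMetricSpace A] [PseudoEMetricSpace B] (φ : A → B) :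
    Prop :=
  ∀ R : ℝ, 0 < R → ∃ S : ℝ, 0 < S ∧
    ∀ x y : A, edist (φ x) (φ y) ≤ ENNReal.ofReal R → edist x y ≤ ENNReal.ofReal S

/-! The proof encodes a CAT(0) cube complex by finite sets of hyperplanes. A vertex `v` becomes the
set `sep hX o v` of hyperplanes that separate it from the base vertex `o`.

From topology to sets. Up to exchanges across squares, every edge path has a reduced form that
depends only on its homotopy class, because three squares around a vertex span a 3-cube
(`PathEquiv.trans_aux`, `Homotopic.normalForm`). A geodesic is its own reduced form, so two
geodesics with the same ends differ by square exchanges. This gives the quadrangle condition, and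
with it the existence of medians (`exists_median`). The parity with which a path crosses a
hyperplane is a homotopy invariant and a geodesic crosses no hyperplane twice, so distance is the
number of separating hyperplanes. Hence the sets `sep hX o v` form a median family
(`isMedianFamily_sep`).

From sets to topology. A median family consists of down-closed sets of a partial order. Any complex
that carries all the cubes of such a family is CAT(0), with one hyperplane for each point of the
family: sets shrink to the empty set by removing maximal points, two ways of shrinking differ by
squares, and missing corners of cubes are majorities (`IsMedianModel.isCAT0`,
`IsMedianModel.exists_label`). Keeping only the hyperplanes of a subset `K` preserves median
families, which settles the restricted complex (`isMedianModel_restrict`).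

The map. Sending `v` to its hyperplanes of colour 0 is only 1-Lipschitz. To gain the factor, lower
the coordinate by `1 / (l + 1)` at each outer hyperplane: colour 0, with no hyperplane of colour 1
between it and `v`. There are at most `l` of them, since they are crossed by a monochromatic inward
geodesic. An outward edge of colour 0 creates one new coordinate `l / (l + 1)`; one of colour 1
makes at most `l` hyperplanes cease to be outer, each regaining `1 / (l + 1)`. Either way
coordinates only increase, by at most `l / (l + 1)` in total (`outerCoord_edge`).

These coordinates need not be those of a point: below a nonzero coordinate everything must be full.
Pouring mass down the order repairs this (`exists_pour`). Pouring is monotone and preserves mass, so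
for comparable functions, whose `ℓ¹` distance is a difference of masses, it is an isometry. The
vertex coordinates are extended multilinearly over cubes; moving along one cube direction gives
comparable functions, so the Lipschitz bound survives (`exists_map_of_coords`).

The image of a vertex stays within `ℓ¹` distance 1 of the obvious vertex, so close images are
separated by few hyperplanes of colour 0. Between two of these an inward geodesic crosses at most
`l` of colour 1, so the original points are close too. -/

namespace CubeComplex

variable {V : Type u} {X : CubeComplex V}

/-! ### Edges and squares -/

/-- The vertex of the cube obtained from `x` by changing the coordinate `i`. -/
def flip {n : ℕ} (i : Fin n) (x : Fin n → Bool) : Fin n → Bool := Function.update x i (!x i)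

theorem flip_same {n : ℕ} (i : Fin n) (x : Fin n → Bool) : flip i x i = !x i := by simp [flip]

theorem flip_ne {n : ℕ} {i j : Fin n} (h : j ≠ i) (x : Fin n → Bool) : flip i x j = x j := by
  simp [flip, h]

theorem flip_flip {n : ℕ} (i : Fin n) (x : Fin n → Bool) : flip i (flip i x) = x := by
  funext j
  by_cases h : j = i
  · subst h; simp [flip]
  · simp [flip, h]

theorem flip_comm {n : ℕ} (i j : Fin n) (x : Fin n → Bool) :
    flip i (flip j x) = flip j (flip i x) := by
  funext m
  by_cases hij : i = j
  · rw [hij]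
  by_cases h : m = i
  · subst h; rw [flip_same, flip_ne hij, flip_ne hij, flip_same]
  · by_cases h' : m = j
    · subst h'; rw [flip_ne h, flip_same, flip_same, flip_ne h]
    · rw [flip_ne h, flip_ne h', flip_ne h', flip_ne h]

theorem adj_flip {n : ℕ} {f : (Fin n → Bool) → V} (hf : X.IsCube f) (x : Fin n → Bool) (i : Fin n) :
    X.skeleton.Adj (f x) (f (flip i x)) := by
  refine ⟨f ∘ fun b m => if m = i then xor (x i) (b 0) else x m, X.face hf ⟨![i], ?_, ?_⟩, ?_, ?_⟩
  · intro a b _; exact Subsingleton.elim a b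
  · intro a b m
    by_cases h : m = i
    · subst h; simp
    · simp [h, Ne.symm h]
  · simp only [Function.comp]
    congr 1
    funext m
    by_cases h : m = i
    · subst h; simp
    · simp [h]
  · simp only [Function.comp]
    congr 1
    funext m
    by_cases h : m = i
    · subst h; simp [flip]
    · simp [h, flip]

theorem isSquare_flip {n : ℕ} {f : (Fin n → Bool) → V} (hf : X.IsCube f) (x : Fin n → Bool)
    {i j : Fin n} (hij : i ≠ j) :
    X.IsSquare (f x) (f (flip i x)) (f (flip j (flip i x))) (f (flip j x)) := by
  have hji := hij.symm
  refine ⟨f ∘ fun b m => if m = i then xor (x i) (b 0) else if m = j then xor (x j) (b 1) else x m,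
    X.face hf ⟨![i, j], ?_, ?_⟩, ?_, ?_, ?_, ?_⟩
  · intro a b h
    fin_cases a <;> fin_cases b <;> simp_all
  · intro a b m
    simp only [Fin.exists_fin_two]
    by_cases h : m = i
    · subst h; simp [hji]
    · by_cases h' : m = j
      · subst h'; simp [h, hij]
      · simp [h, h', Ne.symm h, Ne.symm h']
  all_goals
    simp only [Function.comp]
    congr 1
    funext m
    by_cases h : m = i
    · subst h; simp [flip, hij]
    · by_cases h' : m = j
      · subst h'; simp [h, flip]
      · simp [h, h', flip]

theorem flip_zero_two (a b : Bool) : flip (0 : Fin 2) ![a, b] = ![!a, b] := by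
  funext i; fin_cases i <;> simp [flip]

theorem flip_one_two (a b : Bool) : flip (1 : Fin 2) ![a, b] = ![a, !b] := by
  funext i; fin_cases i <;> simp [flip]

namespace IsSquare

variable {p q r s : V}

theorem rotate (h : X.IsSquare p q r s) : X.IsSquare q r s p := by
  obtain ⟨f, hf, rfl, rfl, rfl, rfl⟩ := h
  have := isSquare_flip hf ![true, false] (i := 1) (j := 0) (by decide)
  simpa [flip_zero_two, flip_one_two] using this

theorem reflect (h : X.IsSquare p q r s) : X.IsSquare p s r q := by
  obtain ⟨f, hf, rfl, rfl, rfl, rfl⟩ := h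
  have := isSquare_flip hf ![false, false] (i := 1) (j := 0) (by decide)
  simpa [flip_zero_two, flip_one_two] using this

theorem adj (h : X.IsSquare p q r s) : X.skeleton.Adj p q := by
  obtain ⟨f, hf, rfl, rfl, rfl, rfl⟩ := h
  have := adj_flip hf ![false, false] 0
  simpa [flip_zero_two, flip_one_two] using this

theorem adj' (h : X.IsSquare p q r s) : X.skeleton.Adj q r := h.rotate.adj

theorem ne (h : X.IsSquare p q r s) : p ≠ r := by
  obtain ⟨f, hf, rfl, rfl, rfl, rfl⟩ := h
  intro he
  have := congrFun (X.injective hf he) 0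
  simp at this

theorem ne' (h : X.IsSquare p q r s) : q ≠ s := h.rotate.ne

theorem range_eq {f : (Fin 2 → Bool) → V} :
    Set.range f = {f ![false, false], f ![true, false], f ![true, true], f ![false, true]} := by
  ext v
  constructor
  · rintro ⟨x, rfl⟩
    have hx : x = ![x 0, x 1] := by funext i; fin_cases i <;> rfl
    rw [hx]
    cases x 0 <;> cases x 1 <;> simp
  · rintro (rfl | rfl | rfl | rfl) <;> exact ⟨_, rfl⟩

/-- The two squares meet in a common face with `2 ^ k` vertices. It contains the three distinct
vertices `p`, `q`, `r`, so `k = 2` and the squares have the same vertex set. -/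
theorem unique (h : X.IsSquare p q r s) {s' : V} (h' : X.IsSquare p q r s') : s = s' := by
  have hpq := h.adj.ne
  have hqr := h.adj'.ne
  have hpr := h.ne
  have hs1 := h.reflect.adj.ne
  have hs2 := h.rotate.rotate.adj.ne
  have hs3 := h.ne'
  obtain ⟨f, hf, rfl, rfl, rfl, rfl⟩ := h
  obtain ⟨g, hg, hgp, hgq, hgr, rfl⟩ := h'
  obtain ⟨k, a, b, ⟨σ, hσ, ha⟩, hb, hab, hI⟩ := X.inter _ _ hf hg hgp.symm
  have hf2 := range_eq (f := f)
  have hg2 := range_eq (f := g)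
  rw [hgp, hgq, hgr] at hg2
  have hk2 : k ≤ 2 := by simpa using Fintype.card_le_of_injective σ hσ
  have hinj : Function.Injective (f ∘ a) := by
    refine (X.injective hf).comp fun x y hxy => ?_
    funext i
    by_contra hi
    exact (ha x y (σ i)).2 ⟨i, rfl, hi⟩ (by rw [hxy])
  have hcard : (Set.range (f ∘ a)).ncard = 2 ^ k := by
    rw [← Set.image_univ, Set.ncard_image_of_injective _ hinj, Set.ncard_univ]
    simp
  have h3 : 3 ≤ (Set.range (f ∘ a)).ncard := by
    have h3' : ({f ![false, false], f ![true, false], f ![true, true]} : Set V).ncard = 3 :=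
      Set.ncard_eq_three.2 ⟨_, _, _, hpq, hpr, hqr, rfl⟩
    rw [← h3']
    refine Set.ncard_le_ncard ?_ (Set.finite_range _)
    rw [← hI, hf2, hg2]
    rintro v (rfl | rfl | rfl) <;> simp
  have hk : k = 2 := by
    by_contra hne
    have : k ≤ 1 := by omega
    have h2 : 2 ^ k ≤ 2 ^ 1 := Nat.pow_le_pow_right (by norm_num) this
    omega
  have hrange : Set.range (f ∘ a) = Set.range f := by
    refine Set.eq_of_subset_of_ncard_le (Set.range_comp_subset_range _ _) ?_ (Set.finite_range _)
    rw [hcard, hk, ← Set.image_univ, Set.ncard_image_of_injective _ (X.injective hf),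
      Set.ncard_univ]
    simp
  have hmem : f ![false, true] ∈ Set.range g := by
    have : f ![false, true] ∈ Set.range f := ⟨_, rfl⟩
    rw [← hrange, ← hI] at this
    exact this.2
  rw [hg2] at hmem
  rcases hmem with h | h | h | h
  · exact absurd h.symm hs1
  · exact absurd h.symm hs3
  · exact absurd h.symm hs2
  · exact h

/-- The corner opposite to `p` is determined by `p` and its neighbours. -/
theorem unique_opposite (h : X.IsSquare p q r s) {r' : V} (h' : X.IsSquare p q r' s) : r = r' :=
  h.reflect.rotate.rotate.rotate.unique h'.reflect.rotate.rotate.rotate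

end IsSquare

/-- Three squares around a vertex of a flag complex span a 3-cube. -/
theorem HasFlagLinks.exists_cube (hX : X.HasFlagLinks) {v a b c ab bc ac : V}
    (hab : X.IsSquare v a ab b) (hbc : X.IsSquare v b bc c) (hac : X.IsSquare v a ac c) :
    ∃ t, X.IsSquare c ac t bc ∧ X.IsSquare ac a ab t ∧ X.IsSquare bc b ab t := by
  obtain ⟨f, hf, h0, hi⟩ := hX v 3 ![a, b, c] (by
      intro i j hij
      fin_cases i <;> fin_cases j <;>
        first
        | rfl
        | exact absurd hij hab.ne'
        | exact absurd hij hab.ne'.symm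
        | exact absurd hij hac.ne'
        | exact absurd hij hac.ne'.symm
        | exact absurd hij hbc.ne'
        | exact absurd hij hbc.ne'.symm)
    (by
      intro i
      fin_cases i
      · exact hab.adj
      · exact hbc.adj
      · exact hac.reflect.adj)
    (by
      intro i j hij
      fin_cases i <;> fin_cases j <;>
        first
        | exact absurd rfl hij
        | exact ⟨_, hab⟩
        | exact ⟨_, hab.reflect⟩
        | exact ⟨_, hac⟩
        | exact ⟨_, hac.reflect⟩
        | exact ⟨_, hbc⟩
        | exact ⟨_, hbc.reflect⟩)
  have e0 : (fun j : Fin 3 => decide (j = 0)) = flip 0 (fun _ => false) := by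
    funext j; fin_cases j <;> simp [flip]
  have e1 : (fun j : Fin 3 => decide (j = 1)) = flip 1 (fun _ => false) := by
    funext j; fin_cases j <;> simp [flip]
  have e2 : (fun j : Fin 3 => decide (j = 2)) = flip 2 (fun _ => false) := by
    funext j; fin_cases j <;> simp [flip]
  have ha : f (flip 0 (fun _ => false)) = a := by rw [← e0]; exact hi 0
  have hb : f (flip 1 (fun _ => false)) = b := by rw [← e1]; exact hi 1
  have hc : f (flip 2 (fun _ => false)) = c := by rw [← e2]; exact hi 2
  have sab := isSquare_flip hf (fun _ => false) (i := 0) (j := 1) (by decide)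
  have sbc := isSquare_flip hf (fun _ => false) (i := 1) (j := 2) (by decide)
  have sac := isSquare_flip hf (fun _ => false) (i := 0) (j := 2) (by decide)
  rw [h0, ha, hb] at sab
  rw [h0, hb, hc] at sbc
  rw [h0, ha, hc] at sac
  -- The squares of the cube supplied by the flag condition are the given ones, since two sides at a
  -- corner determine a square.
  have hab' := sab.unique_opposite hab
  have hbc' := sbc.unique_opposite hbc
  have hac' := sac.unique_opposite hac
  refine ⟨f (flip 0 (flip 1 (flip 2 fun _ => false))), ?_, ?_, ?_⟩
  · have := isSquare_flip hf (flip 2 fun _ => false) (i := 0) (j := 1) (by decide)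
    rw [hc, flip_comm 0 2, hac', flip_comm 1 2 (fun _ => false), hbc'] at this
    rwa [flip_comm 0 1, flip_comm 0 2]
  · have := isSquare_flip hf (flip 2 (flip 0 fun _ => false)) (i := 2) (j := 1) (by decide)
    rw [hac', flip_flip, ha, hab'] at this
    rwa [flip_comm 0 1, flip_comm 0 2]
  · have := isSquare_flip hf (flip 2 (flip 1 fun _ => false)) (i := 2) (j := 0) (by decide)
    rw [hbc', flip_flip, hb, flip_comm 0 1, hab'] at this
    rwa [flip_comm 1 2]

end CubeComplex

namespace CubeComplex

variable {V : Type u} {X : CubeComplex V}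

/-! ### Normal forms of edge paths -/

/-- Edge paths (as lists of vertices) that differ by pushing the path across 2-cubes without
changing its length. The relation is set up so that the first edges of equivalent paths agree or
span a 2-cube. -/
inductive PathEquiv (X : CubeComplex V) : List V → List V → Prop
  | nil (v : V) : PathEquiv X [v] [v]
  | cons (v : V) {u : V} {p q : List V} : PathEquiv X (u :: p) (u :: q) →
      PathEquiv X (v :: u :: p) (v :: u :: q)
  | square {v u₁ z u₂ : V} {p₁ p₂ r : List V} : X.IsSquare v u₁ z u₂ →
      PathEquiv X (u₁ :: p₁) (u₁ :: z :: r) → PathEquiv X (u₂ :: p₂) (u₂ :: z :: r) →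
      PathEquiv X (v :: u₁ :: p₁) (v :: u₂ :: p₂)

namespace PathEquiv

theorem refl : ∀ (v : V) (p : List V), X.PathEquiv (v :: p) (v :: p)
  | v, [] => .nil v
  | v, u :: p => .cons v (refl u p)

theorem symm {p q : List V} (h : X.PathEquiv p q) : X.PathEquiv q p := by
  induction h with
  | nil v => exact .nil v
  | cons v _ ih => exact .cons v ih
  | square hs h1 h2 _ _ => exact .square hs.reflect h2 h1

theorem length_eq {p q : List V} (h : X.PathEquiv p q) : p.length = q.length := by
  induction h with
  | nil v => rfl
  | cons v _ ih => simpa using ih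
  | square hs h1 h2 i1 i2 => simp only [List.length_cons] at i1 i2 ⊢; omega

theorem head_eq {v w : V} {p q : List V} (h : X.PathEquiv (v :: p) (w :: q)) : v = w := by
  cases h <;> rfl

theorem inv {v u₁ u₂ : V} {p₁ p₂ : List V}
    (h : X.PathEquiv (v :: u₁ :: p₁) (v :: u₂ :: p₂)) :
    (u₁ = u₂ ∧ X.PathEquiv (u₁ :: p₁) (u₁ :: p₂)) ∨
    ∃ z r, X.IsSquare v u₁ z u₂ ∧ X.PathEquiv (u₁ :: p₁) (u₁ :: z :: r) ∧
      X.PathEquiv (u₂ :: p₂) (u₂ :: z :: r) := by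
  cases h with
  | cons _ h => exact .inl ⟨rfl, h⟩
  | square hs h1 h2 => exact .inr ⟨_, _, hs, h1, h2⟩

/-- Transitivity is the price for a relation that can be inverted at the first edge, and the place
where flag links enter. For exchanges across `v u₀ z u₁` and `v u₁ z' u₂`, either `z = z'`, and then
`u₀ = u₂`, or induction gives a third square at `u₁` on `z` and `z'`. The three squares at `u₁` span
a cube, and its corner `t` opposite to `u₁` gives a direct exchange across `v u₀ t u₂`. -/
theorem trans_aux (hX : X.HasFlagLinks) : ∀ (n : ℕ) {p q r : List V}, p.length ≤ n →
    X.PathEquiv p q → X.PathEquiv q r → X.PathEquiv p r := by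
  intro n
  induction n with
  | zero =>
    intro p q r hn h1 h2
    cases h1 <;> simp at hn
  | succ n ih =>
    intro p q r hn h1 h2
    have hl := h1.length_eq
    cases h1 with
    | nil v => exact h2
    | @cons v u p q h1 =>
      have hn' : (u :: p).length ≤ n := by simpa using hn
      cases h2 with
      | cons _ h2 => exact .cons v (ih hn' h1 h2)
      | square hs h2 h3 => exact .square hs (ih hn' h1 h2) h3
    | @square v u₀ z u₁ p₀ p₁ r h0 h1 h1' =>
      have hn0 : (u₀ :: p₀).length ≤ n := by simpa using hn
      have hn1 : (u₁ :: p₁).length ≤ n := by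
        simp only [List.length_cons] at hl hn0 ⊢; omega
      have hnr : (z :: r).length + 1 ≤ n := by
        have := h1.length_eq
        simp only [List.length_cons] at this hn0 ⊢; omega
      cases h2 with
      | @cons _ _ _ p₂ h2 =>
        exact .square h0 h1 (ih (by rw [← h2.length_eq]; exact hn1) h2.symm h1')
      | @square _ _ z' u₂ _ p₂ r' h0' h2 h2' =>
        have hzz := ih (by simpa using hnr) h1'.symm h2
        have hn2 : (u₂ :: p₂).length ≤ n := by
          have e1 := h2'.length_eq
          have e2 := hzz.length_eq
          simp only [List.length_cons] at e1 e2 hnr ⊢; omega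
        have hn2' : (u₂ :: z' :: r').length ≤ n := by rw [← h2'.length_eq]; exact hn2
        rcases hzz.inv with ⟨rfl, hr⟩ | ⟨s, q, hs, hr, hr'⟩
        · obtain rfl : u₀ = u₂ := h0.reflect.unique h0'
          exact .cons v (ih hn0 h1 (ih (by simpa using hnr) (.cons u₀ hr) h2'.symm))
        · obtain ⟨t, t1, t2, t3⟩ := hX.exists_cube hs h0'.rotate h0.reflect.rotate
          have hl1 : (u₀ :: z :: r).length ≤ n := by simpa using hnr
          exact .square t1 (ih hn0 h1 (ih hl1 (.cons u₀ hr) (.square t2 (refl _ _) (refl _ _))))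
            (ih hn2 h2' (ih hn2' (.cons u₂ hr') (.square t3 (refl _ _) (refl _ _))))

theorem trans (hX : X.HasFlagLinks) {p q r : List V} (h1 : X.PathEquiv p q)
    (h2 : X.PathEquiv q r) : X.PathEquiv p r := trans_aux hX _ le_rfl h1 h2

theorem isChain_iff {p q : List V} (h : X.PathEquiv p q) :
    p.IsChain X.skeleton.Adj ↔ q.IsChain X.skeleton.Adj := by
  induction h with
  | nil v => rfl
  | cons v _ ih => rw [List.isChain_cons_cons, List.isChain_cons_cons, ih]
  | square hs h1 h2 i1 i2 =>
    rw [List.isChain_cons_cons, List.isChain_cons_cons, i1, i2, List.isChain_cons_cons,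
      List.isChain_cons_cons]
    have a1 := hs.adj
    have a2 := hs.adj'
    have a3 := hs.reflect.adj
    have a4 := hs.reflect.adj'
    tauto

theorem getLast?_eq {p q : List V} (h : X.PathEquiv p q) : p.getLast? = q.getLast? := by
  induction h with
  | nil v => rfl
  | cons v _ ih => simpa [List.getLast?_cons_cons] using ih
  | square hs h1 h2 i1 i2 =>
    simp only [List.getLast?_cons_cons] at i1 i2 ⊢
    rw [i1, i2]

end PathEquiv

/-- No path equivalent to the given one backtracks. -/
def IsReduced (X : CubeComplex V) : List V → Prop
  | v :: u :: p => IsReduced X (u :: p) ∧ ¬∃ q, X.PathEquiv (u :: p) (u :: v :: q)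
  | _ => True

/-- In an exchange across `v u₁ z u₂`, a backtrack in a path through `u₂` is carried by that same
square to a backtrack in a path through `u₁`. -/
theorem IsReduced.of_pathEquiv_aux (hX : X.HasFlagLinks) : ∀ (n : ℕ) {p q : List V}, p.length ≤ n →
    X.PathEquiv p q → X.IsReduced p → X.IsReduced q := by
  intro n
  induction n with
  | zero =>
    intro p q hn h1
    cases h1 <;> simp at hn
  | succ n ih =>
    intro p q hn h hp
    cases h with
    | nil v => exact hp
    | @cons v u p q h =>
      refine ⟨ih (by simpa using hn) h hp.1, ?_⟩
      rintro ⟨q', hq'⟩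
      exact hp.2 ⟨q', h.trans hX hq'⟩
    | @square v u₁ z u₂ p₁ p₂ r hs h1 h2 =>
      have hn1 : (u₁ :: p₁).length ≤ n := by simpa using hn
      have hr := ih hn1 h1 hp.1
      have hz : X.IsReduced (u₂ :: z :: r) := by
        refine ⟨hr.1, ?_⟩
        rintro ⟨q, hq⟩
        exact hp.2 ⟨_, h1.trans hX ((PathEquiv.cons u₁ hq).trans hX
          (.square hs.rotate (.refl _ _) (.refl _ _)))⟩
      have hl1 := h1.length_eq
      simp only [List.length_cons] at hl1 hn1
      refine ⟨ih (by simp only [List.length_cons]; omega) h2.symm hz, ?_⟩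
      rintro ⟨q, hq⟩
      rcases (h2.symm.trans hX hq).inv with ⟨rfl, -⟩ | ⟨s, r', hs', hr1, hr2⟩
      · exact hs.ne rfl
      · obtain rfl : u₁ = s := hs.rotate.rotate.rotate.reflect.unique_opposite hs'
        exact hr.2 ⟨_, hr1⟩

theorem IsReduced.of_pathEquiv (hX : X.HasFlagLinks) {p q : List V} (h : X.PathEquiv p q)
    (hp : X.IsReduced p) : X.IsReduced q := of_pathEquiv_aux hX _ le_rfl h hp

open Classical in
/-- Extend a reduced path to the vertex `u`, and cancel a backtrack if there is one. -/
noncomputable def reducedCons (X : CubeComplex V) (u : V) (p : List V) : List V :=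
  if h : ∃ v q, X.PathEquiv p (v :: u :: q) then u :: h.choose_spec.choose else u :: p

/-- Up to equivalence the choice made in `reducedCons` does not matter: two continuations through
the same vertex `u` cannot be exchanged across a square, whose second and fourth corners differ. -/
theorem reducedCons_pos (hX : X.HasFlagLinks) {u v : V} {p q : List V}
    (h : X.PathEquiv p (v :: u :: q)) : X.PathEquiv (X.reducedCons u p) (u :: q) := by
  have hex : ∃ v q, X.PathEquiv p (v :: u :: q) := ⟨v, q, h⟩
  rw [reducedCons, dif_pos hex]
  have h2 := h.symm.trans hX hex.choose_spec.choose_spec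
  obtain rfl : v = _ := h2.head_eq
  rcases h2.inv with ⟨-, h3⟩ | ⟨z, r, hs, -, -⟩
  · exact h3.symm
  · exact absurd rfl hs.ne'

theorem reducedCons_neg {u : V} {p : List V} (h : ¬∃ v q, X.PathEquiv p (v :: u :: q)) :
    X.reducedCons u p = u :: p := by
  rw [reducedCons, dif_neg h]

theorem reducedCons_congr (hX : X.HasFlagLinks) (u : V) {v : V} {p q : List V}
    (h : X.PathEquiv (v :: p) (v :: q)) :
    X.PathEquiv (X.reducedCons u (v :: p)) (X.reducedCons u (v :: q)) := by
  by_cases hex : ∃ w r, X.PathEquiv (v :: p) (w :: u :: r)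
  · obtain ⟨w, r, hr⟩ := hex
    exact (reducedCons_pos hX hr).trans hX (reducedCons_pos hX (h.symm.trans hX hr)).symm
  · have hex' : ¬∃ w r, X.PathEquiv (v :: q) (w :: u :: r) := by
      rintro ⟨w, r, hr⟩
      exact hex ⟨w, r, h.trans hX hr⟩
    rw [reducedCons_neg hex, reducedCons_neg hex']
    exact .cons u h

theorem exists_reducedCons_eq (u : V) (p : List V) : ∃ q, X.reducedCons u p = u :: q := by
  rw [reducedCons]
  split_ifs <;> exact ⟨_, rfl⟩

theorem IsReduced.reducedCons (hX : X.HasFlagLinks) {u v : V} {p : List V}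
    (h : X.IsReduced (v :: p)) : X.IsReduced (X.reducedCons u (v :: p)) := by
  by_cases hex : ∃ w r, X.PathEquiv (v :: p) (w :: u :: r)
  · obtain ⟨w, r, hr⟩ := hex
    exact ((h.of_pathEquiv hX hr).1).of_pathEquiv hX (reducedCons_pos hX hr).symm
  · rw [reducedCons_neg hex]
    exact ⟨h, fun ⟨q, hq⟩ => hex ⟨_, _, hq⟩⟩

/-- Edges act on classes of reduced paths, and an edge followed by its inverse must act trivially.
One of the two steps cancels and the other does not; if the first one cancels, the second cannot
because the path was reduced. -/
theorem reducedCons_backtrack (hX : X.HasFlagLinks) {u v : V} {p : List V}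
    (h : X.IsReduced (u :: p)) :
    X.PathEquiv (X.reducedCons u (X.reducedCons v (u :: p))) (u :: p) := by
  by_cases hex : ∃ w r, X.PathEquiv (u :: p) (w :: v :: r)
  · obtain ⟨w, r, hr⟩ := hex
    obtain rfl : u = w := hr.head_eq
    have h1 := reducedCons_pos hX hr
    obtain ⟨q, hq⟩ := exists_reducedCons_eq (X := X) v (u :: p)
    rw [hq] at h1 ⊢
    refine (reducedCons_congr hX u h1).trans hX ?_
    rw [reducedCons_neg]
    · exact hr.symm
    · rintro ⟨w, s, hs⟩
      obtain rfl : v = w := hs.head_eq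
      exact (h.of_pathEquiv hX hr).2 ⟨_, hs⟩
  · rw [reducedCons_neg hex]
    exact reducedCons_pos hX (.refl v (u :: p))

/-- The two ways around a square act alike when the step to `q` cancels. If the step to `s` cancels
too, both sides reduce to the tail behind `p`; otherwise the step from `s` to `p` cancels after an
exchange across the square. -/
theorem reducedCons_square_aux (hX : X.HasFlagLinks) {p q r s : V} (hs : X.IsSquare p q r s)
    {t : List V} (hq : ∃ w, X.PathEquiv (r :: t) (r :: q :: w)) :
    X.PathEquiv (X.reducedCons p (X.reducedCons q (r :: t)))
      (X.reducedCons p (X.reducedCons s (r :: t))) := by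
  obtain ⟨w, hw⟩ := hq
  obtain ⟨t1, ht1⟩ := exists_reducedCons_eq (X := X) q (r :: t)
  have e1 := reducedCons_pos hX hw
  rw [ht1] at e1 ⊢
  refine (reducedCons_congr hX p e1).trans hX ?_
  by_cases hsex : ∃ v q, X.PathEquiv (r :: t) (v :: s :: q)
  · obtain ⟨v, w', hw'⟩ := hsex
    obtain rfl : r = v := hw'.head_eq
    rcases (hw.symm.trans hX hw').inv with ⟨h, -⟩ | ⟨z, m, hz, hm1, hm2⟩
    · exact absurd h hs.ne'
    · obtain rfl : p = z := hs.rotate.rotate.reflect.unique_opposite hz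
      have e2 := (reducedCons_pos hX hw').trans hX hm2
      obtain ⟨t2, ht2⟩ := exists_reducedCons_eq (X := X) s (r :: t)
      rw [ht2] at e2 ⊢
      exact (reducedCons_pos hX hm1).trans hX ((reducedCons_congr hX p e2).trans hX
        (reducedCons_pos hX (.refl _ _))).symm
  · rw [reducedCons_neg hsex]
    have h3 : X.PathEquiv (s :: r :: t) (s :: p :: q :: w) :=
      (PathEquiv.cons s hw).trans hX (.square (r := w) hs.rotate.rotate.rotate.reflect (.refl _ _) (.refl _ _))
    refine PathEquiv.trans hX ?_ (reducedCons_pos hX h3).symm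
    rw [reducedCons_neg]
    · exact .refl _ _
    · rintro ⟨v, w', hw'⟩
      obtain rfl : q = v := hw'.head_eq
      exact hsex ⟨_, _, hw.trans hX ((PathEquiv.cons r hw').trans hX
        (.square hs.rotate.rotate.reflect (.refl _ _) (.refl _ _)))⟩

theorem reducedCons_square (hX : X.HasFlagLinks) {p q r s : V} (hs : X.IsSquare p q r s)
    {t : List V} :
    X.PathEquiv (X.reducedCons p (X.reducedCons q (r :: t)))
      (X.reducedCons p (X.reducedCons s (r :: t))) := by
  by_cases hq : ∃ v w, X.PathEquiv (r :: t) (v :: q :: w)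
  · obtain ⟨v, w, hw⟩ := hq
    obtain rfl : r = v := hw.head_eq
    exact reducedCons_square_aux hX hs ⟨w, hw⟩
  by_cases hs' : ∃ v w, X.PathEquiv (r :: t) (v :: s :: w)
  · obtain ⟨v, w, hw⟩ := hs'
    obtain rfl : r = v := hw.head_eq
    exact (reducedCons_square_aux hX hs.reflect ⟨w, hw⟩).symm
  -- If neither `q` nor `s` cancels, `p` does not cancel either, since that would force an
  -- equivalent path continuing through the fourth corner. The two results then differ by one
  -- exchange.
  have key : ∀ q s, X.IsSquare p q r s → (¬∃ v w, X.PathEquiv (r :: t) (v :: s :: w)) →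
      ¬∃ v w, X.PathEquiv (q :: r :: t) (v :: p :: w) := by
    rintro q s hs hs' ⟨v, w, hw⟩
    obtain rfl : q = v := hw.head_eq
    rcases hw.inv with ⟨h, -⟩ | ⟨z, m, hz, hm1, hm2⟩
    · exact hs.ne h.symm
    · obtain rfl : s = z := hs.rotate.unique_opposite hz
      exact hs' ⟨_, _, hm1⟩
  rw [reducedCons_neg hq, reducedCons_neg hs', reducedCons_neg (key q s hs hs'),
    reducedCons_neg (key s q hs.reflect hq)]
  exact .square hs (.refl _ _) (.refl _ _)

/-- The reduced path homotopic to a given path. -/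
noncomputable def normalForm (X : CubeComplex V) : List V → List V
  | v :: u :: p => X.reducedCons v (normalForm X (u :: p))
  | p => p

theorem exists_normalForm_eq (v : V) (p : List V) : ∃ q, X.normalForm (v :: p) = v :: q := by
  cases p with
  | nil => exact ⟨[], rfl⟩
  | cons u p => exact exists_reducedCons_eq _ _

theorem isReduced_normalForm (hX : X.HasFlagLinks) (v : V) (p : List V) :
    X.IsReduced (X.normalForm (v :: p)) := by
  induction p generalizing v with
  | nil => trivial
  | cons u p ih =>
    obtain ⟨q, hq⟩ := exists_normalForm_eq (X := X) u p
    have := ih u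
    rw [normalForm, hq] at *
    exact this.reducedCons hX

/-- Since edges act on classes of reduced paths compatibly with backtracks and squares, the
generators of homotopy leave the class of the result unchanged. -/
theorem Homotopic.normalForm (hX : X.HasFlagLinks) {u v : V} {p q : X.skeleton.Walk u v}
    (h : X.Homotopic p q) : X.PathEquiv (X.normalForm p.support) (X.normalForm q.support) := by
  have hsupp : ∀ {a b : V} (w : X.skeleton.Walk a b), w.support = a :: w.support.tail :=
    fun w => (w.cons_tail_support).symm
  induction h with
  | @refl u v p =>
    rw [hsupp p]
    obtain ⟨q, hq⟩ := exists_normalForm_eq (X := X) u p.support.tail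
    rw [hq]
    exact .refl _ _
  | symm _ ih => exact ih.symm
  | trans _ _ i1 i2 => exact i1.trans hX i2
  | @cons u v w h p q _ ih =>
    rw [SimpleGraph.Walk.support_cons, SimpleGraph.Walk.support_cons]
    rw [hsupp p, hsupp q] at ih ⊢
    obtain ⟨p', hp⟩ := exists_normalForm_eq (X := X) v p.support.tail
    obtain ⟨q', hq⟩ := exists_normalForm_eq (X := X) v q.support.tail
    rw [CubeComplex.normalForm, CubeComplex.normalForm]
    rw [hp, hq] at ih ⊢
    exact reducedCons_congr hX u ih
  | @backtrack u v w h p =>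
    rw [SimpleGraph.Walk.support_cons, SimpleGraph.Walk.support_cons]
    rw [hsupp p, CubeComplex.normalForm, CubeComplex.normalForm]
    have hr := isReduced_normalForm hX u p.support.tail
    obtain ⟨p', hp⟩ := exists_normalForm_eq (X := X) u p.support.tail
    rw [hp] at hr ⊢
    exact reducedCons_backtrack hX hr
  | @square p q r s w hpq hqr hps hsr t hs =>
    simp only [SimpleGraph.Walk.support_cons]
    rw [hsupp t]
    simp only [CubeComplex.normalForm]
    obtain ⟨t', ht⟩ := exists_normalForm_eq (X := X) r t.support.tail
    rw [ht]
    exact reducedCons_square hX hs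

theorem length_reducedCons (u : V) (p : List V) :
    X.reducedCons u p = u :: p ∨ (X.reducedCons u p).length < p.length := by
  by_cases h : ∃ v q, X.PathEquiv p (v :: u :: q)
  · right
    rw [reducedCons, dif_pos h, h.choose_spec.choose_spec.length_eq]
    simp
  · exact .inl (reducedCons_neg h)

theorem normalForm_eq_or_length_lt (v : V) (p : List V) :
    X.normalForm (v :: p) = v :: p ∨ (X.normalForm (v :: p)).length < (v :: p).length := by
  induction p generalizing v with
  | nil => exact .inl rfl
  | cons u p ih =>
    rw [normalForm]
    rcases length_reducedCons (X := X) v (X.normalForm (u :: p)) with h | h <;>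
      rcases ih u with h' | h'
    · rw [h, h']; exact .inl rfl
    · rw [h]; right; simp only [List.length_cons] at h' ⊢; omega
    · rw [h'] at h ⊢; right; simp only [List.length_cons] at h ⊢; omega
    · right; simp only [List.length_cons] at h h' ⊢; omega

theorem reducedCons_isChain {u v : V} {p : List V} (h : X.skeleton.Adj u v)
    (hp : (v :: p).IsChain X.skeleton.Adj) :
    (X.reducedCons u (v :: p)).IsChain X.skeleton.Adj ∧
      (X.reducedCons u (v :: p)).getLast? = (v :: p).getLast? := by
  by_cases hex : ∃ w q, X.PathEquiv (v :: p) (w :: u :: q)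
  · rw [reducedCons, dif_pos hex]
    have h1 := hex.choose_spec.choose_spec
    rw [h1.isChain_iff, List.isChain_cons_cons] at hp
    refine ⟨hp.2, ?_⟩
    conv_rhs => rw [h1.getLast?_eq]
    rw [List.getLast?_cons_cons]
  · rw [reducedCons_neg hex]
    exact ⟨List.isChain_cons_cons.2 ⟨h, hp⟩, List.getLast?_cons_cons⟩

theorem normalForm_isChain (v : V) (p : List V) (hp : (v :: p).IsChain X.skeleton.Adj) :
    (X.normalForm (v :: p)).IsChain X.skeleton.Adj ∧
      (X.normalForm (v :: p)).getLast? = (v :: p).getLast? := by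
  induction p generalizing v with
  | nil => exact ⟨hp, rfl⟩
  | cons u p ih =>
    rw [List.isChain_cons_cons] at hp
    obtain ⟨q, hq⟩ := exists_normalForm_eq (X := X) u p
    have h := ih u hp.2
    rw [normalForm, List.getLast?_cons_cons]
    rw [hq] at h ⊢
    rw [← h.2]
    exact reducedCons_isChain hp.1 h.1

theorem exists_walk_of_isChain (v w : V) (p : List V) (hp : (v :: p).IsChain X.skeleton.Adj)
    (hw : (v :: p).getLast? = some w) : ∃ q : X.skeleton.Walk v w, q.support = v :: p := by
  induction p generalizing v with
  | nil =>
    obtain rfl : v = w := by simpa using hw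
    exact ⟨.nil, rfl⟩
  | cons u p ih =>
    rw [List.isChain_cons_cons] at hp
    obtain ⟨q, hq⟩ := ih u hp.2 (by simpa [List.getLast?_cons_cons] using hw)
    exact ⟨.cons hp.1 q, by rw [SimpleGraph.Walk.support_cons, hq]⟩

theorem support_getLast? {v w : V} (p : X.skeleton.Walk v w) : p.support.getLast? = some w := by
  rw [List.getLast?_eq_getLast_of_ne_nil p.support_ne_nil, p.getLast_support]

/-- A normal form that differs from the path is strictly shorter, yet it is still an edge path with
the same ends. -/
theorem IsGeodesic.normalForm_support {v w : V} {p : X.skeleton.Walk v w}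
    (hp : X.IsGeodesic p) : X.normalForm p.support = p.support := by
  have hl := p.length_support
  have hch := p.isChain_adj_support
  have hla := support_getLast? p
  rw [← p.cons_tail_support] at hl hch hla ⊢
  refine (normalForm_eq_or_length_lt v p.support.tail).resolve_right fun hlt => ?_
  have hn := normalForm_isChain v _ hch
  rw [hla] at hn
  obtain ⟨q, hq⟩ := exists_normalForm_eq (X := X) v p.support.tail
  rw [hq] at hlt hn
  obtain ⟨p', hp'⟩ := exists_walk_of_isChain v w q hn.1 hn.2
  have h1 := SimpleGraph.dist_le p'
  have h2 := p'.length_support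
  rw [hp'] at h2
  rw [← hp] at h1
  omega

theorem IsGeodesic.pathEquiv (hX : X.HasFlagLinks) {v w : V} {p q : X.skeleton.Walk v w}
    (hp : X.IsGeodesic p) (hq : X.IsGeodesic q) (h : X.Homotopic p q) :
    X.PathEquiv p.support q.support := by
  rw [← hp.normalForm_support, ← hq.normalForm_support]
  exact h.normalForm hX

end CubeComplex

namespace CubeComplex

variable {V : Type u} {X : CubeComplex V}

/-! ### Homotopy of paths in simply connected complexes -/

theorem Homotopic.append_right {u v w : V} {p q : X.skeleton.Walk u v} (h : X.Homotopic p q)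
    (r : X.skeleton.Walk v w) : X.Homotopic (p.append r) (q.append r) := by
  induction h with
  | refl p => exact .refl _
  | symm _ ih => exact (ih r).symm
  | trans _ _ i1 i2 => exact (i1 r).trans (i2 r)
  | cons h _ ih => exact .cons h (ih r)
  | backtrack h p => exact .backtrack h _
  | square hpq hqr hps hsr t hs => exact .square hpq hqr hps hsr _ hs

theorem Homotopic.append_left {u v w : V} (r : X.skeleton.Walk u v) {p q : X.skeleton.Walk v w}
    (h : X.Homotopic p q) : X.Homotopic (r.append p) (r.append q) := by
  induction r with
  | nil => exact h
  | cons h' r ih => exact .cons h' (ih h)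

theorem homotopic_append_reverse {u v : V} (p : X.skeleton.Walk u v) :
    X.Homotopic (p.append p.reverse) .nil := by
  induction p with
  | nil => exact .refl _
  | cons h p ih =>
    rw [SimpleGraph.Walk.reverse_cons, SimpleGraph.Walk.cons_append,
      SimpleGraph.Walk.append_assoc]
    exact (Homotopic.cons h (ih.append_right _)).trans (.backtrack h .nil)

theorem IsSimplyConnected.homotopic (hX : X.IsSimplyConnected) {u v : V}
    (p q : X.skeleton.Walk u v) : X.Homotopic p q := by
  have h1 : X.Homotopic p ((q.append q.reverse).append p) := by
    simpa using ((homotopic_append_reverse q).append_right p).symm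
  refine h1.trans ?_
  rw [← SimpleGraph.Walk.append_assoc]
  simpa using (hX.2 v (q.reverse.append p)).append_left q

/-- The quadrangle condition. -/
theorem IsCAT0.quadrangle (hX : X.IsCAT0) {a w u v : V} (hu : X.skeleton.Adj w u)
    (hv : X.skeleton.Adj w v) (huv : u ≠ v) (hdu : X.skeleton.dist u a + 1 = X.skeleton.dist w a)
    (hdv : X.skeleton.dist v a + 1 = X.skeleton.dist w a) :
    ∃ z, X.IsSquare w u z v ∧ X.skeleton.dist z a + 2 = X.skeleton.dist w a := by
  obtain ⟨p, hp⟩ := hX.1.1.exists_walk_length_eq_dist u a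
  obtain ⟨q, hq⟩ := hX.1.1.exists_walk_length_eq_dist v a
  have hp' : X.IsGeodesic (SimpleGraph.Walk.cons hu p) := by
    rw [IsGeodesic, SimpleGraph.Walk.length_cons, hp, hdu]
  have hq' : X.IsGeodesic (SimpleGraph.Walk.cons hv q) := by
    rw [IsGeodesic, SimpleGraph.Walk.length_cons, hq, hdv]
  -- The geodesics from `w` to `a` through `u` and through `v` are equivalent, and inverting the
  -- equivalence at the first edge exhibits the square.
  have h := hp'.pathEquiv hX.2 hq' (hX.1.homotopic _ _)
  rw [SimpleGraph.Walk.support_cons, SimpleGraph.Walk.support_cons, ← p.cons_tail_support,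
    ← q.cons_tail_support] at h
  rcases h.inv with ⟨h, -⟩ | ⟨z, r, hs, h1, -⟩
  · exact absurd h huv
  refine ⟨z, hs, ?_⟩
  have hch := p.isChain_adj_support
  have hla := support_getLast? p
  have hl := p.length_support
  rw [← p.cons_tail_support] at hch hla hl
  rw [h1.isChain_iff, List.isChain_cons_cons] at hch
  rw [h1.getLast?_eq, List.getLast?_cons_cons] at hla
  obtain ⟨p', hp'⟩ := exists_walk_of_isChain z a r hch.2 hla
  have h2 := SimpleGraph.dist_le p'
  have h3 := p'.length_support
  rw [hp'] at h3
  have h4 := h1.length_eq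
  simp only [List.length_cons] at h3 h4 hl
  have h5 : X.skeleton.dist u a ≤ X.skeleton.dist u z + X.skeleton.dist z a :=
    hX.1.1.dist_triangle
  rw [SimpleGraph.dist_eq_one_iff_adj.2 hch.1] at h5
  omega

/-! ### Crossing parities -/

/-- The hyperplane crossed by an edge. -/
def hyp (X : CubeComplex V) {u v : V} (h : X.skeleton.Adj u v) : X.Hyperplane :=
  X.dual ⟨(u, v), h⟩

theorem hyp_symm {u v : V} (h : X.skeleton.Adj u v) : X.hyp h.symm = X.hyp h := by
  refine congrArg (Quot.mk _) (Subtype.ext ?_)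
  exact Sym2.eq_swap

theorem hyp_eq_of_isSquare {p q r s : V} (h : X.IsSquare p q r s) (h1 : X.skeleton.Adj p q)
    (h2 : X.skeleton.Adj s r) : X.hyp h1 = X.hyp h2 :=
  Quot.sound ⟨p, q, r, s, h, rfl, rfl⟩

/-- The list of hyperplanes crossed by an edge path. -/
def crossings (X : CubeComplex V) {u v : V} (p : X.skeleton.Walk u v) : List X.Hyperplane :=
  p.darts.map X.dual

theorem crossings_cons {u v w : V} (h : X.skeleton.Adj u v) (p : X.skeleton.Walk v w) :
    X.crossings (.cons h p) = X.hyp h :: X.crossings p := rfl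

theorem length_crossings {u v : V} (p : X.skeleton.Walk u v) :
    (X.crossings p).length = p.length := by
  simp [crossings]

/-- Modulo 2 a backtrack contributes nothing, and the two ways around a square cross the same two
hyperplanes in opposite order. Arbitrary `f` serves both the parity of the length and the parity for
a single hyperplane. -/
theorem Homotopic.sum_crossings {u v : V} {p q : X.skeleton.Walk u v} (h : X.Homotopic p q)
    (f : X.Hyperplane → ZMod 2) :
    ((X.crossings p).map f).sum = ((X.crossings q).map f).sum := by
  induction h with
  | refl p => rfl
  | symm _ ih => exact ih.symm
  | trans _ _ i1 i2 => exact i1.trans i2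
  | cons h _ ih => simp [crossings_cons, ih]
  | backtrack h p =>
    simp only [crossings_cons, List.map_cons, List.sum_cons]
    rw [← add_assoc, hyp_symm h, CharTwo.add_self_eq_zero, zero_add]
  | square hpq hqr hps hsr t hs =>
    simp only [crossings_cons, List.map_cons, List.sum_cons]
    rw [hyp_eq_of_isSquare hs hpq hsr, hyp_eq_of_isSquare hs.reflect hps hqr, ← add_assoc,
      ← add_assoc, add_comm (f _)]

theorem IsCAT0.sum_crossings_eq (hX : X.IsCAT0) {u v : V} (p q : X.skeleton.Walk u v)
    (f : X.Hyperplane → ZMod 2) :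
    ((X.crossings p).map f).sum = ((X.crossings q).map f).sum :=
  (hX.1.homotopic p q).sum_crossings f

theorem IsCAT0.length_parity (hX : X.IsCAT0) {u v : V} (p q : X.skeleton.Walk u v) :
    (p.length : ZMod 2) = q.length := by
  simpa [length_crossings] using hX.sum_crossings_eq p q fun _ => 1

theorem IsCAT0.dist_adj (hX : X.IsCAT0) {a b : V} (x : V) (h : X.skeleton.Adj a b) :
    X.skeleton.dist x a = X.skeleton.dist x b + 1 ∨
      X.skeleton.dist x b = X.skeleton.dist x a + 1 := by
  obtain ⟨p, hp⟩ := hX.1.1.exists_walk_length_eq_dist a x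
  obtain ⟨q, hq⟩ := hX.1.1.exists_walk_length_eq_dist b x
  have h1 := hX.length_parity p (.cons h q)
  have h2 : X.skeleton.dist x a ≤ X.skeleton.dist x b + X.skeleton.dist b a :=
    hX.1.1.dist_triangle
  have h3 : X.skeleton.dist x b ≤ X.skeleton.dist x a + X.skeleton.dist a b :=
    hX.1.1.dist_triangle
  rw [SimpleGraph.dist_eq_one_iff_adj.2 h] at h3
  rw [SimpleGraph.dist_eq_one_iff_adj.2 h.symm] at h2
  rw [SimpleGraph.Walk.length_cons, hp, hq, SimpleGraph.dist_comm, SimpleGraph.dist_comm (u := b),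
    ZMod.natCast_eq_natCast_iff'] at h1
  omega

/-! ### Sides of an edge -/

/-- Otherwise `b` would be farther from `x` than both `a` and `b'`, while `a'` is as far as `b`. The
quadrangle condition at `b` would make the fourth corner, which is `a'`, two steps closer. -/
theorem IsCAT0.lt_of_isSquare (hX : X.IsCAT0) {a b b' a' x : V} (h : X.IsSquare a b b' a')
    (hx : X.skeleton.dist x a < X.skeleton.dist x b) :
    X.skeleton.dist x a' < X.skeleton.dist x b' := by
  by_contra hc
  have h1 := hX.dist_adj x h.adj
  have h2 := hX.dist_adj x h.rotate.rotate.adj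
  have h3 := hX.dist_adj x h.adj'
  have h4 := hX.dist_adj x h.reflect.adj
  obtain ⟨z, hz, hd⟩ := hX.quadrangle (a := x) h.adj.symm h.adj' h.ne
    (by rw [SimpleGraph.dist_comm, SimpleGraph.dist_comm (u := b)]; omega)
    (by rw [SimpleGraph.dist_comm, SimpleGraph.dist_comm (u := b)]; omega)
  obtain rfl : a' = z := h.rotate.reflect.unique_opposite hz
  rw [SimpleGraph.dist_comm, SimpleGraph.dist_comm (u := b)] at hd
  omega

theorem IsCAT0.lt_iff_of_isSquare (hX : X.IsCAT0) {a b b' a' : V} (h : X.IsSquare a b b' a')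
    (x : V) : X.skeleton.dist x a < X.skeleton.dist x b ↔
      X.skeleton.dist x a' < X.skeleton.dist x b' :=
  ⟨hX.lt_of_isSquare h, hX.lt_of_isSquare h.rotate.reflect.rotate.rotate⟩

/-- The vertices `x`, `y` are on the same side of the edge `e`. -/
def SameSide (X : CubeComplex V) (x y : V) (e : X.skeleton.edgeSet) : Prop :=
  ∀ a b, (e : Sym2 V) = s(a, b) → (X.skeleton.dist x a < X.skeleton.dist x b ↔
    X.skeleton.dist y a < X.skeleton.dist y b)

theorem IsCAT0.sameSide_iff (hX : X.IsCAT0) {x y : V} {e : X.skeleton.edgeSet} {a b : V}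
    (he : (e : Sym2 V) = s(a, b)) :
    X.SameSide x y e ↔ (X.skeleton.dist x a < X.skeleton.dist x b ↔
      X.skeleton.dist y a < X.skeleton.dist y b) := by
  have hab : X.skeleton.Adj a b := by
    have := e.2
    rwa [he, SimpleGraph.mem_edgeSet] at this
  refine ⟨fun h => h a b he, fun h c d hcd => ?_⟩
  rw [he, Sym2.eq_iff] at hcd
  rcases hcd with ⟨rfl, rfl⟩ | ⟨rfl, rfl⟩
  · exact h
  · have h1 := hX.dist_adj x hab
    have h2 := hX.dist_adj y hab
    omega

/-- Which end of an edge is closer to `x` depends on the orientation of the edge; whether `x` and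
`y` agree on it does not. Hence the relation is constant on opposite edges and descends to
hyperplanes. -/
theorem IsCAT0.sameSide_congr (hX : X.IsCAT0) {x y a b a' b' : V} (h : X.skeleton.Adj a b)
    (h' : X.skeleton.Adj a' b') (heq : X.hyp h = X.hyp h') :
    (X.skeleton.dist x a < X.skeleton.dist x b ↔ X.skeleton.dist y a < X.skeleton.dist y b) ↔
    (X.skeleton.dist x a' < X.skeleton.dist x b' ↔
      X.skeleton.dist y a' < X.skeleton.dist y b') := by
  have hinv : ∀ e e' : X.skeleton.edgeSet, X.OppositeEdges e e' →
      X.SameSide x y e = X.SameSide x y e' := by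
    rintro e e' ⟨p, q, r, s, hs, he, he'⟩
    rw [hX.sameSide_iff he, hX.sameSide_iff he', hX.lt_iff_of_isSquare hs,
      hX.lt_iff_of_isSquare hs]
  have := congrArg (Quot.lift (X.SameSide x y) hinv) heq
  rw [← hX.sameSide_iff (e := ⟨s(a, b), h⟩) rfl, ← hX.sameSide_iff (e := ⟨s(a', b'), h'⟩) rfl]
  exact iff_of_eq this

theorem exists_length_eq_of_mem_darts {u v : V} {p : X.skeleton.Walk u v} {d : X.skeleton.Dart}
    (hd : d ∈ p.darts) : ∃ (p₁ : X.skeleton.Walk u d.fst) (p₂ : X.skeleton.Walk d.snd v),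
      p.length = p₁.length + 1 + p₂.length := by
  induction p with
  | nil => simp at hd
  | cons h p ih =>
    rw [SimpleGraph.Walk.darts_cons, List.mem_cons] at hd
    rcases hd with rfl | hd
    · exact ⟨.nil, p, by simp [add_comm]⟩
    · obtain ⟨p₁, p₂, hp⟩ := ih hd
      exact ⟨.cons h p₁, p₂, by simp [hp]; omega⟩

theorem IsGeodesic.lt_of_mem_darts {u v : V} (hX : X.skeleton.Connected)
    {p : X.skeleton.Walk u v} (hp : X.IsGeodesic p) {d : X.skeleton.Dart} (hd : d ∈ p.darts) :
    X.skeleton.dist u d.fst < X.skeleton.dist u d.snd := by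
  obtain ⟨p₁, p₂, hl⟩ := exists_length_eq_of_mem_darts hd
  have h1 := SimpleGraph.dist_le p₁
  have h2 := SimpleGraph.dist_le p₂
  have h3 : X.skeleton.dist u v ≤ X.skeleton.dist u d.snd + X.skeleton.dist d.snd v :=
    hX.dist_triangle
  rw [IsGeodesic] at hp
  omega

theorem IsGeodesic.of_cons {u v w : V} (hX : X.skeleton.Connected) {h : X.skeleton.Adj u v}
    {p : X.skeleton.Walk v w} (hp : X.IsGeodesic (.cons h p)) : X.IsGeodesic p := by
  have h1 := SimpleGraph.dist_le p
  have h3 : X.skeleton.dist u w ≤ X.skeleton.dist u v + X.skeleton.dist v w :=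
    hX.dist_triangle
  rw [SimpleGraph.dist_eq_one_iff_adj.2 h] at h3
  rw [IsGeodesic, SimpleGraph.Walk.length_cons] at hp
  rw [IsGeodesic]
  omega

/-- Suppose the hyperplane of the first edge `u a` recurs at `d`. The path leads across `d` away
from both `u` and `a`, so these lie on the same side of `d`, hence on the same side of the edge `u
a` itself, which is absurd. -/
theorem IsCAT0.nodup_crossings (hX : X.IsCAT0) {u v : V} {p : X.skeleton.Walk u v}
    (hp : X.IsGeodesic p) : (X.crossings p).Nodup := by
  induction p with
  | nil => exact List.nodup_nil
  | @cons u a v h p ih =>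
    have hp' := hp.of_cons hX.1.1
    rw [crossings_cons, List.nodup_cons]
    refine ⟨fun hmem => ?_, ih hp'⟩
    obtain ⟨d, hd, hdh⟩ := List.mem_map.1 hmem
    have h1 := hp'.lt_of_mem_darts hX.1.1 hd
    have h2 := hp.lt_of_mem_darts hX.1.1
      (by rw [SimpleGraph.Walk.darts_cons]; exact List.mem_cons_of_mem _ hd)
    have h3 := (hX.sameSide_congr (x := u) (y := a) d.adj h hdh).1 (iff_of_true h2 h1)
    rw [SimpleGraph.dist_self, SimpleGraph.dist_self, SimpleGraph.dist_comm (u := a),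
      SimpleGraph.dist_eq_one_iff_adj.2 h] at h3
    simp at h3

/-! ### Separating hyperplanes -/

open Classical in
/-- The hyperplanes that separate `u` from `v`. -/
noncomputable def sep (hX : X.IsCAT0) (u v : V) : Finset X.Hyperplane :=
  (X.crossings (hX.1.1.exists_walk_length_eq_dist u v).choose).toFinset

open Classical in
theorem card_sep (hX : X.IsCAT0) (u v : V) : (sep hX u v).card = X.skeleton.dist u v := by
  have h := (hX.1.1.exists_walk_length_eq_dist u v).choose_spec
  rw [sep, List.toFinset_card_of_nodup (hX.nodup_crossings h), length_crossings, h]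

open Classical in
theorem sum_single_eq_count (L : List X.Hyperplane) (h : X.Hyperplane) :
    (L.map fun k => if k = h then (1 : ZMod 2) else 0).sum = L.count h := by
  induction L with
  | nil => simp
  | cons a L ih =>
    rw [List.map_cons, List.sum_cons, ih, List.count_cons]
    by_cases ha : a = h <;> simp [ha, add_comm]

open Classical in
-- On a geodesic the count is 0 or 1, and its parity is the same for all paths. So separation can be
-- tested on any path, which makes `sep` additive modulo 2 under concatenation.
theorem mem_sep (hX : X.IsCAT0) {u v : V} (p : X.skeleton.Walk u v) (h : X.Hyperplane) :
    h ∈ sep hX u v ↔ Odd ((X.crossings p).count h) := by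
  have hg := (hX.1.1.exists_walk_length_eq_dist u v).choose_spec
  have hp := hX.sum_crossings_eq p (hX.1.1.exists_walk_length_eq_dist u v).choose
    fun k => if k = h then 1 else 0
  rw [sum_single_eq_count, sum_single_eq_count] at hp
  rw [← ZMod.natCast_eq_one_iff_odd, hp, ZMod.natCast_eq_one_iff_odd, sep, List.mem_toFinset]
  by_cases hm : h ∈ X.crossings (hX.1.1.exists_walk_length_eq_dist u v).choose
  · simp [List.count_eq_one_of_mem (hX.nodup_crossings hg) hm, hm]
  · simp [List.count_eq_zero_of_not_mem hm, hm]

open Classical in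
theorem mem_sep_of_geodesic (hX : X.IsCAT0) {u v : V} {p : X.skeleton.Walk u v}
    (hp : X.IsGeodesic p) (h : X.Hyperplane) : h ∈ sep hX u v ↔ h ∈ X.crossings p := by
  rw [mem_sep hX p]
  by_cases hm : h ∈ X.crossings p
  · simp [List.count_eq_one_of_mem (hX.nodup_crossings hp) hm, hm]
  · simp [List.count_eq_zero_of_not_mem hm, hm]

theorem mem_sep_comm (hX : X.IsCAT0) {u v : V} {h : X.Hyperplane} :
    h ∈ sep hX u v ↔ h ∈ sep hX v u := by
  classical
  obtain ⟨p⟩ := hX.1.1.preconnected u v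
  rw [mem_sep hX p, mem_sep hX p.reverse]
  have : X.crossings p.reverse = (X.crossings p).reverse := by
    rw [crossings, SimpleGraph.Walk.darts_reverse, crossings, List.map_reverse, List.map_map]
    congr 2
    funext d
    exact hyp_symm d.adj
  rw [this, List.count_reverse]

theorem mem_sep_triangle (hX : X.IsCAT0) (u v w : V) (h : X.Hyperplane) :
    h ∈ sep hX u w ↔ ¬(h ∈ sep hX u v ↔ h ∈ sep hX v w) := by
  classical
  obtain ⟨p⟩ := hX.1.1.preconnected u v
  obtain ⟨q⟩ := hX.1.1.preconnected v w
  rw [mem_sep hX p, mem_sep hX q, mem_sep hX (p.append q)]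
  have : X.crossings (p.append q) = X.crossings p ++ X.crossings q := by
    simp [crossings, SimpleGraph.Walk.darts_append]
  rw [this, List.count_append, Nat.odd_add, ← Nat.not_odd_iff_even]
  tauto

theorem sep_self (hX : X.IsCAT0) (u : V) : sep hX u u = ∅ := by
  rw [← Finset.card_eq_zero, card_sep, SimpleGraph.dist_self]

theorem eq_of_sep_eq_empty (hX : X.IsCAT0) {u v : V} (h : sep hX u v = ∅) : u = v := by
  rw [← Finset.card_eq_zero, card_sep] at h
  exact hX.1.1.dist_eq_zero_iff.1 h

theorem sep_of_adj (hX : X.IsCAT0) {u v : V} (h : X.skeleton.Adj u v) :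
    sep hX u v = {X.hyp h} := by
  classical
  ext k
  rw [mem_sep hX (.cons h .nil), Finset.mem_singleton]
  have : X.crossings (.cons h .nil) = [X.hyp h] := rfl
  rw [this, List.count_singleton]
  by_cases hk : X.hyp h = k
  · simp [hk]
  · simp [hk, Ne.symm hk]

theorem dist_add_one_of_mem_sep (hX : X.IsCAT0) {m m' w : V} (h : X.skeleton.Adj m m') :
    X.hyp h ∈ sep hX m w ↔ X.skeleton.dist m' w + 1 = X.skeleton.dist m w := by
  classical
  have key : ∀ {m m' : V} (h : X.skeleton.Adj m m'), X.hyp h ∈ sep hX m w →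
      X.skeleton.dist m' w + 1 = X.skeleton.dist m w := by
    intro m m' h hm
    rw [← card_sep hX, ← card_sep hX, ← Finset.card_erase_add_one hm]
    congr 2
    ext k
    rw [mem_sep_triangle hX m' m w, sep_of_adj hX h.symm, hyp_symm h, Finset.mem_singleton,
      Finset.mem_erase]
    by_cases hk : k = X.hyp h
    · subst hk; simp [hm]
    · simp [hk]
  refine ⟨key h, fun hd => ?_⟩
  by_contra hm
  have h2 : X.hyp h.symm ∈ sep hX m' w := by
    rw [mem_sep_triangle hX m' m w, sep_of_adj hX h.symm, hyp_symm h]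
    simpa using hm
  have := key h.symm h2
  omega

/-! ### Medians -/

/-- Step from `m` to `m₁` on a geodesic to `u`. If this leads away from `w`, then `h` was not
crossed, and induction gives `m₂` next to `m₁`, closer to both. The quadrangle condition at `m₁`,
applied to `m` and `m₂`, yields the required neighbour of `m`. -/
theorem exists_adj_closer (hX : X.IsCAT0) {u w : V} {h : X.Hyperplane} (n : ℕ) : ∀ m : V,
    X.skeleton.dist m u = n → h ∈ sep hX m u → h ∈ sep hX m w →
    ∃ m', X.skeleton.Adj m m' ∧ X.skeleton.dist m' u + 1 = X.skeleton.dist m u ∧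
      X.skeleton.dist m' w + 1 = X.skeleton.dist m w := by
  induction n with
  | zero =>
    intro m hm hu
    rw [← card_sep hX, Finset.card_eq_zero] at hm
    simp [hm] at hu
  | succ n ih =>
    intro m hm hu hw
    obtain ⟨p, hp⟩ := hX.1.1.exists_walk_length_eq_dist m u
    cases p with
    | nil => rw [SimpleGraph.Walk.length_nil] at hp; omega
    | @cons _ m₁ _ a p =>
      have hp' : X.IsGeodesic p := IsGeodesic.of_cons hX.1.1 (h := a) hp
      rw [SimpleGraph.Walk.length_cons] at hp
      rw [IsGeodesic] at hp'
      have hd := hX.dist_adj w a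
      rw [SimpleGraph.dist_comm, SimpleGraph.dist_comm (u := w)] at hd
      by_cases hm₁ : X.skeleton.dist m₁ w + 1 = X.skeleton.dist m w
      · exact ⟨m₁, a, by omega, hm₁⟩
      have hk := mt (dist_add_one_of_mem_sep hX a).1 hm₁
      have hne : h ≠ X.hyp a := fun he => hk (he ▸ hw)
      have hmem : ∀ x, h ∈ sep hX m x → h ∈ sep hX m₁ x := by
        intro x hx
        rw [mem_sep_triangle hX m₁ m x, sep_of_adj hX a.symm, hyp_symm a, Finset.mem_singleton]
        simp [hne, hx]
      obtain ⟨m₂, a₂, h1, h2⟩ := ih m₁ (by omega) (hmem u hu) (hmem w hw)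
      obtain ⟨z, hz, hdz⟩ := hX.quadrangle (a := w) a.symm a₂ (by
        rintro rfl; omega) (by omega) h2
      refine ⟨z, hz.adj', ?_, by omega⟩
      have h3 : X.skeleton.dist z u ≤ X.skeleton.dist z m₂ + X.skeleton.dist m₂ u :=
        hX.1.1.dist_triangle
      have h4 : X.skeleton.dist m u ≤ X.skeleton.dist m z + X.skeleton.dist z u :=
        hX.1.1.dist_triangle
      rw [SimpleGraph.dist_eq_one_iff_adj.2 hz.rotate.rotate.adj] at h3
      rw [SimpleGraph.dist_eq_one_iff_adj.2 hz.adj'] at h4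
      omega

/-- Minimise the sum of the three distances. If a hyperplane separated the minimum from two of the
vertices, a step closer to both would lose 2 and gain at most 1. -/
theorem exists_median (hX : X.IsCAT0) (u v w : V) : ∃ m, ∀ h,
    ¬(h ∈ sep hX m u ∧ h ∈ sep hX m v) ∧ ¬(h ∈ sep hX m u ∧ h ∈ sep hX m w) ∧
    ¬(h ∈ sep hX m v ∧ h ∈ sep hX m w) := by
  let Φ : V → ℕ := fun m => X.skeleton.dist m u + X.skeleton.dist m v + X.skeleton.dist m w
  have : Nonempty V := ⟨u⟩
  have hmin : ∀ m', Φ (Function.argmin Φ) ≤ Φ m' := fun m' => Function.argmin_le Φ m'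
  have hup : ∀ {m m' : V} (x : V), X.skeleton.Adj m m' →
      X.skeleton.dist m' x ≤ X.skeleton.dist m x + 1 := by
    intro m m' x h
    have := hX.dist_adj x h
    rw [SimpleGraph.dist_comm, SimpleGraph.dist_comm (u := x)] at this
    omega
  refine ⟨Function.argmin Φ, fun h => ⟨?_, ?_, ?_⟩⟩
  · rintro ⟨h1, h2⟩
    obtain ⟨m', a, h3, h4⟩ := exists_adj_closer hX _ _ rfl h1 h2
    have := hmin m'
    have := hup w a
    simp only [Φ] at *
    omega
  · rintro ⟨h1, h2⟩
    obtain ⟨m', a, h3, h4⟩ := exists_adj_closer hX _ _ rfl h1 h2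
    have := hmin m'
    have := hup v a
    simp only [Φ] at *
    omega
  · rintro ⟨h1, h2⟩
    obtain ⟨m', a, h3, h4⟩ := exists_adj_closer hX _ _ rfl h1 h2
    have := hmin m'
    have := hup u a
    simp only [Φ] at *
    omega

/-! ### Halfspaces -/

/-- A path avoiding `h` crosses it zero times; conversely a geodesic crosses only the separating
hyperplanes, so it survives the deletion. -/
theorem mem_side (hX : X.IsCAT0) {h : X.Hyperplane} {x y : V} :
    y ∈ X.side h x ↔ h ∉ sep hX x y := by
  classical
  constructor
  · rintro ⟨p⟩
    induction p with
    | nil => simp [sep_self]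
    | @cons a b c hab p ih =>
      rw [SimpleGraph.deleteEdges_adj] at hab
      rw [mem_sep_triangle hX a b c, sep_of_adj hX hab.1, Finset.mem_singleton]
      have : h ≠ X.hyp hab.1 := fun he => hab.2 ⟨⟨(a, b), hab.1⟩, rfl, he.symm⟩
      simp [this, ih]
  · intro hs
    obtain ⟨p, hp⟩ := hX.1.1.exists_walk_length_eq_dist x y
    rw [mem_sep_of_geodesic hX hp] at hs
    clear hp
    induction p with
    | nil => exact SimpleGraph.Reachable.refl _
    | @cons a b c hab p ih =>
      rw [crossings_cons, List.mem_cons, not_or] at hs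
      refine SimpleGraph.Reachable.trans (SimpleGraph.Adj.reachable ?_) (ih hs.2)
      rw [SimpleGraph.deleteEdges_adj]
      refine ⟨hab, ?_⟩
      rintro ⟨d, hd, hdh⟩
      refine hs.1 ?_
      rw [← hdh]
      exact congrArg (Quot.mk _) (Subtype.ext hd)

theorem side_eq_iff (hX : X.IsCAT0) {h : X.Hyperplane} {x y : V} :
    X.side h x = X.side h y ↔ h ∉ sep hX x y := by
  constructor
  · intro he
    rw [← mem_side hX, he, mem_side hX, sep_self]
    simp
  · intro hs
    ext z
    rw [mem_side hX, mem_side hX, mem_sep_triangle hX x y z]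
    simp [hs]

end CubeComplex

/-! ### Median families of finite sets -/

/-- A family of finite sets that contains the empty set, is closed under medians, and in which each
point of a member is the only difference of two members. -/
structure IsMedianFamily {H : Type u} [DecidableEq H] (F : Set (Finset H)) : Prop where
  empty_mem : ∅ ∈ F
  median_mem : ∀ {A B C}, A ∈ F → B ∈ F → C ∈ F → (A ∩ B) ∪ (B ∩ C) ∪ (A ∩ C) ∈ F
  exists_insert : ∀ {A h}, A ∈ F → h ∈ A → ∃ B ∈ F, h ∉ B ∧ insert h B ∈ F

namespace IsMedianFamily

variable {H : Type u} [DecidableEq H] {F : Set (Finset H)}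

theorem inter_mem (hF : IsMedianFamily F) {A B : Finset H} (hA : A ∈ F) (hB : B ∈ F) :
    A ∩ B ∈ F := by
  simpa using hF.median_mem hA hB hF.empty_mem

theorem union_mem (hF : IsMedianFamily F) {A B C : Finset H} (hA : A ∈ F) (hB : B ∈ F)
    (hC : C ∈ F) (hAC : A ⊆ C) (hBC : B ⊆ C) : A ∪ B ∈ F := by
  have h := hF.median_mem hA hB hC
  have e : (A ∩ B) ∪ (B ∩ C) ∪ (A ∩ C) = A ∪ B := by
    rw [Finset.inter_eq_left.2 hAC, Finset.inter_eq_left.2 hBC]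
    ext x
    simp only [Finset.mem_union, Finset.mem_inter]
    tauto
  rwa [e] at h

/-- `g` lies below `h` when every member that contains `h` contains `g`. -/
def Below (F : Set (Finset H)) (g h : H) : Prop := ∀ A ∈ F, h ∈ A → g ∈ A

/-- Two members that differ exactly in `h` distinguish it from every other point. -/
theorem below_antisymm (hF : IsMedianFamily F) {A : Finset H} {g h : H} (hA : A ∈ F) (hh : h ∈ A)
    (h1 : Below F g h) (h2 : Below F h g) : g = h := by
  obtain ⟨B, hB, hhB, hi⟩ := hF.exists_insert hA hh
  have := h1 _ hi (Finset.mem_insert_self _ _)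
  rcases Finset.mem_insert.1 this with h | h
  · exact h
  · exact absurd (h2 _ hB h) hhB

/-- Birkhoff's representation inside a member `A`. For `h ∈ D`, each `x ∈ A \ D` is not below `h`,
so some member contains `h` but not `x`. Intersecting these with `A` gives a member between `{h}`
and `D`, and the union of such members over `D` is `D`; unions are allowed because all lie in `A`.
-/
theorem mem_of_downset (hF : IsMedianFamily F) {A D : Finset H} (hA : A ∈ F) (hD : D ⊆ A)
    (hdown : ∀ h ∈ D, ∀ g ∈ A, Below F g h → g ∈ D) : D ∈ F := by
  have h1 : ∀ h ∈ D, ∀ G : Finset H, G ⊆ A \ D → ∃ E ∈ F, h ∈ E ∧ E ⊆ A ∧ Disjoint E G := by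
    intro h hh G
    induction G using Finset.induction_on with
    | empty => exact fun _ => ⟨A, hA, hD hh, subset_rfl, Finset.disjoint_empty_right _⟩
    | insert x G _ ih =>
      intro hG
      rw [Finset.insert_subset_iff, Finset.mem_sdiff] at hG
      obtain ⟨E, hE, hhE, hEA, hEG⟩ := ih hG.2
      have hx : ¬Below F x h := fun hb => hG.1.2 (hdown h hh x hG.1.1 hb)
      simp only [Below, not_forall] at hx
      obtain ⟨B, hB, hhB, hxB⟩ := hx
      refine ⟨E ∩ B, hF.inter_mem hE hB, Finset.mem_inter.2 ⟨hhE, hhB⟩,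
        Finset.inter_subset_left.trans hEA, ?_⟩
      rw [Finset.disjoint_insert_right]
      exact ⟨fun h => hxB (Finset.mem_inter.1 h).2,
        hEG.mono_left Finset.inter_subset_left⟩
  have h2 : ∀ G : Finset H, G ⊆ D → ∃ E ∈ F, G ⊆ E ∧ E ⊆ D := by
    intro G
    induction G using Finset.induction_on with
    | empty => exact fun _ => ⟨∅, hF.empty_mem, subset_rfl, Finset.empty_subset _⟩
    | insert x G _ ih =>
      intro hG
      rw [Finset.insert_subset_iff] at hG
      obtain ⟨E, hE, hGE, hED⟩ := ih hG.2
      obtain ⟨E', hE', hx, hEA, hdis⟩ := h1 x hG.1 (A \ D) subset_rfl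
      have hE'D : E' ⊆ D := by
        intro y hy
        by_contra hyD
        exact Finset.disjoint_left.1 hdis hy (Finset.mem_sdiff.2 ⟨hEA hy, hyD⟩)
      refine ⟨E ∪ E', hF.union_mem hE hE' hA (hED.trans hD) hEA, ?_, Finset.union_subset hED hE'D⟩
      exact Finset.insert_subset (Finset.mem_union_right _ hx)
        (hGE.trans Finset.subset_union_left)
  obtain ⟨E, hE, h3, h4⟩ := h2 D subset_rfl
  rwa [h3.antisymm h4]

open Classical in
-- The number of points of `A` below a point is a strictly monotone rank, used to select minimal and
-- maximal points.
theorem card_below_lt (hF : IsMedianFamily F) {A : Finset H} (hA : A ∈ F) {g h : H} (hh : h ∈ A)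
    (hg : Below F g h) (hne : g ≠ h) :
    (A.filter fun x => Below F x g).card < (A.filter fun x => Below F x h).card := by
  refine Finset.card_lt_card (Finset.ssubset_iff_of_subset ?_ |>.2 ⟨h, ?_, ?_⟩)
  · intro x hx
    rw [Finset.mem_filter] at hx ⊢
    exact ⟨hx.1, fun B hB hhB => hx.2 B hB (hg B hB hhB)⟩
  · rw [Finset.mem_filter]
    exact ⟨hh, fun B _ hB => hB⟩
  · rw [Finset.mem_filter]
    exact fun hx => hne (hF.below_antisymm hA hh hg hx.2)

theorem exists_insert_mem (hF : IsMedianFamily F) {A B : Finset H} (hA : A ∈ F) (hB : B ∈ F)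
    (hAB : A ⊂ B) : ∃ m ∈ B, m ∉ A ∧ insert m A ∈ F := by
  classical
  have hne : (B \ A).Nonempty := Finset.sdiff_nonempty.2 hAB.2
  -- Everything in `B` strictly below a minimal point of `B \ A` lies in `A`, so adding that point
  -- leaves `A` down-closed.
  obtain ⟨m, hm, hmin⟩ := Finset.exists_min_image (B \ A)
    (fun h => (B.filter fun x => Below F x h).card) hne
  rw [Finset.mem_sdiff] at hm
  refine ⟨m, hm.1, hm.2, hF.mem_of_downset hB (Finset.insert_subset hm.1 hAB.1) ?_⟩
  intro h hh g hg hb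
  rw [Finset.mem_insert] at hh ⊢
  rcases hh with rfl | hh
  · by_contra hc
    rw [not_or] at hc
    have := hmin g (Finset.mem_sdiff.2 ⟨hg, hc.2⟩)
    exact absurd (hF.card_below_lt hB hm.1 hb hc.1) (not_lt.2 this)
  · exact .inr (hb A hA hh)

theorem exists_erase_mem (hF : IsMedianFamily F) {A : Finset H} (hA : A ∈ F) (hne : A.Nonempty) :
    ∃ m ∈ A, A.erase m ∈ F := by
  classical
  obtain ⟨m, hm, hmax⟩ := Finset.exists_max_image A
    (fun h => (A.filter fun x => Below F x h).card) hne
  refine ⟨m, hm, hF.mem_of_downset hA (Finset.erase_subset _ _) ?_⟩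
  intro h hh g hg hb
  rw [Finset.mem_erase] at hh ⊢
  refine ⟨?_, hg⟩
  rintro rfl
  exact absurd (hF.card_below_lt hA hh.2 hb hh.1.symm) (not_lt.2 (hmax h hh.2))

/-- Majority is computed pointwise, so it commutes with restriction to `K`, and two members
differing only in a point of `K` still do so after restriction. This is why forgetting hyperplanes
stays within CAT(0) cube complexes. -/
theorem filter (hF : IsMedianFamily F) (K : Set H) [DecidablePred (· ∈ K)] :
    IsMedianFamily ((fun A => A.filter (· ∈ K)) '' F) where
  empty_mem := ⟨∅, hF.empty_mem, rfl⟩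
  median_mem := by
    rintro _ _ _ ⟨A, hA, rfl⟩ ⟨B, hB, rfl⟩ ⟨C, hC, rfl⟩
    refine ⟨_, hF.median_mem hA hB hC, ?_⟩
    ext x
    simp only [Finset.mem_filter, Finset.mem_union, Finset.mem_inter]
    tauto
  exists_insert := by
    rintro _ h ⟨A, hA, rfl⟩ hh
    rw [Finset.mem_filter] at hh
    obtain ⟨B, hB, hhB, hi⟩ := hF.exists_insert hA hh.1
    refine ⟨_, ⟨B, hB, rfl⟩, fun h => hhB (Finset.mem_filter.1 h).1, _, hi, ?_⟩
    exact (Finset.filter_insert ..).trans (if_pos hh.2)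

end IsMedianFamily

namespace CubeComplex

/-! ### Complexes whose cubes are all the cubes of a median family -/

/-- The vertices of `Y` correspond to the members of a median family; the cubes are the maps `f`
for which there are distinct `k i` such that the sets of `f x` and `f y` differ exactly in the
`k i` with `x i ≠ y i`. -/
structure IsMedianModel {W H : Type u} [DecidableEq H] (Y : CubeComplex W) (T : W → Finset H) :
    Prop where
  injective : Function.Injective T
  family : IsMedianFamily (Set.range T)
  isCube_iff : ∀ {n : ℕ} (f : (Fin n → Bool) → W), Y.IsCube f ↔ ∃ k : Fin n → H,
    Function.Injective k ∧ ∀ x y h, ¬(h ∈ T (f x) ↔ h ∈ T (f y)) ↔ ∃ i, k i = h ∧ x i ≠ y i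

namespace IsMedianModel

variable {W H : Type u} [DecidableEq H] {Y : CubeComplex W} {T : W → Finset H}

theorem adj_iff (hT : Y.IsMedianModel T) {σ τ : W} :
    Y.skeleton.Adj σ τ ↔ ∃ h, ∀ g, ¬(g ∈ T σ ↔ g ∈ T τ) ↔ g = h := by
  constructor
  · rintro ⟨f, hf, rfl, rfl⟩
    obtain ⟨k, hk, hx⟩ := (hT.isCube_iff f).1 hf
    refine ⟨k 0, fun g => ?_⟩
    rw [hx]
    simp [eq_comm]
  · rintro ⟨h, hh⟩
    refine ⟨fun x => if x 0 then τ else σ, (hT.isCube_iff _).2 ⟨fun _ => h,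
      Function.injective_of_subsingleton _, fun x y g => ?_⟩, by simp, by simp⟩
    have h1 : ¬(g ∈ T τ ↔ g ∈ T σ) ↔ g = h := by rw [← hh g]; exact not_congr iff_comm
    cases hx : x 0 <;> cases hy : y 0 <;> simp [hx, hy, hh, h1, eq_comm]

theorem adj_of_insert (hT : Y.IsMedianModel T) {σ τ : W} {h : H} (hh : h ∉ T σ)
    (he : T τ = insert h (T σ)) : Y.skeleton.Adj σ τ := by
  refine hT.adj_iff.2 ⟨h, fun g => ?_⟩
  rw [he, Finset.mem_insert]
  by_cases hg : g = h
  · subst hg; simp [hh]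
  · simp [hg]

theorem insert_of_adj (hT : Y.IsMedianModel T) {σ τ : W} (h : Y.skeleton.Adj σ τ) :
    ∃ k, (k ∉ T σ ∧ T τ = insert k (T σ)) ∨ (k ∉ T τ ∧ T σ = insert k (T τ)) := by
  obtain ⟨k, hk⟩ := hT.adj_iff.1 h
  refine ⟨k, ?_⟩
  have h1 := (hk k).2 rfl
  have h2 : ∀ g, g ≠ k → (g ∈ T σ ↔ g ∈ T τ) := fun g hg => by
    by_contra hc; exact hg ((hk g).1 hc)
  by_cases hkσ : k ∈ T σ
  · have hkτ : k ∉ T τ := by tauto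
    refine .inr ⟨hkτ, ?_⟩
    ext g
    by_cases hg : g = k
    · subst hg; simp [hkσ]
    · simp [hg, h2 g hg]
  · have hkτ : k ∈ T τ := by tauto
    refine .inl ⟨hkσ, ?_⟩
    ext g
    by_cases hg : g = k
    · subst hg; simp [hkτ]
    · simp [hg, h2 g hg]

theorem isCube_of (hT : Y.IsMedianModel T) {n : ℕ} {f : (Fin n → Bool) → W} {A : Finset H}
    {k : Fin n → H} (hk : Function.Injective k) (hA : ∀ i, k i ∉ A)
    (hf : ∀ x h, h ∈ T (f x) ↔ h ∈ A ∨ ∃ i, k i = h ∧ x i = true) : Y.IsCube f := by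
  refine (hT.isCube_iff f).2 ⟨k, hk, fun x y h => ?_⟩
  rw [hf, hf]
  by_cases hh : ∃ i, k i = h
  · obtain ⟨i, rfl⟩ := hh
    simp only [hA i, false_or, hk.eq_iff, exists_eq_left]
    cases x i <;> cases y i <;> simp
  · push Not at hh
    have : ∀ P : Fin n → Prop, ¬∃ i, k i = h ∧ P i := fun P ⟨i, hi, _⟩ => hh i hi
    simp [this]

theorem isSquare_of (hT : Y.IsMedianModel T) {p q r s : W} {a b : H} (hab : a ≠ b)
    (ha : a ∉ T p) (hb : b ∉ T p) (hq : T q = insert a (T p)) (hs : T s = insert b (T p))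
    (hr : T r = insert a (insert b (T p))) : Y.IsSquare p q r s := by
  refine ⟨fun x => if x 0 then (if x 1 then r else q) else (if x 1 then s else p),
    hT.isCube_of (A := T p) (k := ![a, b]) ?_ ?_ ?_, by simp, by simp, by simp, by simp⟩
  · intro i j hij
    fin_cases i <;> fin_cases j <;> simp_all
  · intro i
    fin_cases i <;> simp_all
  · intro x h
    rw [Fin.exists_fin_two]
    cases hx : x 0 <;> cases hy : x 1 <;> simp [hq, hs, hr, eq_comm] <;> tauto

/-- A path along which the sets decrease. -/
def IsDecreasing (T : W → Finset H) {σ τ : W} (p : Y.skeleton.Walk σ τ) : Prop :=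
  ∀ d ∈ p.darts, (T d.snd).card < (T d.fst).card

theorem IsDecreasing.cons {σ τ ρ : W} {p : Y.skeleton.Walk τ ρ} (hp : IsDecreasing T p)
    (h : Y.skeleton.Adj σ τ) (hlt : (T τ).card < (T σ).card) :
    IsDecreasing T (.cons h p : Y.skeleton.Walk σ ρ) := by
  intro d hd
  rw [SimpleGraph.Walk.darts_cons, List.mem_cons] at hd
  rcases hd with rfl | hd
  · exact hlt
  · exact hp d hd

theorem exists_isDecreasing (hT : Y.IsMedianModel T) {o : W} (ho : T o = ∅) (n : ℕ) :
    ∀ σ : W, (T σ).card = n → ∃ p : Y.skeleton.Walk σ o, IsDecreasing T p := by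
  induction n with
  | zero =>
    intro σ hσ
    obtain rfl : σ = o := hT.injective (by rw [ho, Finset.card_eq_zero.1 hσ])
    exact ⟨.nil, by intro d hd; simp at hd⟩
  | succ n ih =>
    intro σ hσ
    obtain ⟨m, hm, τ, hτ⟩ := hT.family.exists_erase_mem ⟨σ, rfl⟩
      (Finset.card_pos.1 (by omega : 0 < (T σ).card))
    have hc : (T τ).card = n := by rw [hτ, Finset.card_erase_of_mem hm, hσ]; rfl
    obtain ⟨p, hp⟩ := ih τ hc
    refine ⟨_, hp.cons (hT.adj_of_insert (σ := τ) (τ := σ) (h := m) ?_ ?_).symm (by omega)⟩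
    · rw [hτ]; exact Finset.notMem_erase _ _
    · rw [hτ, Finset.insert_erase hm]

/-- If the paths first remove different points `a` and `b`, removing both leaves the intersection of
two members. This completes a square, through which the two paths are compared by induction. -/
theorem homotopic_of_isDecreasing (hT : Y.IsMedianModel T) {o : W} (ho : T o = ∅) (n : ℕ) :
    ∀ σ : W, (T σ).card = n → ∀ p q : Y.skeleton.Walk σ o, IsDecreasing T p → IsDecreasing T q →
      Y.Homotopic p q := by
  induction n with
  | zero =>
    intro σ hσ p q hp hq
    cases p with
    | nil =>
      cases q with
      | nil => exact .refl _
      | cons h q => exact absurd (hq _ (List.mem_cons_self ..)) (by simp [hσ])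
    | cons h p => exact absurd (hp _ (List.mem_cons_self ..)) (by simp [hσ])
  | succ n ih =>
    intro σ hσ p q hp hq
    have hne : σ ≠ o := by rintro rfl; simp [ho] at hσ
    have key : ∀ {τ : W}, Y.skeleton.Adj σ τ → (T τ).card < (T σ).card →
        ∃ k ∈ T σ, T τ = (T σ).erase k := by
      intro τ h hlt
      obtain ⟨k, ⟨hk, he⟩ | ⟨hk, he⟩⟩ := hT.insert_of_adj h
      · rw [he, Finset.card_insert_of_notMem hk] at hlt; omega
      · exact ⟨k, by rw [he]; exact Finset.mem_insert_self _ _, by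
          rw [he, Finset.erase_insert hk]⟩
    cases p with
    | nil => exact absurd rfl hne
    | @cons _ τ₁ _ h₁ p =>
      cases q with
      | nil => exact absurd rfl hne
      | @cons _ τ₂ _ h₂ q =>
        have hp1 := hp _ (List.mem_cons_self ..)
        have hq1 := hq _ (List.mem_cons_self ..)
        have hp2 : IsDecreasing T p := fun d hd => hp d (List.mem_cons_of_mem _ hd)
        have hq2 : IsDecreasing T q := fun d hd => hq d (List.mem_cons_of_mem _ hd)
        obtain ⟨a, ha, hτ₁⟩ := key h₁ hp1
        obtain ⟨b, hb, hτ₂⟩ := key h₂ hq1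
        have c1 : (T τ₁).card = n := by rw [hτ₁, Finset.card_erase_of_mem ha, hσ]; rfl
        have c2 : (T τ₂).card = n := by rw [hτ₂, Finset.card_erase_of_mem hb, hσ]; rfl
        by_cases hab : a = b
        · subst hab
          obtain rfl : τ₁ = τ₂ := hT.injective (hτ₁.trans hτ₂.symm)
          exact .cons h₁ (ih _ c1 p q hp2 hq2)
        obtain ⟨ρ, hρ⟩ := hT.family.inter_mem ⟨τ₁, rfl⟩ ⟨τ₂, rfl⟩
        have e1 : T τ₁ = insert b (T ρ) := by
          rw [hρ, hτ₁, hτ₂]; ext x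
          simp only [Finset.mem_insert, Finset.mem_inter, Finset.mem_erase]
          by_cases hx : x = b
          · subst hx; simp [hb, Ne.symm hab]
          · simp [hx]
        have e2 : T τ₂ = insert a (T ρ) := by
          rw [hρ, hτ₁, hτ₂]; ext x
          simp only [Finset.mem_insert, Finset.mem_inter, Finset.mem_erase]
          by_cases hx : x = a
          · subst hx; simp [ha, hab]
          · simp [hx]
        have e3 : T σ = insert b (insert a (T ρ)) := by
          rw [← e2, hτ₂, Finset.insert_erase hb]
        have haρ : a ∉ T ρ := by rw [hρ, hτ₁]; simp
        have hbρ : b ∉ T ρ := by rw [hρ, hτ₂]; simp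
        have hs : Y.IsSquare ρ τ₁ σ τ₂ := hT.isSquare_of (Ne.symm hab) hbρ haρ e1 e2 e3
        obtain ⟨r, hr⟩ := hT.exists_isDecreasing ho _ ρ rfl
        have a1 := (hT.adj_of_insert hbρ e1).symm
        have a2 := (hT.adj_of_insert haρ e2).symm
        have l1 : (T ρ).card < (T τ₁).card := by
          rw [e1, Finset.card_insert_of_notMem hbρ]; omega
        have l2 : (T ρ).card < (T τ₂).card := by
          rw [e2, Finset.card_insert_of_notMem haρ]; omega
        exact (Homotopic.cons h₁ (ih _ c1 _ _ hp2 (hr.cons a1 l1))).trans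
          ((Homotopic.square h₁ a1 h₂ a2 r hs.rotate.rotate.reflect).trans
            (Homotopic.cons h₂ (ih _ c2 _ _ (hr.cons a2 l2) hq2)))

/-- Fix a decreasing path `γ σ` from each `σ` to the empty set. An edge followed by `γ` is homotopic
to `γ` at its start, hence so is any path followed by `γ`; for a loop, cancelling `γ` gives
triviality. -/
theorem isSimplyConnected (hT : Y.IsMedianModel T) : Y.IsSimplyConnected := by
  obtain ⟨o, ho⟩ := hT.family.empty_mem
  have hγ := fun σ => hT.exists_isDecreasing ho _ σ rfl
  choose γ hγ using hγ
  have h1 : ∀ {σ τ : W} (h : Y.skeleton.Adj σ τ), Y.Homotopic (.cons h (γ τ)) (γ σ) := by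
    intro σ τ h
    have h2 : ∀ {σ τ : W} (h : Y.skeleton.Adj σ τ), (T τ).card < (T σ).card →
      Y.Homotopic (.cons h (γ τ)) (γ σ) := fun {σ τ} h hlt =>
        hT.homotopic_of_isDecreasing ho _ σ rfl _ _ ((hγ τ).cons h hlt) (hγ σ)
    obtain ⟨k, ⟨hk, he⟩ | ⟨hk, he⟩⟩ := hT.insert_of_adj h
    · have h3 := h2 h.symm (by rw [he, Finset.card_insert_of_notMem hk]; omega)
      exact (Homotopic.cons h h3.symm).trans (.backtrack h _)
    · exact h2 h (by rw [he, Finset.card_insert_of_notMem hk]; omega)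
  have h2 : ∀ {σ τ : W} (p : Y.skeleton.Walk σ τ), Y.Homotopic (p.append (γ τ)) (γ σ) := by
    intro σ τ p
    induction p with
    | nil => exact .refl _
    | cons h p ih => exact (Homotopic.cons h ih).trans (h1 h)
  have : Nonempty W := ⟨o⟩
  refine ⟨.mk fun σ τ => ⟨(γ σ).append (γ τ).reverse⟩, fun σ p => ?_⟩
  have h3 := (h2 p).append_right (γ σ).reverse
  rw [← SimpleGraph.Walk.append_assoc] at h3
  have h4 := (homotopic_append_reverse (γ σ)).append_left p
  rw [SimpleGraph.Walk.append_nil] at h4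
  exact h4.symm.trans (h3.trans (homotopic_append_reverse _))

theorem majority_differs {p a b c : Prop} (hab : ¬(p ↔ a) ∨ ¬(p ↔ b)) (hac : ¬(p ↔ a) ∨ ¬(p ↔ c))
    (hbc : ¬(p ↔ b) ∨ ¬(p ↔ c)) : ¬(p ↔ ((a ∧ b) ∨ (b ∧ c)) ∨ (a ∧ c)) := by
  by_cases p <;> by_cases a <;> by_cases b <;> by_cases c <;> simp_all

/-- The corner of the cube for a set `E` of directions is built by induction on `E`. Squares give
the case of two directions. For three directions `a`, `b`, `c` in `E`, take the majority of the
corners for `E` without `a`, without `b` and without `c`: each direction of `E` is missing from at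
most one of the three. -/
theorem hasFlagLinks (hT : Y.IsMedianModel T) : Y.HasFlagLinks := by
  intro v n w hw hadj hsq
  have hk : ∀ i, ∃ h, ∀ g, ¬(g ∈ T v ↔ g ∈ T (w i)) ↔ g = h := fun i => hT.adj_iff.1 (hadj i)
  choose k hk using hk
  have hkinj : Function.Injective k := by
    intro i j hij
    refine hw (hT.injective ?_)
    ext g
    have h1 := hk i g
    have h2 := hk j g
    rw [hij, ← h2] at h1
    tauto
  have key : ∀ (m : ℕ) (E : Finset (Fin n)), E.card = m →
      ∃ u, ∀ g, ¬(g ∈ T v ↔ g ∈ T u) ↔ ∃ i ∈ E, g = k i := by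
    intro m
    induction m using Nat.strong_induction_on with
    | _ m ih =>
    intro E hE
    by_cases h0 : E = ∅
    · subst h0; exact ⟨v, by simp⟩
    obtain ⟨a, ha⟩ := Finset.nonempty_iff_ne_empty.2 h0
    by_cases h1 : E.erase a = ∅
    · obtain rfl : E = {a} := by rw [← Finset.insert_erase ha, h1]; rfl
      exact ⟨w a, by simpa using hk a⟩
    obtain ⟨b, hb⟩ := Finset.nonempty_iff_ne_empty.2 h1
    have hab : a ≠ b := (Finset.mem_erase.1 hb).1.symm
    by_cases h2 : (E.erase a).erase b = ∅
    · have hE2 : E = {a, b} := by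
        rw [← Finset.insert_erase ha, ← Finset.insert_erase hb, h2]
        rfl
      obtain ⟨r, f, hf, f00, f10, f11, f01⟩ := hsq a b hab
      obtain ⟨κ, hκ, hx⟩ := (hT.isCube_iff f).1 hf
      have e0 : κ 0 = k a := by
        have := (hk a (κ 0)).1
        rw [← f00, ← f10, hx] at this
        exact this ⟨0, rfl, by simp⟩
      have e1 : κ 1 = k b := by
        have := (hk b (κ 1)).1
        rw [← f00, ← f01, hx] at this
        exact this ⟨1, rfl, by simp⟩
      refine ⟨r, fun g => ?_⟩
      rw [← f00, ← f11, hx, hE2, Fin.exists_fin_two, e0, e1]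
      simp [eq_comm]
    obtain ⟨c, hc⟩ := Finset.nonempty_iff_ne_empty.2 h2
    have hbE := (Finset.mem_erase.1 hb).2
    have hcE := (Finset.mem_erase.1 (Finset.mem_erase.1 hc).2).2
    have hbc : b ≠ c := (Finset.mem_erase.1 hc).1.symm
    have hac : a ≠ c := (Finset.mem_erase.1 (Finset.mem_erase.1 hc).2).1.symm
    have hlt : ∀ x ∈ E, (E.erase x).card < m := fun x hx => by
      rw [← hE]; exact Finset.card_erase_lt_of_mem hx
    obtain ⟨ua, hua⟩ := ih _ (hlt a ha) _ rfl
    obtain ⟨ub, hub⟩ := ih _ (hlt b hbE) _ rfl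
    obtain ⟨uc, huc⟩ := ih _ (hlt c hcE) _ rfl
    obtain ⟨u, hu⟩ := hT.family.median_mem ⟨ua, rfl⟩ ⟨ub, rfl⟩ ⟨uc, rfl⟩
    refine ⟨u, fun g => ?_⟩
    have hga := hua g
    have hgb := hub g
    have hgc := huc g
    rw [hu]
    simp only [Finset.mem_union, Finset.mem_inter]
    by_cases hg : ∃ i ∈ E, g = k i
    · obtain ⟨i, hi, rfl⟩ := hg
      have e : ∀ x, (∃ j ∈ E.erase x, k i = k j) ↔ i ≠ x := by
        intro x
        simp [hkinj.eq_iff, hi]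
      rw [e] at hga hgb hgc
      have hR : (∃ j ∈ E, k i = k j) ↔ True := iff_true_intro ⟨i, hi, rfl⟩
      rw [hR]
      exact iff_true_intro (majority_differs
        (by rw [hga, hgb]; exact not_and_or.1 fun h => hab (h.1.symm.trans h.2))
        (by rw [hga, hgc]; exact not_and_or.1 fun h => hac (h.1.symm.trans h.2))
        (by rw [hgb, hgc]; exact not_and_or.1 fun h => hbc (h.1.symm.trans h.2)))
    · have e : ∀ x, (∃ j ∈ E.erase x, g = k j) ↔ False := by
        intro x
        rw [iff_false]
        rintro ⟨j, hj, rfl⟩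
        exact hg ⟨j, (Finset.mem_erase.1 hj).2, rfl⟩
      rw [e, iff_false, not_not] at hga hgb hgc
      rw [← hga, ← hgb, ← hgc]
      simp [hg]
  choose u hu using fun E : Finset (Fin n) => key _ E rfl
  have hf : ∀ (x : Fin n → Bool) g, ¬(g ∈ T v ↔ g ∈ T (u (Finset.univ.filter fun i => x i = true))) ↔
      ∃ i, g = k i ∧ x i = true := by
    intro x g
    rw [hu]
    simp [and_comm]
  refine ⟨fun x => u (Finset.univ.filter fun i => x i = true),
    (hT.isCube_iff _).2 ⟨k, hkinj, fun x y g => ?_⟩, ?_, fun i => ?_⟩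
  · have h1 := hf x g
    have h2 := hf y g
    by_cases hg : ∃ i, g = k i
    · obtain ⟨i, rfl⟩ := hg
      simp only [hkinj.eq_iff, exists_eq_left, exists_eq_left'] at h1 h2 ⊢
      rw [ne_eq, Bool.eq_iff_iff, ← h1, ← h2]
      tauto
    · push Not at hg
      have e : ∀ P : Fin n → Prop, ¬∃ i, g = k i ∧ P i := fun P ⟨i, hi, _⟩ => hg i hi
      have e' : ∀ P : Fin n → Prop, ¬∃ i, k i = g ∧ P i := fun P ⟨i, hi, _⟩ => hg i hi.symm
      simp only [e, e', iff_false, not_not] at h1 h2 ⊢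
      tauto
  · refine hT.injective ?_
    ext g
    have := hf (fun _ => false) g
    simp only [Bool.false_eq_true, and_false, exists_false, iff_false, not_not] at this
    exact this.symm
  · refine hT.injective ?_
    ext g
    have h1 := hf (fun j => decide (j = i)) g
    have h2 := hk i g
    simp only [decide_eq_true_eq, exists_eq_right] at h1
    rw [← h2] at h1
    simp only [decide_eq_true_eq] at h1 ⊢
    tauto

theorem isCAT0 (hT : Y.IsMedianModel T) : Y.IsCAT0 := ⟨hT.isSimplyConnected, hT.hasFlagLinks⟩

/-! ### Hyperplanes of a median model -/

/-- Move the edge from `σ` to `σ'` across squares. A point `m` that may be added to `T τ` inside `T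
τ'` may also be added to `T σ`, by intersecting with `T σ'`, and the two edges labelled `h` are
opposite in the resulting square. -/
theorem hyp_eq_of_subset (hT : Y.IsMedianModel T) {h : H} (n : ℕ) : ∀ {σ τ σ' τ' : W}
    (a : Y.skeleton.Adj σ τ) (a' : Y.skeleton.Adj σ' τ'), h ∉ T σ → T τ = insert h (T σ) →
    h ∉ T σ' → T τ' = insert h (T σ') → T σ ⊆ T σ' → (T σ' \ T σ).card = n →
    Y.hyp a = Y.hyp a' := by
  induction n with
  | zero =>
    intro σ τ σ' τ' a a' h1 h2 h3 h4 hs hc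
    rw [Finset.card_eq_zero, Finset.sdiff_eq_empty_iff_subset] at hc
    obtain rfl : σ = σ' := hT.injective (hs.antisymm hc)
    obtain rfl : τ = τ' := hT.injective (h2.trans h4.symm)
    rfl
  | succ n ih =>
    intro σ τ σ' τ' a a' h1 h2 h3 h4 hs hc
    have hss : T τ ⊂ T τ' := by
      refine Finset.ssubset_iff_subset_ne.2 ⟨?_, fun he => ?_⟩
      · rw [h2, h4]; exact Finset.insert_subset_insert _ hs
      · have : T σ = T σ' := by
          rw [← Finset.erase_insert h1, ← h2, he, h4, Finset.erase_insert h3]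
        rw [this, Finset.sdiff_self] at hc
        simp at hc
    obtain ⟨m, hm, hmτ, τ₁, hτ₁⟩ := hT.family.exists_insert_mem ⟨τ, rfl⟩ ⟨τ', rfl⟩ hss
    have hmh : m ≠ h := by rintro rfl; exact hmτ (by rw [h2]; exact Finset.mem_insert_self _ _)
    have hmσ : m ∉ T σ := fun hc => hmτ (by rw [h2]; exact Finset.mem_insert_of_mem hc)
    have hmσ' : m ∈ T σ' := by
      rw [h4] at hm; exact (Finset.mem_insert.1 hm).resolve_left hmh
    obtain ⟨σ₁, hσ₁⟩ := hT.family.inter_mem ⟨τ₁, rfl⟩ ⟨σ', rfl⟩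
    have e1 : T σ₁ = insert m (T σ) := by
      rw [hσ₁, hτ₁, h2]
      ext x
      simp only [Finset.mem_inter, Finset.mem_insert]
      by_cases hx : x = m
      · subst hx; simp [hmσ']
      by_cases hx' : x = h
      · subst hx'; simp [hx, h1, h3]
      simp only [hx, hx', false_or]
      exact ⟨fun h => h.1, fun h => ⟨h, hs h⟩⟩
    have e2 : T τ₁ = insert h (T σ₁) := by rw [hτ₁, h2, e1, Finset.insert_comm]
    have h5 : h ∉ T σ₁ := by rw [e1]; simp [h1, hmh.symm]
    have a₁ := hT.adj_of_insert h5 e2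
    have hsq : Y.IsSquare σ τ τ₁ σ₁ :=
      hT.isSquare_of hmh.symm h1 hmσ h2 e1 (by rw [e2, e1])
    rw [hyp_eq_of_isSquare hsq a a₁]
    refine ih a₁ a' h5 e2 h3 h4 ?_ ?_
    · rw [e1]; exact Finset.insert_subset hmσ' hs
    · have : T σ' \ T σ₁ = (T σ' \ T σ).erase m := by
        rw [e1]; ext x; simp only [Finset.mem_sdiff, Finset.mem_insert, Finset.mem_erase]; tauto
      rw [this, Finset.card_erase_of_mem (Finset.mem_sdiff.2 ⟨hmσ', hmσ⟩), hc]
      rfl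

theorem hyp_eq_of_insert (hT : Y.IsMedianModel T) {h : H} {σ τ σ' τ' : W}
    (a : Y.skeleton.Adj σ τ) (a' : Y.skeleton.Adj σ' τ') (h1 : h ∉ T σ)
    (h2 : T τ = insert h (T σ)) (h3 : h ∉ T σ') (h4 : T τ' = insert h (T σ')) :
    Y.hyp a = Y.hyp a' := by
  -- Both edges are compared with the edge labelled `h` between the intersections of their lower and
  -- of their upper ends.
  obtain ⟨ρ, hρ⟩ := hT.family.inter_mem ⟨σ, rfl⟩ ⟨σ', rfl⟩
  obtain ⟨ρ', hρ'⟩ := hT.family.inter_mem ⟨τ, rfl⟩ ⟨τ', rfl⟩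
  have h5 : h ∉ T ρ := by rw [hρ]; simp [h1]
  have h6 : T ρ' = insert h (T ρ) := by
    rw [hρ', hρ, h2, h4, ← Finset.insert_inter_distrib]
  have b := hT.adj_of_insert h5 h6
  rw [← hT.hyp_eq_of_subset _ b a h5 h6 h1 h2 (by rw [hρ]; exact Finset.inter_subset_left) rfl]
  exact hT.hyp_eq_of_subset _ b a' h5 h6 h3 h4 (by rw [hρ]; exact Finset.inter_subset_right) rfl

theorem hyp_eq (hT : Y.IsMedianModel T) {h : H} {σ τ σ' τ' : W}
    (a : Y.skeleton.Adj σ τ) (a' : Y.skeleton.Adj σ' τ') (h1 : ¬(h ∈ T σ ↔ h ∈ T τ))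
    (h2 : ¬(h ∈ T σ' ↔ h ∈ T τ')) : Y.hyp a = Y.hyp a' := by
  have key : ∀ {σ τ : W} (a : Y.skeleton.Adj σ τ), ¬(h ∈ T σ ↔ h ∈ T τ) →
      (h ∉ T σ ∧ T τ = insert h (T σ)) ∨ (h ∉ T τ ∧ T σ = insert h (T τ)) := by
    intro σ τ a h1
    obtain ⟨k, ⟨hk, he⟩ | ⟨hk, he⟩⟩ := hT.insert_of_adj a
    · obtain rfl : h = k := by
        by_contra hne
        exact h1 (by rw [he]; simp [hne])
      exact .inl ⟨hk, he⟩
    · obtain rfl : h = k := by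
        by_contra hne
        exact h1 (by rw [he]; simp [hne])
      exact .inr ⟨hk, he⟩
  rcases key a h1 with ⟨b1, b2⟩ | ⟨b1, b2⟩ <;> rcases key a' h2 with ⟨c1, c2⟩ | ⟨c1, c2⟩
  · exact hT.hyp_eq_of_insert a a' b1 b2 c1 c2
  · rw [← hyp_symm a']; exact hT.hyp_eq_of_insert a a'.symm b1 b2 c1 c2
  · rw [← hyp_symm a]; exact hT.hyp_eq_of_insert a.symm a' b1 b2 c1 c2
  · rw [← hyp_symm a, ← hyp_symm a']; exact hT.hyp_eq_of_insert a.symm a'.symm b1 b2 c1 c2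

theorem exists_label (hT : Y.IsMedianModel T) : ∃ f : Y.Hyperplane → H, Function.Injective f ∧
    ∀ (d : Y.skeleton.Dart) (h : H), f (Y.dual d) = h ↔ ¬(h ∈ T d.fst ↔ h ∈ T d.snd) := by
  have hex : ∀ e : Y.skeleton.edgeSet, ∃ h, ∀ σ τ, (e : Sym2 W) = s(σ, τ) →
      ∀ g, ¬(g ∈ T σ ↔ g ∈ T τ) ↔ g = h := by
    rintro ⟨e, he⟩
    induction e using Sym2.ind with
    | _ σ τ =>
    obtain ⟨h, hh⟩ := hT.adj_iff.1 he
    refine ⟨h, fun σ' τ' hs g => ?_⟩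
    rcases Sym2.eq_iff.1 hs with ⟨rfl, rfl⟩ | ⟨rfl, rfl⟩
    · exact hh g
    · rw [← hh g]; exact not_congr iff_comm
  choose f hf using hex
  have hinv : ∀ e e', Y.OppositeEdges e e' → f e = f e' := by
    rintro e e' ⟨p, q, r, s, ⟨φ, hφ, rfl, rfl, rfl, rfl⟩, he, he'⟩
    obtain ⟨k, hk, hx⟩ := (hT.isCube_iff φ).1 hφ
    have e1 := (hf e _ _ he (k 0)).1 ((hx _ _ _).2 ⟨0, rfl, by simp⟩)
    have e2 := (hf e' _ _ he' (k 0)).1 ((hx _ _ _).2 ⟨0, rfl, by simp⟩)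
    rw [← e1, ← e2]
  refine ⟨Quot.lift f hinv, ?_, fun d h => ?_⟩
  · rintro ⟨⟨e, he⟩⟩ ⟨⟨e', he'⟩⟩ heq
    induction e using Sym2.ind with
    | _ σ τ =>
    induction e' using Sym2.ind with
    | _ σ' τ' =>
    change f _ = f _ at heq
    exact hT.hyp_eq he he' ((hf ⟨s(σ, τ), he⟩ _ _ rfl _).2 rfl)
      ((hf ⟨s(σ', τ'), he'⟩ _ _ rfl _).2 heq)
  · rw [hf ⟨d.edge, d.edge_mem⟩ d.fst d.snd rfl h, eq_comm]
    rfl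

end IsMedianModel

end CubeComplex

namespace CubeComplex

variable {V : Type u} {X : CubeComplex V}

/-! ### The median family of a CAT(0) cube complex -/

theorem mem_sep_iff (hX : X.IsCAT0) (o u v : V) (h : X.Hyperplane) :
    h ∈ sep hX u v ↔ ¬(h ∈ sep hX o u ↔ h ∈ sep hX o v) := by
  rw [mem_sep_triangle hX u o v, mem_sep_comm hX]

open Classical in
theorem insert_of_sep (hX : X.IsCAT0) (o : V) {u v : V} {k : X.Hyperplane}
    (h : sep hX u v = {k}) (hu : k ∉ sep hX o u) : sep hX o v = insert k (sep hX o u) := by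
  ext g
  have := mem_sep_iff hX o u v g
  rw [h, Finset.mem_singleton] at this
  rw [Finset.mem_insert]
  by_cases hg : g = k
  · subst hg; tauto
  · tauto

theorem iff_majority {m a b c : Prop} (hab : ¬(¬(m ↔ a) ∧ ¬(m ↔ b)))
    (hac : ¬(¬(m ↔ a) ∧ ¬(m ↔ c))) (hbc : ¬(¬(m ↔ b) ∧ ¬(m ↔ c))) :
    m ↔ ((a ∧ b) ∨ (b ∧ c)) ∨ (a ∧ c) := by
  by_cases m <;> by_cases a <;> by_cases b <;> by_cases c <;> simp_all

open Classical in
-- No hyperplane separates a median from two of the three vertices, so its set is their majority. A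
-- hyperplane is a class of edges, and the ends of any one of them differ exactly in that
-- hyperplane.
theorem isMedianFamily_sep (hX : X.IsCAT0) (o : V) : IsMedianFamily (Set.range (sep hX o)) where
  empty_mem := ⟨o, sep_self hX o⟩
  median_mem := by
    rintro _ _ _ ⟨u, rfl⟩ ⟨v, rfl⟩ ⟨w, rfl⟩
    obtain ⟨m, hm⟩ := exists_median hX u v w
    refine ⟨m, ?_⟩
    ext h
    have := hm h
    rw [mem_sep_iff hX o m u, mem_sep_iff hX o m v, mem_sep_iff hX o m w] at this
    simp only [Finset.mem_union, Finset.mem_inter]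
    exact iff_majority this.1 this.2.1 this.2.2
  exists_insert := by
    rintro _ ⟨⟨e, he⟩⟩ - -
    induction e using Sym2.ind with
    | _ u v =>
    have hs : sep hX u v = {X.hyp he} := sep_of_adj hX he
    by_cases hu : X.hyp he ∈ sep hX o u
    · have hs' : sep hX v u = {X.hyp he} := by
        rw [← hyp_symm he]; exact sep_of_adj hX _
      have hv : X.hyp he ∉ sep hX o v := by
        have := mem_sep_iff hX o u v (X.hyp he)
        rw [hs, Finset.mem_singleton] at this
        tauto
      exact ⟨_, ⟨v, rfl⟩, hv, u, insert_of_sep hX o hs' hv⟩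
    · exact ⟨_, ⟨u, rfl⟩, hu, v, insert_of_sep hX o hs hu⟩

theorem flip_induction {n : ℕ} {P : (Fin n → Bool) → Prop} {x : Fin n → Bool} (h0 : P x)
    (hflip : ∀ y i, P y → P (flip i y)) (y : Fin n → Bool) : P y := by
  have key : ∀ (s : Finset (Fin n)) y, (∀ i, y i ≠ x i ↔ i ∈ s) → P y := by
    intro s
    induction s using Finset.induction_on with
    | empty =>
      intro y hy
      obtain rfl : y = x := funext fun i => by simpa using hy i
      exact h0
    | insert a s ha ih =>
      intro y hy
      rw [← flip_flip a y]
      refine hflip _ _ (ih _ fun i => ?_)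
      by_cases hi : i = a
      · subst hi
        have := (hy i).2 (Finset.mem_insert_self _ _)
        rw [flip_same]
        simp [ha, Bool.eq_not_of_ne this]
      · rw [flip_ne hi, hy]
        simp [hi]
  exact key (Finset.univ.filter fun i => y i ≠ x i) y (by simp)

/-- The edges of a cube in the `i`-th direction all cross the hyperplane `k i`. -/
theorem IsCAT0.exists_cube_labels (hX : X.IsCAT0) {n : ℕ} {f : (Fin n → Bool) → V}
    (hf : X.IsCube f) : ∃ k : Fin n → X.Hyperplane, Function.Injective k ∧
      ∀ x y h, h ∈ sep hX (f x) (f y) ↔ ∃ i, k i = h ∧ x i ≠ y i := by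
  let k : Fin n → X.Hyperplane := fun i => X.hyp (adj_flip hf (fun _ => false) i)
  have hk : ∀ x i, X.hyp (adj_flip hf x i) = k i := by
    intro x
    induction x using flip_induction (x := fun _ => false) with
    | h0 => exact fun i => rfl
    | hflip x j ih =>
      intro i
      rw [← ih i]
      by_cases hij : i = j
      · subst hij
        rw [← hyp_symm (adj_flip hf x i)]
        congr 1
        rw [flip_flip]
      · have h1 := isSquare_flip hf x hij
        rw [flip_comm] at h1
        exact (hyp_eq_of_isSquare h1 (adj_flip hf x i) (adj_flip hf (flip j x) i)).symm
  have hsep : ∀ x i, sep hX (f x) (f (flip i x)) = {k i} := fun x i => by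
    rw [sep_of_adj hX (adj_flip hf x i), hk]
  have hkinj : Function.Injective k := by
    intro i j hij
    by_contra hne
    have : f (flip i (fun _ => false)) = f (flip j (fun _ => false)) := by
      refine eq_of_sep_eq_empty hX (Finset.eq_empty_iff_forall_notMem.2 fun h => ?_)
      rw [mem_sep_triangle hX _ (f fun _ => false), mem_sep_comm hX, hsep, hsep, hij]
      simp
    have := congrFun (X.injective hf this) i
    rw [flip_same, flip_ne hne] at this
    simp at this
  refine ⟨k, hkinj, fun x y h => ?_⟩
  induction y using flip_induction (x := x) with
  | h0 => simp [sep_self]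
  | hflip y i ih =>
    rw [mem_sep_triangle hX _ (f y), hsep, ih, Finset.mem_singleton]
    by_cases hh : h = k i
    · subst hh
      simp only [hkinj.eq_iff, exists_eq_left, flip_same]
      cases x i <;> cases y i <;> simp
    · rw [iff_false_right hh, not_not]
      refine exists_congr fun j => and_congr_right fun hj => ?_
      have : j ≠ i := by rintro rfl; exact hh hj.symm
      rw [flip_ne this]

/-! ### The restricted complex as a median model -/

/-- The chosen halfspaces have a common vertex, so they are the sides containing it. Orientations
thus become traces on `K` of the sets of vertices. -/
theorem Orientation.apply_eq (hX : X.IsCAT0) {K : Set X.Hyperplane} (σ : X.Orientation K) (h : K) :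
    σ.1 h = X.side h σ.2.2.some := by
  obtain ⟨x, hx⟩ := σ.2.1 h
  have h1 : σ.2.2.some ∈ σ.1 h := Set.mem_iInter.1 σ.2.2.some_mem h
  rw [hx] at h1 ⊢
  rw [side_eq_iff hX, ← mem_side hX]
  exact h1

/-- The orientation of the hyperplanes of `K` towards a vertex. -/
def orientation (X : CubeComplex V) (K : Set X.Hyperplane) (v : V) : X.Orientation K :=
  ⟨fun h => X.side h v, fun _ => ⟨v, rfl⟩, ⟨v, Set.mem_iInter.2 fun _ =>
    SimpleGraph.Reachable.refl _⟩⟩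

open Classical in
/-- The hyperplanes of `K` that separate an orientation from the base point. -/
noncomputable def orientationSep (hX : X.IsCAT0) (o : V) (K : Set X.Hyperplane)
    (σ : X.Orientation K) : Finset X.Hyperplane :=
  (sep hX o σ.2.2.some).filter (· ∈ K)

theorem orientationSep_subset (hX : X.IsCAT0) (o : V) (K : Set X.Hyperplane)
    (σ : X.Orientation K) {h : X.Hyperplane} (hh : h ∈ orientationSep hX o K σ) : h ∈ K := by
  classical
  exact (Finset.mem_filter.1 hh).2

theorem orientation_ne_iff (hX : X.IsCAT0) (o : V) {K : Set X.Hyperplane} (σ τ : X.Orientation K)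
    (h : K) : σ.1 h ≠ τ.1 h ↔
      ¬((h : X.Hyperplane) ∈ orientationSep hX o K σ ↔
        (h : X.Hyperplane) ∈ orientationSep hX o K τ) := by
  classical
  rw [σ.apply_eq hX, τ.apply_eq hX, ne_eq, side_eq_iff hX, not_not, mem_sep_iff hX o,
    orientationSep, orientationSep, Finset.mem_filter, Finset.mem_filter]
  simp [h.2]

open Classical in
theorem orientationSep_orientation (hX : X.IsCAT0) (o : V) (K : Set X.Hyperplane) (v : V) :
    orientationSep hX o K (X.orientation K v) = (sep hX o v).filter (· ∈ K) := by
  ext h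
  rw [orientationSep, Finset.mem_filter, Finset.mem_filter]
  refine and_congr_left fun hh => ?_
  have h1 := (X.orientation K v).apply_eq hX ⟨h, hh⟩
  have h2 : X.side h v = X.side h (X.orientation K v).2.2.some := h1
  rw [side_eq_iff hX, mem_sep_iff hX o, not_not] at h2
  exact h2.symm

open Classical in
theorem isMedianModel_restrict (hX : X.IsCAT0) (o : V) (K : Set X.Hyperplane) :
    (X.restrict K).IsMedianModel (orientationSep hX o K) where
  injective := by
    intro σ τ h
    refine Subtype.ext (funext fun k => ?_)
    by_contra hne
    exact (orientation_ne_iff hX o σ τ k).1 hne (by rw [h])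
  family := by
    have : Set.range (orientationSep hX o K) =
        (fun A => A.filter (· ∈ K)) '' Set.range (sep hX o) := by
      ext A
      constructor
      · rintro ⟨σ, rfl⟩
        exact ⟨_, ⟨_, rfl⟩, rfl⟩
      · rintro ⟨_, ⟨v, rfl⟩, rfl⟩
        exact ⟨_, orientationSep_orientation hX o K v⟩
    rw [this]
    exact (isMedianFamily_sep hX o).filter K
  isCube_iff := by
    intro n f
    constructor
    · rintro ⟨k, hk, hf⟩
      refine ⟨fun i => k i, Subtype.val_injective.comp hk, fun x y h => ?_⟩
      by_cases hh : h ∈ K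
      · rw [← orientation_ne_iff hX o (f x) (f y) ⟨h, hh⟩, hf]
        simp [Subtype.ext_iff]
      · have e : ∀ σ, h ∉ orientationSep hX o K σ := fun σ hc =>
          hh (orientationSep_subset hX o K σ hc)
        simp only [e, not_true_eq_false, false_iff, not_exists, not_and]
        rintro i rfl
        exact absurd (k i).2 hh
    · rintro ⟨k, hk, hf⟩
      have hkK : ∀ i, k i ∈ K := by
        intro i
        by_contra hh
        have e : ∀ σ, k i ∉ orientationSep hX o K σ := fun σ hc =>
          hh (orientationSep_subset hX o K σ hc)
        exact (hf (fun _ => false) (fun _ => true) (k i)).2 ⟨i, rfl, by simp⟩ (by simp [e])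
      refine ⟨fun i => ⟨k i, hkK i⟩, fun i j hij => hk (congrArg Subtype.val hij),
        fun x y h => ?_⟩
      rw [orientation_ne_iff hX o, hf]
      simp [Subtype.ext_iff]

/-- The hyperplanes of the restricted complex. -/
theorem exists_hyperplane_equiv (hX : X.IsCAT0) (o : V) (K : Set X.Hyperplane) :
    ∃ e : (X.restrict K).Hyperplane ≃ K, ∀ (d : (X.restrict K).skeleton.Dart) (h : K),
      e ((X.restrict K).dual d) = h ↔ d.fst.1 h ≠ d.snd.1 h := by
  classical
  have hT := isMedianModel_restrict hX o K
  obtain ⟨f, hf, hd⟩ := hT.exists_label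
  have hK : ∀ k, f k ∈ K := by
    rintro ⟨⟨e, he⟩⟩
    induction e using Sym2.ind with
    | _ σ τ =>
    by_contra hc
    exact (hd ⟨(σ, τ), he⟩ _).1 rfl (iff_of_false
      (fun h => hc (orientationSep_subset hX o K σ h))
      (fun h => hc (orientationSep_subset hX o K τ h)))
  refine ⟨Equiv.ofBijective (fun k => ⟨f k, hK k⟩)
    ⟨fun a b hab => hf (congrArg Subtype.val hab), ?_⟩, fun d h => ?_⟩
  -- Surjectivity: an edge of `X` that crosses a hyperplane of `K` stays an edge after the other
  -- hyperplanes are forgotten.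
  · rintro ⟨⟨⟨e, he⟩⟩, hh⟩
    induction e using Sym2.ind with
    | _ u v =>
    have hs : sep hX u v = {X.hyp he} := sep_of_adj hX he
    have hg : ∀ g, ¬(g ∈ orientationSep hX o K (X.orientation K u) ↔
        g ∈ orientationSep hX o K (X.orientation K v)) ↔ g = X.hyp he := by
      intro g
      rw [orientationSep_orientation, orientationSep_orientation, Finset.mem_filter,
        Finset.mem_filter]
      have := mem_sep_iff hX o u v g
      rw [hs, Finset.mem_singleton] at this
      rw [this]
      have hgK : g = X.hyp he → g ∈ K := by rintro rfl; exact hh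
      rw [this] at hgK
      tauto
    have ha := hT.adj_iff.2 ⟨_, hg⟩
    refine ⟨(X.restrict K).dual ⟨(_, _), ha⟩, Subtype.ext ?_⟩
    exact (hd _ _).2 ((hg _).2 rfl)
  · rw [orientation_ne_iff hX o, ← hd]
    exact Subtype.ext_iff

end CubeComplex

/-! ### Pouring mass down an order -/

namespace Pour

variable {κ : Type u}

/-- Functions with values in the unit interval. -/
def IsUnit (z : κ → ℝ) : Prop := ∀ h, 0 ≤ z h ∧ z h ≤ 1

/-- Order preserving maps that move mass downwards. -/
structure IsTransport (D : κ → Finset κ) (F : (κ → ℝ) → κ → ℝ) : Prop where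
  isUnit : ∀ {z}, IsUnit z → IsUnit (F z)
  mono : ∀ {z z'}, IsUnit z → IsUnit z' → z ≤ z' → F z ≤ F z'
  mass : ∀ {z} (P : Finset κ), IsUnit z → (∀ h, z h ≠ 0 → h ∈ P) → (∀ h ∈ P, D h ⊆ P) →
    (∀ h, F z h ≠ 0 → h ∈ P) ∧ ∑ h ∈ P, F z h = ∑ h ∈ P, z h

theorem IsTransport.foldl {D : κ → Finset κ} {ι : Type*} {F : ι → (κ → ℝ) → κ → ℝ} (L : List ι)
    (hF : ∀ i ∈ L, IsTransport D (F i)) : IsTransport D fun z => L.foldl (fun z i => F i z) z := by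
  induction L with
  | nil => exact ⟨fun h => h, fun _ _ h => h, fun P _ h _ => ⟨h, rfl⟩⟩
  | cons i L ih =>
    have h1 := hF i (List.mem_cons_self ..)
    have h2 := ih fun j hj => hF j (List.mem_cons_of_mem _ hj)
    refine ⟨fun h => h2.isUnit (h1.isUnit h), fun h h' hle =>
      h2.mono (h1.isUnit h) (h1.isUnit h') (h1.mono h h' hle), fun P h hP hD => ?_⟩
    obtain ⟨a1, a2⟩ := h1.mass P h hP hD
    obtain ⟨b1, b2⟩ := h2.mass P (h1.isUnit h) a1 hD
    exact ⟨b1, b2.trans a2⟩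

variable [DecidableEq κ]

/-- Move mass from `h` to `g` until `g` is full. -/
noncomputable def push (h g : κ) (z : κ → ℝ) : κ → ℝ :=
  Function.update (Function.update z g (min 1 (z g + z h))) h (max 0 (z g + z h - 1))

theorem push_top (h g : κ) (z : κ → ℝ) : push h g z h = max 0 (z g + z h - 1) := by
  simp [push]

theorem push_bot {h g : κ} (hgh : g ≠ h) (z : κ → ℝ) : push h g z g = min 1 (z g + z h) := by
  simp [push, hgh]

theorem push_of_ne {h g x : κ} (hx : x ≠ h) (hx' : x ≠ g) (z : κ → ℝ) : push h g z x = z x := by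
  simp [push, hx, hx']

theorem push_eq_self {h g : κ} (hgh : g ≠ h) {z : κ → ℝ} (hz : IsUnit z)
    (h0 : z h = 0 ∨ z g = 1) : push h g z = z := by
  have h1 := hz h
  have h2 := hz g
  funext x
  by_cases hx : x = h
  · subst hx
    rw [push_top]
    rcases h0 with h0 | h0
    · rw [h0, max_eq_left]; linarith
    · rw [h0, max_eq_right] <;> linarith
  by_cases hx' : x = g
  · subst hx'
    rw [push_bot hgh]
    rcases h0 with h0 | h0
    · rw [h0, min_eq_right] <;> linarith
    · rw [h0, min_eq_left]; linarith
  exact push_of_ne hx hx' z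

/-- The new values are `min 1 s` and `max 0 (s - 1)` for the total mass `s` of the two points: both
increase with `s`, and their sum is `s`. -/
theorem isTransport_push {D : κ → Finset κ} {h g : κ} (hgh : g ≠ h) (hg : g ∈ D h) :
    IsTransport D (push h g) where
  isUnit := by
    intro z hz x
    have h1 := hz h
    have h2 := hz g
    by_cases hx : x = h
    · subst hx
      rw [push_top]
      exact ⟨le_max_left _ _, max_le zero_le_one (by linarith)⟩
    by_cases hx' : x = g
    · subst hx'
      rw [push_bot hgh]
      exact ⟨le_min zero_le_one (by linarith), min_le_left _ _⟩
    rw [push_of_ne hx hx']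
    exact hz x
  mono := by
    intro z z' _ _ hle x
    have h1 := hle h
    have h2 := hle g
    by_cases hx : x = h
    · subst hx
      rw [push_top, push_top]
      exact max_le_max le_rfl (by linarith)
    by_cases hx' : x = g
    · subst hx'
      rw [push_bot hgh, push_bot hgh]
      exact min_le_min le_rfl (by linarith)
    rw [push_of_ne hx hx', push_of_ne hx hx']
    exact hle x
  mass := by
    intro z P hz hP hD
    by_cases h0 : z h = 0
    · rw [push_eq_self hgh hz (.inl h0)]
      exact ⟨hP, rfl⟩
    have hhP := hP h h0
    have hgP := hD h hhP hg
    refine ⟨fun x hx => ?_, ?_⟩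
    · by_cases hx1 : x = h
      · rwa [hx1]
      by_cases hx2 : x = g
      · rwa [hx2]
      rw [push_of_ne hx1 hx2] at hx
      exact hP x hx
    · have hgP' : g ∈ P.erase h := Finset.mem_erase.2 ⟨hgh, hgP⟩
      rw [← Finset.add_sum_erase _ _ hhP, ← Finset.add_sum_erase _ _ hgP',
        ← Finset.add_sum_erase _ z hhP, ← Finset.add_sum_erase _ z hgP', push_top, push_bot hgh,
        Finset.sum_congr rfl fun x hx => push_of_ne (Finset.mem_erase.1
          (Finset.mem_erase.1 hx).2).1 (Finset.mem_erase.1 hx).1 z]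
      rcases le_total (z g + z h) 1 with hle | hle
      · rw [min_eq_right hle, max_eq_left (by linarith)]; ring
      · rw [min_eq_left hle, max_eq_right (by linarith)]; ring

end Pour

/-! ### Pouring from one element and from a sorted list of elements -/

namespace Pour

variable {κ : Type u} [LinearOrder κ] {D : κ → Finset κ}

/-- Pour the mass at `h` into the elements below `h`. -/
noncomputable def pourFrom (D : κ → Finset κ) (h : κ) (z : κ → ℝ) : κ → ℝ :=
  (D h).sort.foldl (fun z g => push h g z) z

/-- Pour the mass at the elements of a list into the elements below. -/
noncomputable def pourList (D : κ → Finset κ) (L : List κ) (z : κ → ℝ) : κ → ℝ :=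
  L.foldl (fun z h => pourFrom D h z) z

theorem isTransport_pourFrom (hD : ∀ h, ∀ g ∈ D h, g < h) (h : κ) :
    IsTransport D (pourFrom D h) :=
  IsTransport.foldl _ fun g hg =>
    isTransport_push (hD h g ((Finset.mem_sort _).1 hg)).ne ((Finset.mem_sort _).1 hg)

theorem isTransport_pourList (hD : ∀ h, ∀ g ∈ D h, g < h) (L : List κ) :
    IsTransport D (pourList D L) :=
  IsTransport.foldl _ fun h _ => isTransport_pourFrom hD h

theorem pourFrom_eq_self (hD : ∀ h, ∀ g ∈ D h, g < h) {h : κ} {z : κ → ℝ} (hz : IsUnit z)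
    (h0 : z h ≠ 0 → ∀ g ∈ D h, z g = 1) : pourFrom D h z = z := by
  have key : ∀ L : List κ, (∀ g ∈ L, g ∈ D h) → L.foldl (fun z g => push h g z) z = z := by
    intro L
    induction L with
    | nil => exact fun _ => rfl
    | cons g L ih =>
      intro hL
      have hg := hL g (List.mem_cons_self ..)
      rw [List.foldl_cons, push_eq_self (hD h g hg).ne hz]
      · exact ih fun x hx => hL x (List.mem_cons_of_mem _ hx)
      · by_cases hzh : z h = 0
        · exact .inl hzh
        · exact .inr (h0 hzh g hg)
  exact key _ fun g hg => (Finset.mem_sort _).1 hg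

theorem pourList_eq_self (hD : ∀ h, ∀ g ∈ D h, g < h) (L : List κ) {z : κ → ℝ} (hz : IsUnit z)
    (h0 : ∀ h, z h ≠ 0 → ∀ g ∈ D h, z g = 1) : pourList D L z = z := by
  induction L with
  | nil => rfl
  | cons h L ih =>
    rw [pourList, List.foldl_cons, pourFrom_eq_self hD hz (h0 h)]
    exact ih

theorem pourFrom_of_lt (hD : ∀ h, ∀ g ∈ D h, g < h) {h x : κ} (hx : h < x) (z : κ → ℝ) :
    pourFrom D h z x = z x := by
  have key : ∀ (L : List κ) (z : κ → ℝ), (∀ g ∈ L, g ∈ D h) →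
      L.foldl (fun z g => push h g z) z x = z x := by
    intro L
    induction L with
    | nil => exact fun _ _ => rfl
    | cons g L ih =>
      intro z hL
      have hg := hD h g (hL g (List.mem_cons_self ..))
      rw [List.foldl_cons, ih _ fun x hx => hL x (List.mem_cons_of_mem _ hx),
        push_of_ne hx.ne' (hg.trans hx).ne']
  exact key _ z fun g hg => (Finset.mem_sort _).1 hg

open Classical in
-- Elements without mass may be skipped, as pouring from smaller elements never changes the mass at
-- larger ones. So different functions can be poured along one common list, which monotonicity
-- requires.
theorem pourList_filter (hD : ∀ h, ∀ g ∈ D h, g < h) (L : List κ) : ∀ (z : κ → ℝ), IsUnit z →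
    L.Pairwise (· < ·) → pourList D L z = pourList D (L.filter fun h => z h ≠ 0) z := by
  induction L with
  | nil => exact fun _ _ _ => rfl
  | cons h L ih =>
    intro z hz hL
    rw [List.pairwise_cons] at hL
    by_cases h0 : z h = 0
    · rw [List.filter_cons_of_neg (by simp [h0]), ← ih z hz hL.2]
      change pourList D L (pourFrom D h z) = _
      rw [pourFrom_eq_self hD hz fun h => absurd h0 h]
    · rw [List.filter_cons_of_pos (by simp [h0])]
      change pourList D L (pourFrom D h z) = pourList D _ (pourFrom D h z)
      rw [ih _ ((isTransport_pourFrom hD h).isUnit hz) hL.2]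
      congr 1
      refine List.filter_congr fun x hx => ?_
      rw [pourFrom_of_lt hD (hL.1 x hx)]

theorem pourFrom_ordered (hD : ∀ h, ∀ g ∈ D h, g < h) (hDD : ∀ h, ∀ g ∈ D h, D g ⊆ D h)
    {h : κ} {L : List κ} (hL : (h :: L).Pairwise (· < ·)) {z : κ → ℝ} (hz : IsUnit z)
    (hord : ∀ x, z x ≠ 0 → x ∈ h :: L ∨ ((∀ y ∈ h :: L, x < y) ∧ ∀ g ∈ D x, z g = 1)) :
    ∀ x, pourFrom D h z x ≠ 0 →
      x ∈ L ∨ ((∀ y ∈ L, x < y) ∧ ∀ g ∈ D x, pourFrom D h z g = 1) := by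
  rw [List.pairwise_cons] at hL
  -- Invariant while `h` is poured into the remaining list `G`: a nonempty element is still waiting
  -- in `L`, or has only full elements below it, or is `h`, whose lower elements outside `G` are
  -- full. Mass reaches `g` only from a nonempty `h`; then everything below `g` is already full,
  -- because it comes before `g` in the sorted list. If mass remains at `h`, then `g` has become
  -- full.
  have key : ∀ (G : List κ) (z : κ → ℝ), IsUnit z → (∀ g ∈ G, g ∈ D h) → G.Pairwise (· < ·) →
      (∀ x, z x ≠ 0 → x ∈ L ∨ (x < h ∧ ∀ g ∈ D x, z g = 1) ∨
        (x = h ∧ ∀ g ∈ D h, g ∉ G → z g = 1)) →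
      ∀ x, G.foldl (fun z g => push h g z) z x ≠ 0 → x ∈ L ∨ (x ≤ h ∧
        ∀ g ∈ D x, G.foldl (fun z g => push h g z) z g = 1) := by
    intro G
    induction G with
    | nil =>
      intro z hz _ _ hJ x hx
      rcases hJ x hx with h1 | ⟨h1, h2⟩ | ⟨rfl, h2⟩
      · exact .inl h1
      · exact .inr ⟨h1.le, h2⟩
      · exact .inr ⟨le_rfl, fun g hg => h2 g hg (by simp)⟩
    | cons g G ih =>
      intro z hz hG hGs hJ
      have hgD := hG g (List.mem_cons_self ..)
      have hgh := hD h g hgD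
      have h1 := hz h
      have h2 := hz g
      rw [List.pairwise_cons] at hGs
      have hJh : z h ≠ 0 → ∀ x ∈ D h, x ∉ g :: G → z x = 1 := by
        intro h0
        rcases hJ h h0 with h1 | ⟨h1, -⟩ | ⟨-, h1⟩
        · exact absurd (hL.1 h h1) (lt_irrefl h)
        · exact absurd h1 (lt_irrefl h)
        · exact h1
      rw [List.foldl_cons]
      refine ih _ ((isTransport_push hgh.ne hgD).isUnit hz)
        (fun x hx => hG x (List.mem_cons_of_mem _ hx)) hGs.2 fun x hx => ?_
      by_cases hxh : x = h
      · subst hxh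
        rw [push_top] at hx
        have hgt : 1 < z g + z x := by
          by_contra hle
          exact hx (max_eq_left (by linarith))
        refine .inr (.inr ⟨rfl, fun y hy hyG => ?_⟩)
        by_cases hyg : y = g
        · subst hyg
          rw [push_bot hgh.ne, min_eq_left hgt.le]
        · rw [push_of_ne (hD x y hy).ne hyg]
          exact hJh (by intro h0; rw [h0] at hgt; linarith) y hy (by simp [hyg, hyG])
      by_cases hxg : x = g
      · subst hxg
        refine .inr (.inl ⟨hgh, fun y hy => ?_⟩)
        have hyx := hD x y hy
        rw [push_of_ne (hyx.trans hgh).ne hyx.ne]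
        by_cases h0 : z x = 0
        · rw [push_bot hgh.ne, h0, zero_add] at hx
          refine hJh (fun h => hx (by rw [h]; simp)) y (hDD h x hgD hy) ?_
          rw [List.mem_cons, not_or]
          exact ⟨hyx.ne, fun h => lt_asymm hyx (hGs.1 y h)⟩
        · rcases hJ x h0 with h1 | ⟨-, h1⟩ | ⟨h1, -⟩
          · exact absurd (hL.1 x h1) (lt_asymm hgh)
          · exact h1 y hy
          · exact absurd h1 hxh
      rw [push_of_ne hxh hxg] at hx
      rcases hJ x hx with h1 | ⟨h1, h3⟩ | ⟨h1, -⟩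
      · exact .inl h1
      · refine .inr (.inl ⟨h1, fun y hy => ?_⟩)
        have hyx := hD x y hy
        by_cases hyg : y = g
        · subst hyg
          rw [push_bot hgh.ne, h3 y hy, min_eq_left]
          linarith [(hz h).1]
        · rw [push_of_ne (hyx.trans h1).ne hyg]
          exact h3 y hy
      · exact absurd h1 hxh
  intro x hx
  refine (key ((D h).sort fun a b => a ≤ b) z hz (fun g hg => (Finset.mem_sort _).1 hg) (Finset.sortedLT_sort _).pairwise
    (fun x hx => ?_) x hx).imp_right fun ⟨h1, h2⟩ => ⟨fun y hy => h1.trans_lt (hL.1 y hy), h2⟩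
  rcases hord x hx with h1 | ⟨h1, h2⟩
  · rcases List.mem_cons.1 h1 with rfl | h1
    · exact .inr (.inr ⟨rfl, fun g hg hg' => absurd ((Finset.mem_sort _).2 hg) hg'⟩)
    · exact .inl h1
  · exact .inr (.inl ⟨h1 h (List.mem_cons_self ..), h2⟩)

theorem pourList_ordered (hD : ∀ h, ∀ g ∈ D h, g < h) (hDD : ∀ h, ∀ g ∈ D h, D g ⊆ D h)
    (L : List κ) : ∀ (z : κ → ℝ), IsUnit z → L.Pairwise (· < ·) →
    (∀ x, z x ≠ 0 → x ∈ L ∨ ((∀ y ∈ L, x < y) ∧ ∀ g ∈ D x, z g = 1)) →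
    ∀ x, pourList D L z x ≠ 0 → ∀ g ∈ D x, pourList D L z g = 1 := by
  induction L with
  | nil =>
    intro z _ _ h x hx
    exact ((h x hx).resolve_left (by simp)).2
  | cons h L ih =>
    intro z hz hL hord
    exact ih _ ((isTransport_pourFrom hD h).isUnit hz) (List.pairwise_cons.1 hL).2
      (pourFrom_ordered hD hDD hL hz hord)

end Pour

/-- Mass on a partial order with finite lower sets can be moved downwards, in a way that preserves
the order of functions, until every element is empty or all the elements below it are full. -/
theorem exists_pour {κ : Type u} (R : κ → κ → Prop) (hirr : ∀ g, ¬R g g)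
    (htrans : ∀ f g h, R f g → R g h → R f h) (hfin : ∀ h, {g | R g h}.Finite) :
    ∃ F : (κ → ℝ) → κ → ℝ,
      (∀ z, Pour.IsUnit z → (Function.support z).Finite →
        Pour.IsUnit (F z) ∧ ∀ g h, R g h → F z h ≠ 0 → F z g = 1) ∧
      (∀ z z', Pour.IsUnit z → Pour.IsUnit z' → (Function.support z').Finite → z ≤ z' →
        F z ≤ F z') ∧
      (∀ z (P : Finset κ), Pour.IsUnit z → (∀ h, z h ≠ 0 → h ∈ P) →
        (∀ h ∈ P, ∀ g, R g h → g ∈ P) →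
        (∀ h, F z h ≠ 0 → h ∈ P) ∧ ∑ h ∈ P, F z h = ∑ h ∈ P, z h) ∧
      (∀ z, Pour.IsUnit z → (∀ g h, R g h → z h ≠ 0 → z g = 1) → F z = z) := by
  classical
  have : IsPartialOrder κ fun a b => a = b ∨ R a b :=
    { refl := fun a => .inl rfl
      trans := by
        rintro a b c (rfl | h1) (rfl | h2)
        · exact .inl rfl
        · exact .inr h2
        · exact .inr h1
        · exact .inr (htrans _ _ _ h1 h2)
      antisymm := by
        rintro a b (rfl | h1) (h2 | h2)
        · rfl
        · rfl
        · exact h2.symm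
        · exact absurd (htrans _ _ _ h1 h2) (hirr a) }
  -- A linear extension fixes the order in which elements are poured and filled.
  obtain ⟨s, hs, hrs⟩ := extend_partialOrder fun a b => a = b ∨ R a b
  let _ : LinearOrder κ :=
    { le := s
      le_refl := hs.refl
      le_trans := hs.trans
      le_antisymm := hs.antisymm
      le_total := hs.total
      toDecidableLE := Classical.decRel s }
  let D : κ → Finset κ := fun h => (hfin h).toFinset
  have hmemD : ∀ g h, g ∈ D h ↔ R g h := fun g h => by simp [D]
  have hD : ∀ h, ∀ g ∈ D h, g < h := by
    intro h g hg
    rw [hmemD] at hg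
    refine lt_of_le_of_ne (hrs _ _ (.inr hg)) ?_
    rintro rfl
    exact hirr g hg
  have hDD : ∀ h, ∀ g ∈ D h, D g ⊆ D h := by
    intro h g hg f hf
    rw [hmemD] at *
    exact htrans _ _ _ hf hg
  -- Only the last property concerns functions of infinite support, and the default `z` satisfies
  -- it.
  let F : (κ → ℝ) → κ → ℝ := fun z =>
    if hz : (Function.support z).Finite then Pour.pourList D hz.toFinset.sort z else z
  have hF : ∀ z (P : Finset κ), Pour.IsUnit z → (∀ h, z h ≠ 0 → h ∈ P) →
      F z = Pour.pourList D P.sort z := by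
    intro z P hz hP
    have hfz : (Function.support z).Finite := P.finite_toSet.subset hP
    simp only [F, dif_pos hfz]
    rw [Pour.pourList_filter hD (P.sort fun a b => a ≤ b) z hz (Finset.sortedLT_sort _).pairwise]
    congr 1
    refine (Finset.sortedLT_sort _).pairwise.eq_of_mem_iff
      ((Finset.sortedLT_sort P).pairwise.filter _) fun {x} => ?_
    simp only [Finset.mem_sort, Set.Finite.mem_toFinset, Function.mem_support, List.mem_filter,
      decide_eq_true_eq]
    exact ⟨fun h => ⟨hP x h, h⟩, fun h => h.2⟩
  refine ⟨F, fun z hz hfz => ?_, fun z z' hz hz' hfz hle => ?_, fun z P hz hP hR => ?_,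
    fun z hz hord => ?_⟩
  · rw [hF z hfz.toFinset hz fun h hh => hfz.mem_toFinset.2 hh]
    refine ⟨(Pour.isTransport_pourList hD _).isUnit hz, fun g h hgh h0 => ?_⟩
    refine Pour.pourList_ordered hD hDD _ z hz (Finset.sortedLT_sort _).pairwise
      (fun x hx => .inl ?_) h h0 g ((hmemD _ _).2 hgh)
    exact (Finset.mem_sort _).2 (hfz.mem_toFinset.2 hx)
  · rw [hF z hfz.toFinset hz, hF z' hfz.toFinset hz' fun h hh => hfz.mem_toFinset.2 hh]
    · exact (Pour.isTransport_pourList hD _).mono hz hz' hle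
    · intro h hh
      refine hfz.mem_toFinset.2 fun h0 => hh (le_antisymm ?_ (hz h).1)
      rw [← h0]
      exact hle h
  · rw [hF z P hz hP]
    exact (Pour.isTransport_pourList hD _).mass P hz hP fun h hh g hg =>
      hR h hh g ((hmemD _ _).1 hg)
  · simp only [F]
    split_ifs with hfz
    · exact Pour.pourList_eq_self hD _ hz fun h hh g hg => hord g h ((hmemD _ _).1 hg) hh
    · rfl

namespace CubeComplex

/-! ### Averages over cubes -/

theorem vertexWeight_nonneg {n : ℕ} (t : Fin n → unitInterval) (x : Fin n → Bool) :
    0 ≤ vertexWeight t x := by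
  refine Finset.prod_nonneg fun i _ => ?_
  split_ifs
  · exact (t i).2.1
  · linarith [(t i).2.2]

/-- The average of a function on the vertices of a cube with respect to the weights of a point. -/
noncomputable def avg {n : ℕ} (t : Fin n → unitInterval) (g : (Fin n → Bool) → ℝ) : ℝ :=
  ∑ x, vertexWeight t x * g x

theorem sum_vertexWeight {n : ℕ} (t : Fin n → unitInterval) : ∑ x, vertexWeight t x = 1 := by
  have h := Finset.prod_univ_sum (fun _ : Fin n => (Finset.univ : Finset Bool))
    (fun i b => if b then (t i : ℝ) else 1 - (t i : ℝ))
  rw [Fintype.piFinset_univ] at h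
  simp only [vertexWeight]
  rw [← h]
  simp

theorem avg_const {n : ℕ} (t : Fin n → unitInterval) (a : ℝ) : avg t (fun _ => a) = a := by
  rw [avg, ← Finset.sum_mul, sum_vertexWeight, one_mul]

theorem avg_mono {n : ℕ} (t : Fin n → unitInterval) {g g' : (Fin n → Bool) → ℝ}
    (h : ∀ x, g x ≤ g' x) : avg t g ≤ avg t g' :=
  Finset.sum_le_sum fun x _ => mul_le_mul_of_nonneg_left (h x) (vertexWeight_nonneg t x)

theorem avg_sum {n : ℕ} {ι : Type*} (t : Fin n → unitInterval) (U : Finset ι)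
    (g : ι → (Fin n → Bool) → ℝ) : avg t (fun x => ∑ h ∈ U, g h x) = ∑ h ∈ U, avg t (g h) := by
  simp only [avg, Finset.mul_sum]
  exact Finset.sum_comm

theorem avg_sub {n : ℕ} (t : Fin n → unitInterval) (g g' : (Fin n → Bool) → ℝ) :
    avg t (fun x => g x - g' x) = avg t g - avg t g' := by
  simp only [avg, mul_sub, Finset.sum_sub_distrib]

/-- The average is affine in each coordinate separately. -/
theorem avg_update {n : ℕ} (t : Fin n → unitInterval) (i : Fin n) (s : unitInterval)
    (g : (Fin n → Bool) → ℝ) : avg (Function.update t i s) g =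
      s * avg t (fun x => g (Function.update x i true)) +
        (1 - s) * avg t (fun x => g (Function.update x i false)) := by
  let W : (Fin n → Bool) → ℝ := fun x =>
    ∏ j ∈ Finset.univ.erase i, if x j then (t j : ℝ) else 1 - (t j : ℝ)
  have hW : ∀ (r : unitInterval) x, vertexWeight (Function.update t i r) x =
      (if x i then (r : ℝ) else 1 - (r : ℝ)) * W x := by
    intro r x
    rw [vertexWeight, ← Finset.mul_prod_erase _ _ (Finset.mem_univ i), Function.update_self]
    congr 1
    refine Finset.prod_congr rfl fun j hj => ?_
    rw [Function.update_of_ne (Finset.mem_erase.1 hj).1]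
  have hWf : ∀ x, W (flip i x) = W x := by
    intro x
    refine Finset.prod_congr rfl fun j hj => ?_
    rw [flip_ne (Finset.mem_erase.1 hj).1]
  -- Pairing each vertex with its neighbour in direction `i` counts every pair twice, which explains
  -- the factor 2.
  have hsum : ∀ F : (Fin n → Bool) → ℝ, 2 * ∑ x, F x = ∑ x, (F x + F (flip i x)) := by
    intro F
    have : ∑ x, F (flip i x) = ∑ x, F x :=
      Equiv.sum_comp (⟨flip i, flip i, flip_flip i, flip_flip i⟩ : Equiv.Perm (Fin n → Bool)) F
    rw [Finset.sum_add_distrib, this, two_mul]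
  have hup : ∀ (x : Fin n → Bool), x = Function.update x i (x i) := fun x => by simp
  have hfl : ∀ (x : Fin n → Bool) b, Function.update (flip i x) i b = Function.update x i b :=
    fun x b => by simp [flip]
  have key : ∀ r : unitInterval, ∀ G : (Fin n → Bool) → ℝ,
      2 * avg (Function.update t i r) G = ∑ x, W x * (r * G (Function.update x i true) +
        (1 - r) * G (Function.update x i false)) := by
    intro r G
    rw [avg, hsum]
    refine Finset.sum_congr rfl fun x _ => ?_
    rw [hW, hW, hWf, flip_same]
    cases hx : x i
    · have e1 : x = Function.update x i false := by rw [← hx]; exact hup x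
      have e2 : flip i x = Function.update x i true := by rw [flip, hx]; rfl
      rw [e2, ← e1]
      simp
      ring
    · have e1 : x = Function.update x i true := by rw [← hx]; exact hup x
      have e2 : flip i x = Function.update x i false := by rw [flip, hx]; rfl
      rw [e2, ← e1]
      simp
      ring
  have ht : Function.update t i (t i) = t := Function.update_eq_self i t
  have h1 := key s g
  have h2 := key (t i) (fun x => g (Function.update x i true))
  have h3 := key (t i) (fun x => g (Function.update x i false))
  simp only [ht, Function.update_idem] at h2 h3
  have : 2 * avg (Function.update t i s) g = 2 * (s * avg t (fun x => g (Function.update x i true)) +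
        (1 - s) * avg t (fun x => g (Function.update x i false))) := by
    rw [h1, mul_add, mul_left_comm, h2, mul_left_comm 2, h3, Finset.mul_sum, Finset.mul_sum,
      ← Finset.sum_add_distrib]
    refine Finset.sum_congr rfl fun x _ => ?_
    ring
  linarith

theorem avg_update_sub {n : ℕ} (t : Fin n → unitInterval) (i : Fin n) (s s' : unitInterval)
    (g : (Fin n → Bool) → ℝ) :
    avg (Function.update t i s') g - avg (Function.update t i s) g = (s' - s) *
      avg t (fun x => g (Function.update x i true) - g (Function.update x i false)) := by
  rw [avg_update, avg_update, avg_sub]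
  ring

theorem avg_coord {n : ℕ} (t : Fin n → unitInterval) (i : Fin n) (a b : ℝ) :
    avg t (fun x => if x i then a else b) = t i * a + (1 - t i) * b := by
  have h := avg_update t i (t i) (fun x => if x i then a else b)
  rw [Function.update_eq_self] at h
  rw [h]
  simp [avg_const]

/-! ### Functions on vertices, points of cubes and vertices in the realization -/

section Points

variable {V : Type u}

theorem cubePoint_apply {n : ℕ} {f : (Fin n → Bool) → V} (hf : Function.Injective f)
    (t : Fin n → unitInterval) (x : Fin n → Bool) : cubePoint f t (f x) = vertexWeight t x := by
  rw [cubePoint, Finset.sum_eq_single x]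
  · simp
  · intro y _ hy
    rw [if_neg fun h => hy (hf h)]
  · simp

theorem cubePoint_of_notMem {n : ℕ} {f : (Fin n → Bool) → V} (t : Fin n → unitInterval) {v : V}
    (hv : v ∉ Set.range f) : cubePoint f t v = 0 :=
  Finset.sum_eq_zero fun x _ => if_neg fun h => hv ⟨x, h⟩

/-- The average of a function on the vertices with respect to the weights of a point. -/
noncomputable def mean (p : V → ℝ) (g : V → ℝ) : ℝ := ∑ᶠ v, p v * g v

/-- A function on the vertices extends multilinearly to the realization. As `mean` depends on the
weights alone, no compatibility between cubes has to be checked. -/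
theorem mean_cubePoint {n : ℕ} {f : (Fin n → Bool) → V} (hf : Function.Injective f)
    (t : Fin n → unitInterval) (g : V → ℝ) :
    mean (cubePoint f t) g = avg t (fun x => g (f x)) := by
  classical
  rw [mean, finsum_eq_sum_of_support_subset (s := Finset.univ.image f),
    Finset.sum_image fun x _ y _ h => hf h, avg]
  · exact Finset.sum_congr rfl fun x _ => by rw [cubePoint_apply hf]
  · intro v hv
    rw [Function.mem_support] at hv
    by_contra hc
    refine hv ?_
    rw [cubePoint_of_notMem, zero_mul]
    simpa using hc

/-- The point with given coordinates in a cube. -/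
noncomputable def mkPoint (X : CubeComplex V) {n : ℕ} {f : (Fin n → Bool) → V} (hf : X.IsCube f)
    (t : Fin n → unitInterval) : X.Realization := ⟨cubePoint f t, n, f, t, hf, rfl⟩

theorem cubeDist_mkPoint_le (X : CubeComplex V) {n : ℕ} {f : (Fin n → Bool) → V} (hf : X.IsCube f)
    (s t : Fin n → unitInterval) : X.cubeDist (X.mkPoint hf s) (X.mkPoint hf t) ≤
      ENNReal.ofReal (∑ i, |(s i : ℝ) - (t i : ℝ)|) :=
  iInf_le_of_le n (iInf_le_of_le f (iInf_le_of_le s (iInf_le_of_le t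
    (iInf_le_of_le ⟨hf, rfl, rfl⟩ le_rfl))))

/-- A vertex, as a point of the realization. -/
noncomputable def vertexPoint (X : CubeComplex V) (v : V) : X.Realization :=
  X.mkPoint (X.vertex v) fun i => i.elim0

theorem mkPoint_eq_vertexPoint (X : CubeComplex V) {n : ℕ} {f : (Fin n → Bool) → V}
    (hf : X.IsCube f) (x : Fin n → Bool) :
    X.mkPoint hf (fun i => if x i then 1 else 0) = X.vertexPoint (f x) := by
  have hw : ∀ y, vertexWeight (fun i => if x i then (1 : unitInterval) else 0) y =
      if y = x then 1 else 0 := by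
    intro y
    split_ifs with hyx
    · subst hyx
      refine Finset.prod_eq_one fun i _ => ?_
      cases h : y i <;> simp [h]
    · obtain ⟨i, hi⟩ := Function.ne_iff.1 hyx
      refine Finset.prod_eq_zero (Finset.mem_univ i) ?_
      cases hy : y i <;> cases hx : x i <;> simp_all
  refine Subtype.ext (funext fun v => ?_)
  change cubePoint f (fun i => if x i then 1 else 0) v =
    cubePoint (fun _ : Fin 0 → Bool => f x) (fun i => i.elim0) v
  by_cases hv : v ∈ Set.range f
  · obtain ⟨y, rfl⟩ := hv
    rw [cubePoint_apply (X.injective hf), hw]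
    by_cases hyx : y = x
    · subst hyx
      simp [cubePoint, vertexWeight]
    · have : f x ≠ f y := fun h => hyx (X.injective hf h).symm
      simp [cubePoint, hyx, this]
  · have : f x ≠ v := fun h => hv ⟨x, h⟩
    rw [cubePoint_of_notMem _ hv]
    simp [cubePoint, this]

theorem mean_vertexPoint (X : CubeComplex V) (v : V) (g : V → ℝ) :
    mean (X.vertexPoint v).1 g = g v := by
  change mean (cubePoint (fun _ : Fin 0 → Bool => v) fun i => i.elim0) g = g v
  rw [mean_cubePoint (Function.injective_of_subsingleton _)]
  exact avg_const _ _

theorem pathDist_vertexPoint_le (X : CubeComplex V) {n : ℕ} {f : (Fin n → Bool) → V}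
    (hf : X.IsCube f) (t : Fin n → unitInterval) (x : Fin n → Bool) :
    X.pathDist (X.mkPoint hf t) (X.vertexPoint (f x)) ≤ n := by
  rw [← X.mkPoint_eq_vertexPoint hf]
  refine (X.pathDist_le_cubeDist _ _).trans ((X.cubeDist_mkPoint_le hf _ _).trans ?_)
  rw [← ENNReal.ofReal_natCast]
  refine ENNReal.ofReal_le_ofReal ?_
  calc _ ≤ ∑ _i : Fin n, (1 : ℝ) := Finset.sum_le_sum fun i _ => ?_
    _ = n := by simp
  rw [abs_le]
  have h1 := (t i).2.1
  have h2 := (t i).2.2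
  cases x i <;> constructor <;> simp <;> linarith

theorem pathDist_vertexPoint_le_length (X : CubeComplex V) {u v : V} (p : X.skeleton.Walk u v) :
    X.pathDist (X.vertexPoint u) (X.vertexPoint v) ≤ p.length := by
  induction p with
  | nil => simp [pathDist_self]
  | @cons u v w h p ih =>
    refine (X.pathDist_triangle _ (X.vertexPoint v) _).trans ?_
    rw [SimpleGraph.Walk.length_cons, Nat.cast_add, add_comm]
    refine add_le_add ih ?_
    obtain ⟨f, hf, rfl, rfl⟩ := h
    rw [← X.mkPoint_eq_vertexPoint hf ![false]]
    exact X.pathDist_vertexPoint_le hf _ _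

end Points

end CubeComplex

/-! ### The order of a median family and coordinates of points -/

namespace IsMedianFamily

variable {H : Type u} [DecidableEq H] {F : Set (Finset H)}

/-- The strict order of the points of a median family. -/
def StrictBelow (F : Set (Finset H)) (g h : H) : Prop := g ≠ h ∧ Below F g h ∧ ∃ A ∈ F, h ∈ A

theorem StrictBelow.mem {g h : H} (hgh : StrictBelow F g h) {A : Finset H} (hA : A ∈ F)
    (hh : h ∈ A) : g ∈ A := hgh.2.1 A hA hh

theorem strictBelow_trans (hF : IsMedianFamily F) {f g h : H} (h1 : StrictBelow F f g)
    (h2 : StrictBelow F g h) : StrictBelow F f h := by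
  obtain ⟨A, hA, hhA⟩ := h2.2.2
  refine ⟨?_, fun B hB hh => h1.2.1 B hB (h2.2.1 B hB hh), A, hA, hhA⟩
  rintro rfl
  exact h2.1 (hF.below_antisymm hA hhA h2.2.1 h1.2.1)

/-- The lower set of `h` lies in any member containing `h`. For an `h` in no member, `Below` is
vacuous, and the last clause of `StrictBelow` keeps the lower set empty. -/
theorem finite_strictBelow (h : H) : {g | StrictBelow F g h}.Finite := by
  by_cases hh : ∃ A ∈ F, h ∈ A
  · obtain ⟨A, hA, hh⟩ := hh
    exact A.finite_toSet.subset fun g hg => hg.mem hA hh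
  · convert Set.finite_empty
    exact Set.eq_empty_of_forall_notMem fun g hg => hh hg.2.2

/-- Coordinates of the points of the cube complex of a median family in the cubes below `U`. -/
structure IsPoint (F : Set (Finset H)) (U : Finset H) (z : H → ℝ) : Prop where
  isUnit : Pour.IsUnit z
  support : ∀ h, z h ≠ 0 → h ∈ U
  ordered : ∀ g h, StrictBelow F g h → z h ≠ 0 → z g = 1

/-- The sets `A ∪ E'` are the vertices of a cube around the point: `A` collects full coordinates and
`E` the free directions. Below a nonzero coordinate everything is full, hence in `A`, so the set is
down-closed. `A` need not contain every full coordinate, so a full but maximal one may serve as a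
free direction. -/
theorem IsPoint.union_mem (hF : IsMedianFamily F) {U : Finset H} (hU : U ∈ F) {z : H → ℝ}
    (hz : IsPoint F U z) {A E E' : Finset H} (hAU : A ⊆ U) (hEU : E' ⊆ U) (hE : E' ⊆ E)
    (hne : ∀ h ∈ A ∪ E, z h ≠ 0)
    (hA : ∀ g ∈ U, z g = 1 → (∃ h ∈ A ∪ E, StrictBelow F g h) → g ∈ A) : A ∪ E' ∈ F := by
  have hsub : A ∪ E' ⊆ U := Finset.union_subset hAU hEU
  refine hF.mem_of_downset hU hsub fun h hh g hg hb => ?_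
  by_cases hgh : g = h
  · rwa [hgh]
  have hs : StrictBelow F g h := ⟨hgh, hb, U, hU, hsub hh⟩
  have hh' : h ∈ A ∪ E := Finset.union_subset_union_right hE hh
  exact Finset.mem_union_left _ (hA g hg (hz.ordered g h hs (hne h hh')) ⟨h, hh', hs⟩)

end IsMedianFamily

/-! ### Points of a median model described by their coordinates -/

namespace CubeComplex

open IsMedianFamily

section Model

variable {W H : Type u} [DecidableEq H] {Y : CubeComplex W} {T : W → Finset H}

/-- The weights of the point with coordinates `z` on the vertices of a median model. -/
noncomputable def weights (T : W → Finset H) (z : H → ℝ) (σ : W) : ℝ :=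
  ∏ᶠ h, if h ∈ T σ then z h else 1 - z h

theorem IsMedianModel.exists_cube (hT : Y.IsMedianModel T) {A E : Finset H} (hAE : Disjoint A E)
    (hmem : ∀ E' ⊆ E, A ∪ E' ∈ Set.range T) :
    ∃ f : (Fin E.card → Bool) → W, Y.IsCube f ∧
      ∀ x h, h ∈ T (f x) ↔ h ∈ A ∨ ∃ i, (E.equivFin.symm i : H) = h ∧ x i = true := by
  have hsub : ∀ x : Fin E.card → Bool,
      ((Finset.univ.filter fun i => x i = true).image fun i => (E.equivFin.symm i : H)) ⊆ E := by
    intro x h hh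
    obtain ⟨i, -, rfl⟩ := Finset.mem_image.1 hh
    exact (E.equivFin.symm i).2
  choose f hf using fun x => hmem _ (hsub x)
  have hf' : ∀ x h, h ∈ T (f x) ↔ h ∈ A ∨ ∃ i, (E.equivFin.symm i : H) = h ∧ x i = true := by
    intro x h
    rw [hf, Finset.mem_union]
    simp [and_comm]
  refine ⟨f, hT.isCube_of (A := A) (k := fun i => (E.equivFin.symm i : H))
    (Subtype.val_injective.comp E.equivFin.symm.injective) (fun i hi => ?_) hf', hf'⟩
  exact Finset.disjoint_left.1 hAE hi (E.equivFin.symm i).2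

/-- At a vertex of the cube all factors outside `E` equal 1; at any other vertex some factor is 0.
Coordinates in `E` may be 0 or 1, so the same `weights` describe the point in every cube of this
form that contains it. -/
theorem IsMedianModel.weights_eq_cubePoint (hT : Y.IsMedianModel T) {A E : Finset H}
    (hAE : Disjoint A E) {f : (Fin E.card → Bool) → W} (hc : Y.IsCube f)
    (hf : ∀ x h, h ∈ T (f x) ↔ h ∈ A ∨ ∃ i, (E.equivFin.symm i : H) = h ∧ x i = true)
    {z : H → ℝ} (hA : ∀ h ∈ A, z h = 1) (h0 : ∀ h, h ∉ A → h ∉ E → z h = 0)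
    (t : Fin E.card → unitInterval) (ht : ∀ i, (t i : ℝ) = z (E.equivFin.symm i)) :
    weights T z = cubePoint f t := by
  have hkE : ∀ {h}, h ∈ E → ∃ i, (E.equivFin.symm i : H) = h := fun {h} hh =>
    ⟨E.equivFin ⟨h, hh⟩, by simp⟩
  have hnE : ∀ {x h}, h ∉ E → (h ∈ T (f x) ↔ h ∈ A) := by
    intro x h hh
    rw [hf]
    refine or_iff_left ?_
    rintro ⟨i, rfl, -⟩
    exact hh (E.equivFin.symm i).2
  have hiE : ∀ x i, (E.equivFin.symm i : H) ∈ T (f x) ↔ x i = true := by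
    intro x i
    rw [hf, or_iff_right]
    · constructor
      · rintro ⟨j, hj, hx⟩
        rwa [← E.equivFin.symm.injective (Subtype.ext hj)]
      · exact fun h => ⟨i, rfl, h⟩
    · exact fun h => Finset.disjoint_left.1 hAE h (E.equivFin.symm i).2
  funext σ
  by_cases hσ : σ ∈ Set.range f
  · obtain ⟨x, rfl⟩ := hσ
    rw [cubePoint_apply (Y.injective hc), weights, finprod_eq_prod_of_mulSupport_subset (s := E),
      vertexWeight, ← Finset.prod_coe_sort, ← Equiv.prod_comp E.equivFin.symm]
    · refine Finset.prod_congr rfl fun i _ => ?_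
      rw [ht]
      simp only [hiE]
    · intro h hh
      by_contra hE
      rw [Function.mem_mulSupport] at hh
      refine hh ?_
      simp only [hnE hE]
      split_ifs with hhA
      · exact hA h hhA
      · rw [h0 h hhA hE, sub_zero]
  · rw [cubePoint_of_notMem _ hσ, weights,
      finprod_eq_prod_of_mulSupport_subset (s := (A ∪ E) ∪ T σ)]
    · have hex : ∃ h ∈ (A ∪ E) ∪ T σ, (if h ∈ T σ then z h else 1 - z h) = 0 := by
        by_contra hc'
        push Not at hc'
        refine hσ ⟨fun i => decide ((E.equivFin.symm i : H) ∈ T σ), hT.injective ?_⟩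
        ext h
        by_cases hhA : h ∈ A
        · have h1 := hc' h (by simp [hhA])
          rw [hf]
          simp only [hhA, true_or, true_iff]
          by_contra hhσ
          simp [hhσ, hA h hhA] at h1
        by_cases hhE : h ∈ E
        · obtain ⟨i, rfl⟩ := hkE hhE
          rw [hiE]
          simp
        · rw [hnE hhE]
          refine iff_of_false hhA fun hhσ => ?_
          have h1 := hc' h (by simp [hhσ])
          simp [hhσ, h0 h hhA hhE] at h1
      obtain ⟨h, hh, h1⟩ := hex
      exact Finset.prod_eq_zero hh h1
    · intro h hh
      by_contra hc'
      rw [Finset.mem_coe, Finset.mem_union, Finset.mem_union, not_or, not_or] at hc'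
      rw [Function.mem_mulSupport] at hh
      refine hh ?_
      simp [hc'.2, h0 h hc'.1.1 hc'.1.2]

theorem IsMedianModel.exists_cube_of_isPoint (hT : Y.IsMedianModel T) {U : Finset H}
    (hU : U ∈ Set.range T) {z : H → ℝ} (hz : IsPoint (Set.range T) U z) :
    ∃ (A E : Finset H) (f : (Fin E.card → Bool) → W) (t : Fin E.card → unitInterval),
      Disjoint A E ∧ Y.IsCube f ∧
      (∀ x h, h ∈ T (f x) ↔ h ∈ A ∨ ∃ i, (E.equivFin.symm i : H) = h ∧ x i = true) ∧
      (∀ h ∈ A, z h = 1) ∧ (∀ h, h ∉ A → h ∉ E → z h = 0) ∧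
      (∀ i, (t i : ℝ) = z (E.equivFin.symm i)) ∧ weights T z = cubePoint f t := by
  classical
  let A := U.filter fun h => z h = 1
  let E := U.filter fun h => z h ≠ 0 ∧ z h ≠ 1
  have hAE : Disjoint A E := by
    rw [Finset.disjoint_left]
    intro h h1 h2
    exact (Finset.mem_filter.1 h2).2.2 (Finset.mem_filter.1 h1).2
  obtain ⟨f, hc, hf⟩ := hT.exists_cube hAE fun E' hE' =>
    hz.union_mem hT.family hU (Finset.filter_subset _ _) (hE'.trans (Finset.filter_subset _ _)) hE'
      (fun h hh => by
        rcases Finset.mem_union.1 hh with hh | hh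
        · rw [(Finset.mem_filter.1 hh).2]; exact one_ne_zero
        · exact (Finset.mem_filter.1 hh).2.1)
      (fun g hg h1 _ => Finset.mem_filter.2 ⟨hg, h1⟩)
  have hA : ∀ h ∈ A, z h = 1 := fun h hh => (Finset.mem_filter.1 hh).2
  have h0 : ∀ h, h ∉ A → h ∉ E → z h = 0 := by
    intro h h1 h2
    by_contra hne
    have hU := hz.support h hne
    exact h2 (Finset.mem_filter.2 ⟨hU, hne, fun h' => h1 (Finset.mem_filter.2 ⟨hU, h'⟩)⟩)
  exact ⟨A, E, f, fun i => ⟨z (E.equivFin.symm i), hz.isUnit _⟩, hAE, hc, hf, hA, h0, fun i => rfl,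
    hT.weights_eq_cubePoint hAE hc hf hA h0 _ fun i => rfl⟩

/-- The point with given coordinates. -/
noncomputable def IsMedianModel.point (hT : Y.IsMedianModel T) (z : H → ℝ)
    (hz : ∃ U ∈ Set.range T, IsPoint (Set.range T) U z) : Y.Realization :=
  ⟨weights T z, by
    obtain ⟨U, hU, hz⟩ := hz
    obtain ⟨A, E, f, t, -, hc, -, -, -, -, h⟩ := hT.exists_cube_of_isPoint hU hz
    exact ⟨_, f, t, hc, h⟩⟩

open Classical in
/-- The coordinate of a point that belongs to `h`. -/
noncomputable def coord (T : W → Finset H) (h : H) (p : W → ℝ) : ℝ :=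
  mean p fun σ => if h ∈ T σ then 1 else 0

theorem IsMedianModel.coord_point (hT : Y.IsMedianModel T) (z : H → ℝ)
    (hz : ∃ U ∈ Set.range T, IsPoint (Set.range T) U z) (h : H) :
    coord T h (hT.point z hz).1 = z h := by
  change coord T h (weights T z) = z h
  obtain ⟨U, hU, hz⟩ := hz
  obtain ⟨A, E, f, t, hAE, hc, hf, hA, h0, ht, hw⟩ := hT.exists_cube_of_isPoint hU hz
  rw [hw, coord, mean_cubePoint (Y.injective hc)]
  by_cases hhA : h ∈ A
  · have : ∀ x, h ∈ T (f x) := fun x => (hf x h).2 (.inl hhA)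
    simp only [this, if_true]
    rw [avg_const, hA h hhA]
  by_cases hhE : h ∈ E
  · obtain ⟨i, rfl⟩ : ∃ i, (E.equivFin.symm i : H) = h := ⟨E.equivFin ⟨h, hhE⟩, by simp⟩
    have : ∀ x, (E.equivFin.symm i : H) ∈ T (f x) ↔ x i = true := by
      intro x
      rw [hf, or_iff_right hhA]
      constructor
      · rintro ⟨j, hj, hx⟩
        rwa [← E.equivFin.symm.injective (Subtype.ext hj)]
      · exact fun h => ⟨i, rfl, h⟩
    simp only [this]
    rw [avg_coord, ← ht]
    ring
  · have : ∀ x, h ∉ T (f x) := by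
      intro x hx
      rcases (hf x h).1 hx with hx | ⟨i, rfl, -⟩
      · exact hhA hx
      · exact hhE (E.equivFin.symm i).2
    simp only [this, if_false]
    rw [avg_const, h0 h hhA hhE]

/-- Both points lie in one cube, whose directions are the fractional coordinates of `z'` together
with `h`. The direction `h` is admissible even if `z' h = 1`: a nonzero coordinate above `h` would
be nonzero in `z` by `hmax`, forcing `z h = 1`. -/
theorem IsMedianModel.pathDist_point_update_le (hT : Y.IsMedianModel T) {U : Finset H}
    (hU : U ∈ Set.range T) {z z' : H → ℝ} (hz : IsPoint (Set.range T) U z)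
    (hz' : IsPoint (Set.range T) U z') {h : H} (hlt : z h < z' h) (heq : ∀ g, g ≠ h → z g = z' g)
    (hmax : ∀ k, StrictBelow (Set.range T) h k → z k = z' k) :
    Y.pathDist (hT.point z ⟨U, hU, hz⟩) (hT.point z' ⟨U, hU, hz'⟩) ≤
      ENNReal.ofReal (z' h - z h) := by
  classical
  have hh0 : z' h ≠ 0 := (lt_of_le_of_lt (hz.isUnit h).1 hlt).ne'
  have hhU : h ∈ U := hz'.support h hh0
  let A := U.filter fun g => g ≠ h ∧ z' g = 1
  let E := U.filter fun g => g = h ∨ (z' g ≠ 0 ∧ z' g ≠ 1)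
  have hAE : Disjoint A E := by
    rw [Finset.disjoint_left]
    intro g h1 h2
    have h1 := (Finset.mem_filter.1 h1).2
    rcases (Finset.mem_filter.1 h2).2 with h2 | h2
    · exact h1.1 h2
    · exact h2.2 h1.2
  have hne : ∀ g ∈ A ∪ E, z' g ≠ 0 := by
    intro g hg
    rcases Finset.mem_union.1 hg with hg | hg
    · rw [(Finset.mem_filter.1 hg).2.2]; exact one_ne_zero
    · rcases (Finset.mem_filter.1 hg).2 with rfl | hg
      · exact hh0
      · exact hg.1
  obtain ⟨f, hc, hf⟩ := hT.exists_cube hAE fun E' hE' =>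
    hz'.union_mem hT.family hU (Finset.filter_subset _ _) (hE'.trans (Finset.filter_subset _ _))
      hE' hne (by
        rintro g hg h1 ⟨k, hk, hgk⟩
        refine Finset.mem_filter.2 ⟨hg, ?_, h1⟩
        rintro rfl
        have h2 := hmax k hgk
        have h3 := hz.ordered g k hgk (by rw [h2]; exact hne k hk)
        rw [h3, h1] at hlt
        exact lt_irrefl _ hlt)
  have hA : ∀ g ∈ A, z' g = 1 := fun g hg => (Finset.mem_filter.1 hg).2.2
  have h0 : ∀ g, g ∉ A → g ∉ E → z' g = 0 := by
    intro g h1 h2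
    by_contra hne
    have hgU := hz'.support g hne
    by_cases hgh : g = h
    · exact h2 (Finset.mem_filter.2 ⟨hgU, .inl hgh⟩)
    · exact h2 (Finset.mem_filter.2 ⟨hgU, .inr ⟨hne, fun h' =>
        h1 (Finset.mem_filter.2 ⟨hgU, hgh, h'⟩)⟩⟩)
  have hhE : h ∈ E := Finset.mem_filter.2 ⟨hhU, .inl rfl⟩
  have hA' : ∀ g ∈ A, z g = 1 := fun g hg => by
    rw [heq g (Finset.mem_filter.1 hg).2.1]; exact hA g hg
  have h0' : ∀ g, g ∉ A → g ∉ E → z g = 0 := fun g h1 h2 => by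
    rw [heq g (by rintro rfl; exact h2 hhE)]; exact h0 g h1 h2
  let s : Fin E.card → unitInterval := fun i => ⟨z (E.equivFin.symm i), hz.isUnit _⟩
  let s' : Fin E.card → unitInterval := fun i => ⟨z' (E.equivFin.symm i), hz'.isUnit _⟩
  have e : hT.point z ⟨U, hU, hz⟩ = Y.mkPoint hc s :=
    Subtype.ext (hT.weights_eq_cubePoint hAE hc hf hA' h0' s fun i => rfl)
  have e' : hT.point z' ⟨U, hU, hz'⟩ = Y.mkPoint hc s' :=
    Subtype.ext (hT.weights_eq_cubePoint hAE hc hf hA h0 s' fun i => rfl)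
  rw [e, e']
  refine (Y.pathDist_le_cubeDist _ _).trans ((Y.cubeDist_mkPoint_le hc s s').trans_eq ?_)
  congr 1
  rw [Finset.sum_eq_single (E.equivFin ⟨h, hhE⟩)]
  · simp only [s, s', Equiv.symm_apply_apply]
    rw [abs_sub_comm, abs_of_pos (by linarith)]
  · intro i _ hi
    have : (E.equivFin.symm i : H) ≠ h := by
      intro hc
      apply hi
      rw [← Equiv.symm_apply_eq]
      exact Subtype.ext hc
    simp only [s, s', heq _ this, sub_self, abs_zero]
  · simp

/-- Coordinates are raised one at a time, from below upwards. Seen from `z'`, a maximal coordinate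
among those that differ is lowered to its value in `z`, which keeps the coordinates ordered. -/
theorem IsMedianModel.pathDist_point_le (hT : Y.IsMedianModel T) {U : Finset H}
    (hU : U ∈ Set.range T) {z : H → ℝ} (hz : IsPoint (Set.range T) U z) (n : ℕ) :
    ∀ {z' : H → ℝ} (hz' : IsPoint (Set.range T) U z'), z ≤ z' → {h ∈ U | z h ≠ z' h}.card = n →
      Y.pathDist (hT.point z ⟨U, hU, hz⟩) (hT.point z' ⟨U, hU, hz'⟩) ≤
        ENNReal.ofReal (∑ h ∈ U, (z' h - z h)) := by
  classical
  induction n with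
  | zero =>
    intro z' hz' hle hn
    have : z = z' := by
      funext h
      by_contra hne
      have hhU : h ∈ U := by
        refine hz'.support h fun h0 => hne ?_
        exact le_antisymm (hle h) (by rw [h0]; exact (hz.isUnit h).1)
      rw [Finset.card_eq_zero] at hn
      exact Finset.notMem_empty h (hn ▸ Finset.mem_filter.2 ⟨hhU, hne⟩)
    subst this
    rw [pathDist_self]
    exact bot_le
  | succ n ih =>
    intro z' hz' hle hn
    obtain ⟨h, hh, hmax⟩ := Finset.exists_max_image {h ∈ U | z h ≠ z' h}
      (fun h => (U.filter fun x => Below (Set.range T) x h).card)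
      (Finset.card_pos.1 (by rw [hn]; omega))
    rw [Finset.mem_filter] at hh
    have hlt : z h < z' h := lt_of_le_of_ne (hle h) hh.2
    have hz0 : ∀ {g}, z g ≠ 0 → z' g ≠ 0 := fun {g} h1 h2 =>
      h1 (le_antisymm (by rw [← h2]; exact hle g) (hz.isUnit g).1)
    have hmax' : ∀ k, StrictBelow (Set.range T) h k → z k = z' k := by
      intro k hk
      by_contra hne
      have hkU : k ∈ U := by
        refine hz'.support k fun h0 => hne ?_
        exact le_antisymm (hle k) (by rw [h0]; exact (hz.isUnit k).1)
      have h1 := hmax k (Finset.mem_filter.2 ⟨hkU, hne⟩)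
      exact absurd (hT.family.card_below_lt hU hkU hk.2.1 hk.1) (not_lt.2 h1)
    let z₁ := Function.update z' h (z h)
    have e1 : z₁ h = z h := by simp [z₁]
    have e2 : ∀ g, g ≠ h → z₁ g = z' g := fun g hg => by simp [z₁, hg]
    have hz₁ : IsPoint (Set.range T) U z₁ := by
      refine ⟨fun g => ?_, fun g hg => ?_, fun g k hgk hk => ?_⟩
      · by_cases hgh : g = h
        · rw [hgh, e1]; exact hz.isUnit h
        · rw [e2 g hgh]; exact hz'.isUnit g
      · by_cases hgh : g = h
        · rw [hgh]; exact hh.1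
        · rw [e2 g hgh] at hg; exact hz'.support g hg
      · by_cases hkh : k = h
        · subst hkh
          rw [e1] at hk
          rw [e2 g hgk.1]
          exact hz'.ordered g k hgk (hz0 hk)
        · rw [e2 k hkh] at hk
          by_cases hgh : g = h
          · subst hgh
            rw [e1]
            exact hz.ordered g k hgk (by rw [hmax' k hgk]; exact hk)
          · rw [e2 g hgh]
            exact hz'.ordered g k hgk hk
    have hle₁ : z ≤ z₁ := by
      intro g
      by_cases hgh : g = h
      · rw [hgh, e1]
      · rw [e2 g hgh]; exact hle g
    have hcard : {g ∈ U | z g ≠ z₁ g}.card = n := by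
      have : {g ∈ U | z g ≠ z₁ g} = {g ∈ U | z g ≠ z' g}.erase h := by
        ext g
        rw [Finset.mem_erase, Finset.mem_filter, Finset.mem_filter]
        by_cases hgh : g = h
        · subst hgh; simp [e1]
        · simp [e2 g hgh, hgh]
      rw [this, Finset.card_erase_of_mem (Finset.mem_filter.2 hh), hn]
      rfl
    have h1 := ih hz₁ hle₁ hcard
    have h2 := hT.pathDist_point_update_le hU hz₁ hz' (h := h) (by rw [e1]; exact hlt) e2 (by
      intro k hk
      exact e2 k hk.1.symm)
    refine (Y.pathDist_triangle _ (hT.point z₁ ⟨U, hU, hz₁⟩) _).trans ((add_le_add h1 h2).trans ?_)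
    rw [← ENNReal.ofReal_add (Finset.sum_nonneg fun g _ => sub_nonneg.2 (hle₁ g))
      (by rw [e1]; linarith)]
    refine ENNReal.ofReal_le_ofReal (le_of_eq ?_)
    rw [← Finset.add_sum_erase _ _ hh.1, ← Finset.add_sum_erase (f := fun g => z' g - z g) _ hh.1,
      e1, Finset.sum_congr rfl fun g hg => by rw [e2 g (Finset.mem_erase.1 hg).1]]
    ring

theorem IsMedianModel.sum_coord_le_cubeDist (hT : Y.IsMedianModel T) (p q : Y.Realization)
    (U : Finset H) :
    ENNReal.ofReal (∑ h ∈ U, |coord T h p.1 - coord T h q.1|) ≤ Y.cubeDist p q := by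
  classical
  refine le_iInf fun n => le_iInf fun f => le_iInf fun s => le_iInf fun t => le_iInf fun hpq => ?_
  obtain ⟨hc, hp, hq⟩ := hpq
  refine ENNReal.ofReal_le_ofReal ?_
  obtain ⟨k, hk, hf⟩ := (hT.isCube_iff f).1 hc
  have hcoord : ∀ (t : Fin n → unitInterval) h, coord T h (cubePoint f t) =
      avg t fun x => if h ∈ T (f x) then 1 else 0 := fun t h => mean_cubePoint (Y.injective hc) t _
  -- Within a cube, the coordinate of `h` is `t i` or `1 - t i` if `h` is the hyperplane of
  -- direction `i`, and constant if `h` belongs to no direction.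
  have key : ∀ h, |coord T h p.1 - coord T h q.1| ≤
      ∑ i, if k i = h then |(s i : ℝ) - t i| else 0 := by
    intro h
    rw [hp, hq, hcoord, hcoord]
    by_cases hh : ∃ i, k i = h
    · obtain ⟨i, rfl⟩ := hh
      have hi : ∀ x, ¬(k i ∈ T (f x) ↔ k i ∈ T (f fun _ => false)) ↔ x i = true := by
        intro x
        rw [hf]
        simp [hk.eq_iff]
      have h1 : |(s i : ℝ) - t i| = ∑ j, if k j = k i then |(s j : ℝ) - t j| else 0 := by
        simp [hk.eq_iff]
      rw [← h1]
      by_cases h0 : k i ∈ T (f fun _ => false)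
      · have : ∀ x, (if k i ∈ T (f x) then (1 : ℝ) else 0) = if x i then 0 else 1 := by
          intro x
          have := hi x
          simp only [h0, iff_true] at this
          by_cases hx : x i = true
          · rw [if_neg (this.2 hx), if_pos hx]
          · rw [if_neg hx, if_pos (not_not.1 (mt this.1 hx))]
        simp only [this, avg_coord]
        rw [abs_sub_comm]
        exact le_of_eq (congrArg _ (by ring))
      · have : ∀ x, (if k i ∈ T (f x) then (1 : ℝ) else 0) = if x i then 1 else 0 := by
          intro x
          have := hi x
          simp only [h0, iff_false, not_not] at this
          simp only [this]
        simp only [this, avg_coord]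
        exact le_of_eq (congrArg _ (by ring))
    · have : ∀ x, (if h ∈ T (f x) then (1 : ℝ) else 0) =
          if h ∈ T (f fun _ => false) then 1 else 0 := by
        intro x
        have := (hf x (fun _ => false) h).not.2 (fun ⟨i, hi, _⟩ => hh ⟨i, hi⟩)
        rw [not_not] at this
        simp only [this]
      simp only [this, avg_const, sub_self, abs_zero]
      exact Finset.sum_nonneg fun i _ => by split_ifs <;> positivity
  refine (Finset.sum_le_sum fun h _ => key h).trans ?_
  rw [Finset.sum_comm]
  refine Finset.sum_le_sum fun i _ => ?_
  rw [Finset.sum_ite_eq]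
  split_ifs
  · exact le_rfl
  · exact abs_nonneg _

theorem IsMedianModel.sum_coord_le_pathDist (hT : Y.IsMedianModel T) (p q : Y.Realization)
    (U : Finset H) :
    ENNReal.ofReal (∑ h ∈ U, |coord T h p.1 - coord T h q.1|) ≤ Y.pathDist p q := by
  refine le_iInf fun L => le_iInf fun hL => ?_
  subst hL
  induction L generalizing p with
  | nil => simp
  | cons a L ih =>
    rw [stringLength, List.getLastD_cons]
    refine le_trans ?_ (add_le_add (hT.sum_coord_le_cubeDist p a U) (ih a))
    rw [← ENNReal.ofReal_add (Finset.sum_nonneg fun _ _ => abs_nonneg _)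
      (Finset.sum_nonneg fun _ _ => abs_nonneg _), ← Finset.sum_add_distrib]
    exact ENNReal.ofReal_le_ofReal (Finset.sum_le_sum fun h _ => abs_sub_le _ _ _)

end Model

end CubeComplex

namespace CubeComplex

open IsMedianFamily

variable {V : Type u} {X : CubeComplex V}

/-! ### Extension of vertex coordinates to the realization -/

/-- Flip exactly those directions whose hyperplane does not yet separate the reference corner from
`o`. -/
theorem IsCAT0.exists_top_vertex (hX : X.IsCAT0) (o : V) {n : ℕ} {f : (Fin n → Bool) → V}
    (hf : X.IsCube f) : ∃ y, ∀ x, sep hX o (f x) ⊆ sep hX o (f y) := by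
  classical
  obtain ⟨k, hk, hsep⟩ := hX.exists_cube_labels hf
  refine ⟨fun i => if k i ∈ sep hX o (f fun _ => false) then false else true, fun x h hh => ?_⟩
  by_contra hc
  have h1 := (mem_sep_iff hX o (f x) _ h).2 (by simpa [hh] using hc)
  obtain ⟨i, rfl, -⟩ := (hsep _ _ _).1 h1
  by_cases h0 : k i ∈ sep hX o (f fun _ => false)
  · have h2 := (mem_sep_iff hX o (f fun _ => false) _ (k i)).2 (by simpa [h0] using hc)
    obtain ⟨j, hj, hne⟩ := (hsep _ _ _).1 h2
    rw [hk hj] at hne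
    simp [h0] at hne
  · have h2 := (hsep (fun _ => false) (fun i => if k i ∈ sep hX o (f fun _ => false) then false
      else true) (k i)).2 ⟨i, rfl, by simp [h0]⟩
    rw [mem_sep_iff hX o] at h2
    tauto

open Classical in
/-- In each direction, a cube points away from the base point or towards it. -/
theorem IsCAT0.exists_direction (hX : X.IsCAT0) (o : V) {n : ℕ} {f : (Fin n → Bool) → V}
    (hf : X.IsCube f) (i : Fin n) : ∃ b : Bool, ∀ x, ∃ k, k ∉ sep hX o (f (Function.update x i !b)) ∧
      sep hX o (f (Function.update x i b)) = insert k (sep hX o (f (Function.update x i !b))) := by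
  classical
  obtain ⟨k, hk, hsep⟩ := hX.exists_cube_labels hf
  have key : ∃ b : Bool, ∀ x, k i ∉ sep hX o (f (Function.update x i !b)) := by
    have h1 : ∀ x y, x i = y i → (k i ∈ sep hX o (f x) ↔ k i ∈ sep hX o (f y)) := by
      intro x y hxy
      by_contra hc
      obtain ⟨j, hj, hne⟩ := (hsep _ _ _).1 ((mem_sep_iff hX o (f x) (f y) (k i)).2 hc)
      rw [hk hj] at hne
      exact hne hxy
    have h2 := (hsep (fun _ => false) (fun _ => true) (k i)).2 ⟨i, rfl, by simp⟩
    rw [mem_sep_iff hX o] at h2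
    by_cases h3 : k i ∈ sep hX o (f fun _ => false)
    · refine ⟨false, fun x hx => ?_⟩
      rw [h1 _ (fun _ => true) (by simp)] at hx
      tauto
    · refine ⟨true, fun x hx => ?_⟩
      rw [h1 _ (fun _ => false) (by simp)] at hx
      tauto
  obtain ⟨b, hb⟩ := key
  refine ⟨b, fun x => ⟨k i, hb x, insert_of_sep hX o ?_ (hb x)⟩⟩
  ext h
  rw [hsep, Finset.mem_singleton]
  constructor
  · rintro ⟨j, rfl, hj⟩
    by_contra hne
    have : j ≠ i := fun h => hne (by rw [h])
    simp [this] at hj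
  · rintro rfl
    exact ⟨i, rfl, by simp⟩

open Classical in
-- Criterion for maps to the restricted complex: vertex coordinates that grow along outward edges,
-- by at most `C` in total, define a `C`-Lipschitz map after multilinear extension and pouring.
-- `hclose` keeps the images of vertices within `ℓ¹` distance 1 of their orientations.
theorem exists_map_of_coords (hX : X.IsCAT0) (o : V) (K : Set X.Hyperplane) (C : ℝ) (hC : 0 ≤ C)
    (ψ : V → X.Hyperplane → ℝ) (hunit : ∀ v, Pour.IsUnit (ψ v))
    (hsupp : ∀ v h, ψ v h ≠ 0 → h ∈ (sep hX o v).filter (· ∈ K))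
    (hedge : ∀ v w k, k ∉ sep hX o v → sep hX o w = insert k (sep hX o v) →
      ψ v ≤ ψ w ∧ ∀ U : Finset X.Hyperplane, ∑ h ∈ U, (ψ w h - ψ v h) ≤ C)
    (hclose : ∀ v (U : Finset X.Hyperplane),
      ∑ h ∈ U, ((if h ∈ (sep hX o v).filter (· ∈ K) then 1 else 0) - ψ v h) ≤ 1) :
    ∃ φ : X.Realization → (X.restrict K).Realization,
      (∀ {n : ℕ} {f : (Fin n → Bool) → V} (hf : X.IsCube f) (s t : Fin n → unitInterval),
        (X.restrict K).pathDist (φ (X.mkPoint hf s)) (φ (X.mkPoint hf t)) ≤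
          ENNReal.ofReal (C * ∑ i, |(s i : ℝ) - t i|)) ∧
      ∀ v (U : Finset X.Hyperplane), ∑ h ∈ U, |(if h ∈ (sep hX o v).filter (· ∈ K) then 1 else 0) -
        coord (orientationSep hX o K) h (φ (X.vertexPoint v)).1| ≤ 1 := by
  have hT := isMedianModel_restrict hX o K
  set T := orientationSep hX o K with hTdef
  have hrange : ∀ v, (sep hX o v).filter (· ∈ K) ∈ Set.range T := fun v =>
    ⟨_, orientationSep_orientation hX o K v⟩
  obtain ⟨F, hF1, hF2, hF3, hF4⟩ := exists_pour (StrictBelow (Set.range T)) (fun g h => h.1 rfl)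
    (fun f g h => hT.family.strictBelow_trans) finite_strictBelow
  let Ψ : X.Realization → X.Hyperplane → ℝ := fun p h => mean p.1 fun v => ψ v h
  have hΨ : ∀ {n : ℕ} {f : (Fin n → Bool) → V} (hf : X.IsCube f) (t : Fin n → unitInterval) h,
      Ψ (X.mkPoint hf t) h = avg t fun x => ψ (f x) h := fun hf t h =>
    mean_cubePoint (X.injective hf) t _
  have hΨu : ∀ {n : ℕ} {f : (Fin n → Bool) → V} (hf : X.IsCube f) (t : Fin n → unitInterval),
      Pour.IsUnit (Ψ (X.mkPoint hf t)) := by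
    intro n f hf t h
    rw [hΨ]
    constructor
    · rw [← avg_const t 0]; exact avg_mono t fun x => (hunit _ h).1
    · rw [← avg_const t 1]; exact avg_mono t fun x => (hunit _ h).2
  have hclosed : ∀ U ∈ Set.range T, ∀ h ∈ U, ∀ g, StrictBelow (Set.range T) g h → g ∈ U :=
    fun U hU h hh g hg => hg.mem hU hh
  have hpt : ∀ {n : ℕ} {f : (Fin n → Bool) → V} (hf : X.IsCube f), ∃ U ∈ Set.range T,
      ∀ t : Fin n → unitInterval, (∀ h, Ψ (X.mkPoint hf t) h ≠ 0 → h ∈ U) ∧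
        IsPoint (Set.range T) U (F (Ψ (X.mkPoint hf t))) := by
    intro n f hf
    obtain ⟨y, hy⟩ := hX.exists_top_vertex o hf
    refine ⟨_, hrange (f y), fun t => ?_⟩
    have h1 : ∀ h, Ψ (X.mkPoint hf t) h ≠ 0 → h ∈ (sep hX o (f y)).filter (· ∈ K) := by
      intro h hne
      by_contra hc
      refine hne ?_
      rw [hΨ, ← avg_const t 0]
      congr 1
      funext x
      by_contra hx
      exact hc (Finset.filter_subset_filter _ (hy x) (hsupp _ _ hx))
    have h2 := hF1 _ (hΨu hf t) ((Finset.finite_toSet _).subset h1)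
    exact ⟨h1, h2.1, (hF3 _ _ (hΨu hf t) h1 (hclosed _ (hrange _))).1, h2.2⟩
  have hpt' : ∀ p : X.Realization, ∃ U ∈ Set.range T, IsPoint (Set.range T) U (F (Ψ p)) := by
    rintro ⟨_, n, f, t, hf, rfl⟩
    obtain ⟨U, hU, h⟩ := hpt hf
    exact ⟨U, hU, (h t).2⟩
  let φ : X.Realization → (X.restrict K).Realization := fun p => hT.point (F (Ψ p)) (hpt' p)
  -- For comparable functions the distance of the poured points is at most the difference of their
  -- masses on the down-closed set `U`, which pouring does not change.
  have hup : ∀ {n : ℕ} {f : (Fin n → Bool) → V} (hf : X.IsCube f) (s t : Fin n → unitInterval)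
      (r : ℝ), Ψ (X.mkPoint hf s) ≤ Ψ (X.mkPoint hf t) →
      (∀ U : Finset X.Hyperplane, ∑ h ∈ U, (Ψ (X.mkPoint hf t) h - Ψ (X.mkPoint hf s) h) ≤ r) →
      (X.restrict K).pathDist (φ (X.mkPoint hf s)) (φ (X.mkPoint hf t)) ≤ ENNReal.ofReal r := by
    intro n f hf s t r hle hr
    obtain ⟨U, hU, h⟩ := hpt hf
    refine (hT.pathDist_point_le hU (h s).2 _ (h t).2 (hF2 _ _ (hΨu hf s) (hΨu hf t)
      (U.finite_toSet.subset (h t).1) hle) rfl).trans (ENNReal.ofReal_le_ofReal ?_)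
    rw [Finset.sum_sub_distrib, (hF3 _ U (hΨu hf s) (h s).1 (hclosed U hU)).2,
      (hF3 _ U (hΨu hf t) (h t).1 (hclosed U hU)).2, ← Finset.sum_sub_distrib]
    exact hr U
  -- All edges of a cube in direction `i` point away from `o` at the same end, so changing one
  -- coordinate gives comparable functions; `δ` is the signed change in the outward direction.
  have hcoord : ∀ {n : ℕ} {f : (Fin n → Bool) → V} (hf : X.IsCube f) (t : Fin n → unitInterval)
      (i : Fin n) (a b : unitInterval),
      (X.restrict K).pathDist (φ (X.mkPoint hf (Function.update t i a)))
        (φ (X.mkPoint hf (Function.update t i b))) ≤ ENNReal.ofReal (C * |(a : ℝ) - b|) := by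
    intro n f hf t i
    obtain ⟨e, he⟩ := hX.exists_direction o hf i
    have hg : ∀ x h, ψ (f (Function.update x i !e)) h ≤ ψ (f (Function.update x i e)) h := by
      intro x
      obtain ⟨k, h1, h2⟩ := he x
      exact (hedge _ _ k h1 h2).1
    have hs : ∀ x (U : Finset X.Hyperplane), ∑ h ∈ U, (ψ (f (Function.update x i e)) h -
        ψ (f (Function.update x i !e)) h) ≤ C := by
      intro x
      obtain ⟨k, h1, h2⟩ := he x
      exact (hedge _ _ k h1 h2).2
    let δ : unitInterval → unitInterval → ℝ := fun a b => if e then (b : ℝ) - a else a - b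
    have hdiff : ∀ a b h, Ψ (X.mkPoint hf (Function.update t i b)) h -
        Ψ (X.mkPoint hf (Function.update t i a)) h = δ a b * avg t (fun x =>
          ψ (f (Function.update x i e)) h - ψ (f (Function.update x i !e)) h) := by
      intro a b h
      rw [hΨ, hΨ, avg_update_sub]
      cases e with
      | true => rfl
      | false =>
        simp only [δ, Bool.not_false, avg_sub]
        simp
        ring
    have main : ∀ a b, 0 ≤ δ a b →
        (X.restrict K).pathDist (φ (X.mkPoint hf (Function.update t i a)))
          (φ (X.mkPoint hf (Function.update t i b))) ≤ ENNReal.ofReal (C * |(a : ℝ) - b|) := by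
      intro a b hδ
      have habs : |(a : ℝ) - b| = δ a b := by
        simp only [δ] at hδ ⊢
        split_ifs at hδ ⊢
        · rw [abs_sub_comm, abs_of_nonneg hδ]
        · rw [abs_of_nonneg hδ]
      refine hup hf _ _ _ (fun h => ?_) fun U => ?_
      · rw [← sub_nonneg, hdiff]
        refine mul_nonneg hδ ?_
        rw [← avg_const t 0]
        exact avg_mono t fun x => sub_nonneg.2 (hg x h)
      · rw [Finset.sum_congr rfl fun h _ => hdiff a b h, ← Finset.mul_sum, ← avg_sum, habs,
          mul_comm C]
        refine mul_le_mul_of_nonneg_left ?_ hδ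
        rw [← avg_const t C]
        exact avg_mono t fun x => hs x U
    intro a b
    rcases le_total 0 (δ a b) with h | h
    · exact main a b h
    · rw [pathDist_comm, abs_sub_comm]
      refine main b a ?_
      simp only [δ] at h ⊢
      split_ifs at h ⊢ <;> linarith
  refine ⟨φ, fun {n f} hf s t => ?_, fun v U => ?_⟩
  -- Replace the coordinates of `s` by those of `t` one after another.
  · have key : ∀ J : Finset (Fin n), (X.restrict K).pathDist (φ (X.mkPoint hf s))
        (φ (X.mkPoint hf fun i => if i ∈ J then t i else s i)) ≤
          ENNReal.ofReal (C * ∑ i ∈ J, |(s i : ℝ) - t i|) := by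
      intro J
      induction J using Finset.induction_on with
      | empty => simp [pathDist_self]
      | insert a J ha ih =>
        have e1 : (fun i => if i ∈ J then t i else s i) =
            Function.update (fun i => if i ∈ J then t i else s i) a (s a) := by
          rw [eq_comm, Function.update_eq_iff]
          simp [ha]
        have e2 : (fun i => if i ∈ insert a J then t i else s i) =
            Function.update (fun i => if i ∈ J then t i else s i) a (t a) := by
          funext i
          by_cases hi : i = a
          · subst hi; simp
          · simp [hi]
        have h1 := hcoord hf (fun i => if i ∈ J then t i else s i) a (s a) (t a)
        rw [← e1, ← e2] at h1
        refine ((X.restrict K).pathDist_triangle _ _ _).trans ((add_le_add ih h1).trans ?_)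
        rw [← ENNReal.ofReal_add (mul_nonneg hC (Finset.sum_nonneg fun _ _ => abs_nonneg _))
          (mul_nonneg hC (abs_nonneg _)), Finset.sum_insert ha, ← mul_add, add_comm]
    have := key Finset.univ
    simpa using this
  · let P := (sep hX o v).filter (· ∈ K)
    let χ : X.Hyperplane → ℝ := fun h => if h ∈ P then 1 else 0
    have hPm : P ∈ Set.range T := hrange v
    have hχ0 : ∀ h, χ h ≠ 0 → h ∈ P := fun h hh => by
      by_contra hc
      exact hh (if_neg hc)
    have hχu : Pour.IsUnit χ := fun h => by
      simp only [χ]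
      split_ifs <;> norm_num
    -- The indicator of a member is already ordered, so pouring fixes it. By monotonicity it still
    -- dominates the poured coordinates, and the distance is again a difference of masses.
    have hFχ : F χ = χ := hF4 χ hχu fun g h hgh hh => if_pos (hgh.mem hPm (hχ0 h hh))
    have hψχ : ψ v ≤ χ := by
      intro h
      by_cases hh : h ∈ P
      · simp only [χ, if_pos hh]; exact (hunit v h).2
      · simp only [χ, if_neg hh]
        refine le_of_eq ?_
        by_contra hc
        exact hh (hsupp v h hc)
    have hΨv : Ψ (X.vertexPoint v) = ψ v := funext fun h => X.mean_vertexPoint v _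
    have hle := hF2 _ _ (hunit v) hχu (P.finite_toSet.subset hχ0) hψχ
    rw [hFχ] at hle
    have hmass := hF3 _ P (hunit v) (hsupp v) (hclosed P hPm)
    have hval : ∀ h, coord T h (φ (X.vertexPoint v)).1 = F (ψ v) h := by
      intro h
      rw [← hΨv]
      exact hT.coord_point _ _ h
    calc ∑ h ∈ U, |χ h - coord T h (φ (X.vertexPoint v)).1|
        = ∑ h ∈ U, (χ h - F (ψ v) h) := Finset.sum_congr rfl fun h _ => by
          rw [hval, abs_of_nonneg (sub_nonneg.2 (hle h))]
      _ ≤ ∑ h ∈ U ∪ P, (χ h - F (ψ v) h) :=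
          Finset.sum_le_sum_of_subset_of_nonneg Finset.subset_union_left
            fun h _ _ => sub_nonneg.2 (hle h)
      _ = ∑ h ∈ P, (χ h - F (ψ v) h) := by
          refine (Finset.sum_subset Finset.subset_union_right fun h _ hh => ?_).symm
          have h1 : F (ψ v) h = 0 := by
            by_contra hc
            exact hh (hmass.1 h hc)
          rw [h1]
          simp [χ, hh]
      _ = ∑ h ∈ P, (χ h - ψ v h) := by
          rw [Finset.sum_sub_distrib, hmass.2, ← Finset.sum_sub_distrib]
      _ ≤ 1 := hclose v P

end CubeComplex

namespace CubeComplex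

open IsMedianFamily

variable {V : Type u} {X : CubeComplex V}

/-! ### Controlled colourings -/

/-- Such a geodesic crosses only hyperplanes that separate `v` from `o`, so every step removes one
of them. -/
theorem IsGeodesic.isInward (hX : X.IsCAT0) (o : V) {v u : V} {p : X.skeleton.Walk v u}
    (hp : X.IsGeodesic p) (hvu : sep hX o u ⊆ sep hX o v) : X.IsInward o p := by
  induction p with
  | nil => exact fun d hd => absurd hd (by simp)
  | @cons v m u h p ih =>
    have hk := (mem_sep_of_geodesic hX hp (X.hyp h)).2 (by simp [crossings_cons])
    rw [mem_sep_iff hX o] at hk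
    have hkv : X.hyp h ∈ sep hX o v := by
      by_contra hc
      exact hc (hvu (by tauto))
    have hm : sep hX o u ⊆ sep hX o m := by
      intro g hg
      by_contra hc
      have h1 := (mem_sep_iff hX o v m g).2 (by simp [hvu hg, hc])
      rw [sep_of_adj hX h, Finset.mem_singleton] at h1
      subst h1
      tauto
    intro d hd
    rw [SimpleGraph.Walk.darts_cons, List.mem_cons] at hd
    rcases hd with rfl | hd
    · have := (dist_add_one_of_mem_sep hX (w := o) h).1 ((mem_sep_comm hX).1 hkv)
      rw [SimpleGraph.dist_comm, SimpleGraph.dist_comm (u := v)] at this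
      change X.skeleton.dist o m < X.skeleton.dist o v
      omega
    · exact ih (hp.of_cons hX.1.1) hm d hd

open Classical in
theorem sep_eq_sdiff (hX : X.IsCAT0) (o : V) {u v : V} (hvu : sep hX o u ⊆ sep hX o v) :
    sep hX v u = sep hX o v \ sep hX o u := by
  ext h
  rw [mem_sep_iff hX o, Finset.mem_sdiff]
  have := @hvu h
  tauto

open Classical in
theorem IsControlledColouring.card_sdiff_le {hX : X.IsCAT0} {o : V} {l : ℕ}
    {c : X.Hyperplane → Fin 2} (hc : X.IsControlledColouring o l c) {u v : V}
    (hvu : sep hX o u ⊆ sep hX o v) (a : Fin 2) (ha : ∀ h ∈ sep hX o v \ sep hX o u, c h = a) :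
    (sep hX o v \ sep hX o u).card ≤ l := by
  obtain ⟨p, hp⟩ := hX.1.1.exists_walk_length_eq_dist v u
  rw [← sep_eq_sdiff hX o hvu] at ha ⊢
  rw [card_sep, ← hp]
  refine hc v u p hp (IsGeodesic.isInward hX o hp hvu) ⟨a, fun d hd => ha _ ?_⟩
  exact (mem_sep_of_geodesic hX hp _).2 (List.mem_map_of_mem hd)

open Classical in
-- With `n` hyperplanes of colour 0 between `u` and `v`, those of colour 1 occur in at most `n + 1`
-- runs of length at most `l`, and `(n + 1) * l + n = (l + 1) * n + l`.
theorem IsControlledColouring.card_sdiff_le_mul {hX : X.IsCAT0} {o : V} {l : ℕ}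
    {c : X.Hyperplane → Fin 2} (hc : X.IsControlledColouring o l c) {u v : V}
    (hvu : sep hX o u ⊆ sep hX o v) : (sep hX o v \ sep hX o u).card ≤
      (l + 1) * ((sep hX o v \ sep hX o u).filter fun h => c h = 0).card + l := by
  -- `u'` moves outward to `v` one hyperplane at a time, while `u` marks the beginning of the
  -- current run of colour 1.
  have key : ∀ (N : ℕ) (u u' : V), sep hX o u ⊆ sep hX o u' → sep hX o u' ⊆ sep hX o v →
      (∀ h ∈ sep hX o u' \ sep hX o u, c h = 1) → (sep hX o v \ sep hX o u').card = N →
      (sep hX o v \ sep hX o u).card ≤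
        (l + 1) * ((sep hX o v \ sep hX o u').filter fun h => c h = 0).card + l := by
    intro N
    induction N with
    | zero =>
      intro u u' h1 h2 h3 h4
      rw [Finset.card_eq_zero, Finset.sdiff_eq_empty_iff_subset] at h4
      rw [subset_antisymm h2 h4] at h3
      exact (hc.card_sdiff_le (h1.trans h2) 1 h3).trans (Nat.le_add_left _ _)
    | succ N ih =>
      intro u u' h1 h2 h3 h4
      have hss : sep hX o u' ⊂ sep hX o v := by
        refine ⟨h2, fun h => ?_⟩
        rw [Finset.sdiff_eq_empty_iff_subset.2 h, Finset.card_empty] at h4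
        omega
      obtain ⟨m, hm, hmu, w, hw⟩ := (isMedianFamily_sep hX o).exists_insert_mem ⟨u', rfl⟩ ⟨v, rfl⟩ hss
      have hwv : sep hX o w ⊆ sep hX o v := by
        rw [hw]; exact Finset.insert_subset hm h2
      have hins : sep hX o v \ sep hX o u' = insert m (sep hX o v \ sep hX o w) := by
        rw [hw]; ext h
        simp only [Finset.mem_sdiff, Finset.mem_insert]
        by_cases hh : h = m
        · subst hh; tauto
        · tauto
      have hmw : m ∉ sep hX o v \ sep hX o w := by simp [hw]
      have hN : (sep hX o v \ sep hX o w).card = N := by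
        rw [hins, Finset.card_insert_of_notMem hmw] at h4
        omega
      rw [hins]
      by_cases hcm : c m = 0
      · have := ih w w subset_rfl hwv (by simp) hN
        rw [Finset.filter_insert, if_pos hcm, Finset.card_insert_of_notMem (by simp [hw])]
        have h5 := hc.card_sdiff_le h1 1 h3
        have h6 : (sep hX o v \ sep hX o u).card ≤ (sep hX o v \ sep hX o u').card +
            (sep hX o u' \ sep hX o u).card := by
          rw [Finset.card_sdiff_of_subset h2, Finset.card_sdiff_of_subset h1,
            Finset.card_sdiff_of_subset (h1.trans h2)]
          have := Finset.card_le_card h1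
          have := Finset.card_le_card h2
          omega
        rw [mul_add, mul_one]
        omega
      · rw [Finset.filter_insert, if_neg hcm]
        refine ih u w ?_ hwv ?_ hN
        · rw [hw]; exact h1.trans (Finset.subset_insert _ _)
        · intro h hh
          rw [hw, Finset.mem_sdiff, Finset.mem_insert] at hh
          rcases hh with ⟨rfl | hh, hn⟩
          · omega
          · exact h3 h (Finset.mem_sdiff.2 ⟨hh, hn⟩)
  exact key _ u u subset_rfl hvu (by simp) rfl

open Classical in
/-- The hyperplanes of colour `0` separating `v` from the base point such that no hyperplane
of the other colour lies between them and `v`. -/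
noncomputable def outer (hX : X.IsCAT0) (o : V) (c : X.Hyperplane → Fin 2) (v : V) :
    Finset X.Hyperplane :=
  (sep hX o v).filter fun h => c h = 0 ∧
    ∀ k ∈ sep hX o v, Below (Set.range (sep hX o)) h k → c k = 0

theorem mem_outer {hX : X.IsCAT0} {o : V} {c : X.Hyperplane → Fin 2} {v : V} {h : X.Hyperplane} :
    h ∈ outer hX o c v ↔ h ∈ sep hX o v ∧ c h = 0 ∧
      ∀ k ∈ sep hX o v, Below (Set.range (sep hX o)) h k → c k = 0 := by
  classical
  rw [outer, Finset.mem_filter]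

/-- A hyperplane above an outer one is outer, so the other hyperplanes are those separating some
vertex `u` from `o`. Those between `u` and `v` are exactly the outer ones, all of colour 0. -/
theorem IsControlledColouring.card_outer_le {hX : X.IsCAT0} {o : V} {l : ℕ}
    {c : X.Hyperplane → Fin 2} (hc : X.IsControlledColouring o l c) (v : V) :
    (outer hX o c v).card ≤ l := by
  classical
  have hsub : outer hX o c v ⊆ sep hX o v := Finset.filter_subset _ _
  obtain ⟨u, hu⟩ := (isMedianFamily_sep hX o).mem_of_downset ⟨v, rfl⟩
    (Finset.sdiff_subset : sep hX o v \ outer hX o c v ⊆ sep hX o v) (by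
      intro h hh g hg hgh
      rw [Finset.mem_sdiff] at hh ⊢
      refine ⟨hg, fun hgo => hh.2 ?_⟩
      rw [mem_outer] at hgo ⊢
      exact ⟨hh.1, hgo.2.2 h hh.1 hgh, fun k hk hhk =>
        hgo.2.2 k hk fun A hA hkA => hgh A hA (hhk A hA hkA)⟩)
  have h1 : sep hX o v \ sep hX o u = outer hX o c v := by
    rw [hu, Finset.sdiff_sdiff_eq_self hsub]
  rw [← h1]
  refine hc.card_sdiff_le (by rw [hu]; exact Finset.sdiff_subset) 0 ?_
  rw [h1]
  exact fun h hh => (mem_outer.1 hh).2.1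

open Classical in
/-- The indicator of the hyperplanes of colour `0` separating `v` from the base point, lowered by
`1 / (l + 1)` on the outer ones. -/
noncomputable def outerCoord (hX : X.IsCAT0) (o : V) (c : X.Hyperplane → Fin 2) (l : ℕ) (v : V)
    (h : X.Hyperplane) : ℝ :=
  (if h ∈ (sep hX o v).filter fun h => c h = 0 then 1 else 0) -
    if h ∈ outer hX o c v then 1 / ((l : ℝ) + 1) else 0

theorem outerCoord_of_mem_outer {hX : X.IsCAT0} {o : V} {c : X.Hyperplane → Fin 2} (l : ℕ) {v : V}
    {h : X.Hyperplane} (hh : h ∈ outer hX o c v) :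
    outerCoord hX o c l v h = 1 - 1 / ((l : ℝ) + 1) := by
  classical
  have := mem_outer.1 hh
  rw [outerCoord, if_pos hh, if_pos (Finset.mem_filter.2 ⟨this.1, this.2.1⟩)]

theorem outerCoord_of_notMem_outer {hX : X.IsCAT0} {o : V} {c : X.Hyperplane → Fin 2} (l : ℕ)
    {v : V} {h : X.Hyperplane} (h1 : h ∈ sep hX o v) (h2 : c h = 0) (h3 : h ∉ outer hX o c v) :
    outerCoord hX o c l v h = 1 := by
  classical
  rw [outerCoord, if_neg h3, if_pos (Finset.mem_filter.2 ⟨h1, h2⟩), sub_zero]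

theorem outerCoord_of_not {hX : X.IsCAT0} {o : V} {c : X.Hyperplane → Fin 2} (l : ℕ) {v : V}
    {h : X.Hyperplane} (h1 : ¬(h ∈ sep hX o v ∧ c h = 0)) : outerCoord hX o c l v h = 0 := by
  classical
  rw [outerCoord, if_neg (by rwa [Finset.mem_filter]), if_neg, sub_zero]
  exact fun hh => h1 ⟨(mem_outer.1 hh).1, (mem_outer.1 hh).2.1⟩

theorem isUnit_outerCoord (hX : X.IsCAT0) (o : V) (c : X.Hyperplane → Fin 2) (l : ℕ) (v : V) :
    Pour.IsUnit (outerCoord hX o c l v) := by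
  intro h
  by_cases h1 : h ∈ sep hX o v ∧ c h = 0
  · by_cases h2 : h ∈ outer hX o c v
    · rw [outerCoord_of_mem_outer l h2, sub_nonneg]
      refine ⟨?_, sub_le_self _ (by positivity)⟩
      rw [div_le_one (by positivity)]
      linarith [(Nat.cast_nonneg l : (0 : ℝ) ≤ l)]
    · rw [outerCoord_of_notMem_outer l h1.1 h1.2 h2]
      norm_num
  · rw [outerCoord_of_not l h1]
    norm_num

theorem sum_indicator_le {ι : Type*} [DecidableEq ι] {A : Finset ι} {l : ℕ} (hA : A.card ≤ l)
    (U : Finset ι) : ∑ h ∈ U, (if h ∈ A then 1 / ((l : ℝ) + 1) else 0) ≤ l / ((l : ℝ) + 1) := by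
  rw [← Finset.sum_filter, Finset.sum_const, nsmul_eq_mul, mul_one_div]
  gcongr
  refine (Finset.card_le_card fun h hh => ?_).trans hA
  exact (Finset.mem_filter.1 hh).2

open Classical in
-- The constant balances the colours: with a lowering `a`, an edge of colour 0 costs `1 - a` and one
-- of colour 1 at most `l * a`; these agree for `a = 1 / (l + 1)`.
theorem IsControlledColouring.outerCoord_edge {hX : X.IsCAT0} {o : V} {l : ℕ}
    {c : X.Hyperplane → Fin 2} (hc : X.IsControlledColouring o l c) {v w : V} {k : X.Hyperplane}
    (hk : k ∉ sep hX o v) (hw : sep hX o w = insert k (sep hX o v)) :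
    outerCoord hX o c l v ≤ outerCoord hX o c l w ∧ ∀ U : Finset X.Hyperplane,
      ∑ h ∈ U, (outerCoord hX o c l w h - outerCoord hX o c l v h) ≤ l / ((l : ℝ) + 1) := by
  have hl : (0 : ℝ) < (l : ℝ) + 1 := by positivity
  have hlpos : 0 < 1 / ((l : ℝ) + 1) := by positivity
  have hl1 : 1 - 1 / ((l : ℝ) + 1) = l / ((l : ℝ) + 1) := by field_simp; ring
  have hsub : ∀ h, h ≠ k → h ∈ outer hX o c w → h ∈ outer hX o c v := by
    intro h hne hh
    rw [mem_outer, hw, Finset.mem_insert] at hh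
    exact mem_outer.2 ⟨hh.1.resolve_left hne, hh.2.1, fun g hg => hh.2.2 g
      (Finset.mem_insert_of_mem hg)⟩
  by_cases hck : c k = 0
  -- Nothing already crossed can lie above the new hyperplane `k`, since `k` does not separate `v`
  -- from `o`. A new `k` of colour 0 is therefore outer, and it leaves the status of the others
  -- unchanged.
  · have hko : k ∈ outer hX o c w := by
      refine mem_outer.2 ⟨by simp [hw], hck, fun g hg hb => ?_⟩
      rw [hw, Finset.mem_insert] at hg
      rcases hg with rfl | hg
      · exact hck
      · exact absurd (hb _ ⟨v, rfl⟩ hg) hk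
    have hdiff : ∀ h, outerCoord hX o c l w h - outerCoord hX o c l v h =
        if h = k then l / ((l : ℝ) + 1) else 0 := by
      intro h
      by_cases hne : h = k
      · subst hne
        rw [if_pos rfl, outerCoord_of_mem_outer l hko, outerCoord_of_not l (by tauto), sub_zero, hl1]
      · rw [if_neg hne, sub_eq_zero]
        have h1 : h ∈ sep hX o w ↔ h ∈ sep hX o v := by simp [hw, hne]
        have h2 : h ∈ outer hX o c w ↔ h ∈ outer hX o c v := by
          refine ⟨hsub h hne, fun hh => ?_⟩
          rw [mem_outer] at hh ⊢
          refine ⟨h1.2 hh.1, hh.2.1, fun g hg hb => ?_⟩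
          rw [hw, Finset.mem_insert] at hg
          rcases hg with rfl | hg
          · exact hck
          · exact hh.2.2 g hg hb
        simp only [outerCoord, Finset.mem_filter, h1, h2]
    refine ⟨fun h => ?_, fun U => ?_⟩
    · rw [← sub_nonneg, hdiff]
      split_ifs <;> positivity
    · rw [Finset.sum_congr rfl fun h _ => hdiff h, Finset.sum_ite_eq']
      split_ifs
      · exact le_rfl
      · positivity
  -- A new hyperplane of colour 1 has coordinate 0 and can only end the outer status of others, each
  -- of which then regains `1 / (l + 1)`.
  · have hdiff : ∀ h, 0 ≤ outerCoord hX o c l w h - outerCoord hX o c l v h ∧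
        outerCoord hX o c l w h - outerCoord hX o c l v h ≤
          if h ∈ outer hX o c v then 1 / ((l : ℝ) + 1) else 0 := by
      intro h
      by_cases hne : h = k
      · subst hne
        rw [outerCoord_of_not l (by tauto), outerCoord_of_not l (by tauto), sub_zero]
        refine ⟨le_rfl, ?_⟩
        split_ifs
        · exact hlpos.le
        · exact le_rfl
      · have h1 : h ∈ sep hX o w ↔ h ∈ sep hX o v := by simp [hw, hne]
        have h2 := hsub h hne
        simp only [outerCoord, Finset.mem_filter, h1]
        by_cases h3 : h ∈ outer hX o c w
        · simp [h3, h2 h3, hlpos.le, - one_div]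
        · by_cases h4 : h ∈ outer hX o c v <;> simp [h3, h4, hlpos.le, - one_div]
    refine ⟨fun h => sub_nonneg.1 (hdiff h).1, fun U => ?_⟩
    exact (Finset.sum_le_sum fun h _ => (hdiff h).2).trans
      (sum_indicator_le (hc.card_outer_le v) U)

/-! ### The map to the restricted complex -/

theorem lipschitz_of_mkPoint {W : Type u} {Y : CubeComplex W} (φ : X.Realization → Y.Realization)
    {C : ℝ≥0} (hC : 0 < C)
    (h : ∀ {n : ℕ} {f : (Fin n → Bool) → V} (hf : X.IsCube f) (s t : Fin n → unitInterval),
      Y.pathDist (φ (X.mkPoint hf s)) (φ (X.mkPoint hf t)) ≤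
        ENNReal.ofReal (C * ∑ i, |(s i : ℝ) - t i|)) : LipschitzWith C φ := by
  have hC0 : (C : ℝ≥0∞) ≠ 0 := by simpa using hC.ne'
  have h1 : ∀ p q, Y.pathDist (φ p) (φ q) ≤ C * X.cubeDist p q := by
    intro p q
    rw [← ENNReal.div_le_iff' hC0 ENNReal.coe_ne_top]
    refine le_iInf fun n => le_iInf fun f => le_iInf fun s => le_iInf fun t => le_iInf fun hh => ?_
    obtain ⟨hf, hp, hq⟩ := hh
    obtain rfl : p = X.mkPoint hf s := Subtype.ext hp
    obtain rfl : q = X.mkPoint hf t := Subtype.ext hq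
    rw [ENNReal.div_le_iff' hC0 ENNReal.coe_ne_top]
    refine (h hf s t).trans_eq ?_
    rw [ENNReal.ofReal_mul C.coe_nonneg, ENNReal.ofReal_coe_nnreal]
  intro p q
  change Y.pathDist (φ p) (φ q) ≤ C * X.pathDist p q
  rw [← ENNReal.div_le_iff' hC0 ENNReal.coe_ne_top]
  refine le_iInf fun L => le_iInf fun hL => ?_
  rw [ENNReal.div_le_iff' hC0 ENNReal.coe_ne_top]
  subst hL
  induction L generalizing p with
  | nil => simp [pathDist_self]
  | cons a L ih =>
    rw [List.getLastD_cons, stringLength, mul_add]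
    exact (Y.pathDist_triangle _ (φ a) _).trans (add_le_add (h1 p a) (ih a))

theorem subsingleton_realization [Subsingleton V] : Subsingleton X.Realization := by
  refine ⟨fun p q => ?_⟩
  have key : ∀ p : X.Realization, ∀ v, p.1 v = 1 := by
    rintro ⟨_, n, f, t, hf, rfl⟩ v
    change cubePoint f t v = 1
    rw [← sum_vertexWeight t, cubePoint]
    exact Finset.sum_congr rfl fun x _ => if_pos (Subsingleton.elim _ _)
  exact Subtype.ext (funext fun v => (key p v).trans (key q v).symm)

/-- A single inward edge is a monochromatic geodesic of length 1, so for `l = 0` there is no vertex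
besides `o`. -/
theorem IsControlledColouring.subsingleton (hX : X.IsCAT0) {o : V} {c : X.Hyperplane → Fin 2}
    (hc : X.IsControlledColouring o 0 c) : Subsingleton V := by
  classical
  have key : ∀ v, v = o := by
    intro v
    by_contra hne
    have hnem : (sep hX o v).Nonempty := by
      rw [Finset.nonempty_iff_ne_empty]
      exact fun h => hne (eq_of_sep_eq_empty hX h).symm
    obtain ⟨m, hm, w, hw⟩ := (isMedianFamily_sep hX o).exists_erase_mem ⟨v, rfl⟩ hnem
    have h2 := hc.card_sdiff_le (hX := hX) (u := w) (v := v) (by rw [hw]; exact Finset.erase_subset _ _)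
      (c m) (by
        intro h hh
        rw [hw, Finset.mem_sdiff, Finset.mem_erase] at hh
        have : h = m := by tauto
        rw [this])
    rw [hw, Finset.sdiff_erase_self hm] at h2
    simp at h2
  exact ⟨fun u v => (key u).trans (key v).symm⟩

end CubeComplex

/-! ### The cobornologous map of a controlled colouring -/

namespace CubeComplex

open IsMedianFamily

variable {V : Type u} {X : CubeComplex V}

theorem exists_vertex_near {D : ℕ} (hD : X.HasDimension D) (p : X.Realization) :
    ∃ v, X.pathDist p (X.vertexPoint v) ≤ D := by
  obtain ⟨_, n, f, t, hf, rfl⟩ := p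
  refine ⟨f fun _ => false, (X.pathDist_vertexPoint_le hf t _).trans ?_⟩
  exact_mod_cast hD.2 n f hf

open Classical in
/-- Vertices are close if few hyperplanes of colour `0` separate them. -/
theorem IsControlledColouring.dist_le {hX : X.IsCAT0} {o : V} {l : ℕ}
    {c : X.Hyperplane → Fin 2} (hc : X.IsControlledColouring o l c) {v w : V} {N : ℕ}
    (hN : ((sep hX v w).filter fun h => c h = 0).card ≤ N) :
    X.skeleton.dist v w ≤ 2 * ((l + 1) * N + l) := by
  -- `m` is the median of `o`, `v`, `w`. The geodesics from `v` and from `w` to `m` are inward and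
  -- cross only hyperplanes separating `v` from `w`; this gives the factor 2.
  obtain ⟨m, hm⟩ := (isMedianFamily_sep hX o).inter_mem ⟨v, rfl⟩ ⟨w, rfl⟩
  have key : ∀ x, sep hX o m ⊆ sep hX o x → (∀ h ∈ sep hX o x, h ∉ sep hX o m → h ∈ sep hX v w) →
      X.skeleton.dist x m ≤ (l + 1) * N + l := by
    intro x hx hh
    rw [← card_sep hX, sep_eq_sdiff hX o hx]
    refine (hc.card_sdiff_le_mul hx).trans (Nat.add_le_add_right (Nat.mul_le_mul_left _ ?_) _)
    refine (Finset.card_le_card (Finset.filter_subset_filter _ fun h hhx => ?_)).trans hN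
    rw [Finset.mem_sdiff] at hhx
    exact hh h hhx.1 hhx.2
  have h1 := key v (by rw [hm]; exact Finset.inter_subset_left) fun h hv hn => by
    rw [hm, Finset.mem_inter] at hn
    rw [mem_sep_iff hX o]
    tauto
  have h2 := key w (by rw [hm]; exact Finset.inter_subset_right) fun h hv hn => by
    rw [hm, Finset.mem_inter] at hn
    rw [mem_sep_iff hX o]
    tauto
  have h3 := hX.1.1.dist_triangle (u := v) (v := m) (w := w)
  rw [SimpleGraph.dist_comm (u := m)] at h3
  omega

open Classical in
theorem IsControlledColouring.exists_map {hX : X.IsCAT0} {D : ℕ} (hD : X.HasDimension D) {o : V}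
    {l : ℕ} {c : X.Hyperplane → Fin 2} (hc : X.IsControlledColouring o l c) (hl : 0 < l) :
    ∃ φ : X.Realization → (X.restrict {h | c h = 0}).Realization,
      LipschitzWith ((l : ℝ≥0) / ((l : ℝ≥0) + 1)) φ ∧ IsCobornologous φ := by
  set K : Set X.Hyperplane := {h | c h = 0} with hK
  have hlpos : (0 : ℝ) < l := by exact_mod_cast hl
  have hC : (l : ℝ) / ((l : ℝ) + 1) ≤ 1 := by
    rw [div_le_one (by positivity)]
    linarith
  obtain ⟨φ, hφ, hclose⟩ := exists_map_of_coords hX o K (l / ((l : ℝ) + 1)) (by positivity)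
    (outerCoord hX o c l) (isUnit_outerCoord hX o c l)
    (fun v h hne => by
      by_contra hh
      simp only [Finset.mem_filter] at hh
      exact hne (outerCoord_of_not l hh))
    (fun v w k hk hw => hc.outerCoord_edge hk hw)
    (fun v U => by
      refine le_trans (le_of_eq (Finset.sum_congr rfl fun h _ => ?_))
        ((sum_indicator_le (hc.card_outer_le (hX := hX) v) U).trans hC)
      simp only [outerCoord, hK, Set.mem_ofPred_eq, sub_sub_cancel])
  have hLip : LipschitzWith ((l : ℝ≥0) / ((l : ℝ≥0) + 1)) φ := by
    refine lipschitz_of_mkPoint φ (by positivity) fun hf s t => ?_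
    simpa using hφ hf s t
  refine ⟨φ, hLip, fun R hR => ?_⟩
  have hLip1 : ∀ p q, (X.restrict K).pathDist (φ p) (φ q) ≤ X.pathDist p q := by
    intro p q
    refine (hLip p q).trans ?_
    refine mul_le_of_le_one_left' ?_
    rw [ENNReal.coe_le_one_iff, ← NNReal.coe_le_coe]
    simpa using hC
  -- `N` bounds the number of hyperplanes of colour 0 between vertices near `p` and `q`: passing to
  -- these vertices costs `D` twice, and replacing their images by orientations costs 1 twice.
  set N := ⌊R + 2 * D + 2⌋₊ with hN
  refine ⟨(2 * D + 2 * ((l + 1) * N + l) : ℕ), ?_, fun p q hpq => ?_⟩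
  · have : 0 < 2 * D + 2 * ((l + 1) * N + l) := by omega
    exact_mod_cast this
  change (X.restrict K).pathDist (φ p) (φ q) ≤ _ at hpq
  change X.pathDist p q ≤ _
  obtain ⟨v, hv⟩ := exists_vertex_near hD p
  obtain ⟨w, hw⟩ := exists_vertex_near hD q
  have hvw : (X.restrict K).pathDist (φ (X.vertexPoint v)) (φ (X.vertexPoint w)) ≤
      ENNReal.ofReal (R + 2 * D) := by
    calc _ ≤ (X.restrict K).pathDist (φ (X.vertexPoint v)) (φ p) +
          ((X.restrict K).pathDist (φ p) (φ q) +
            (X.restrict K).pathDist (φ q) (φ (X.vertexPoint w))) :=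
          ((X.restrict K).pathDist_triangle _ (φ p) _).trans
            (add_le_add_right ((X.restrict K).pathDist_triangle _ (φ q) _) _)
      _ ≤ D + (ENNReal.ofReal R + D) := by
          refine add_le_add ?_ (add_le_add hpq ((hLip1 _ _).trans hw))
          rw [pathDist_comm]
          exact (hLip1 _ _).trans hv
      _ = ENNReal.ofReal (R + 2 * D) := by
          rw [ENNReal.ofReal_add hR.le (by positivity), two_mul,
            ENNReal.ofReal_add (by positivity) (by positivity), ENNReal.ofReal_natCast]
          ring
  have hT := isMedianModel_restrict hX o K
  let U := (sep hX v w).filter fun h => c h = 0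
  have hU : (U.card : ℝ) ≤ R + 2 * D + 2 := by
    have h1 := (ENNReal.ofReal_le_ofReal_iff (by positivity)).1
      ((hT.sum_coord_le_pathDist _ _ U).trans hvw)
    have hclose' : ∀ x, ∑ h ∈ U, |(if h ∈ sep hX o x then 1 else 0) -
        coord (orientationSep hX o K) h (φ (X.vertexPoint x)).1| ≤ 1 := by
      refine fun x => le_trans (le_of_eq (Finset.sum_congr rfl fun h hh => ?_)) (hclose x U)
      have hhK : h ∈ K := (Finset.mem_filter.1 hh).2
      simp only [Finset.mem_filter, hhK, and_true]
    have h2 := hclose' v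
    have h3 := hclose' w
    set a := fun h => coord (orientationSep hX o K) h (φ (X.vertexPoint v)).1
    set b := fun h => coord (orientationSep hX o K) h (φ (X.vertexPoint w)).1
    -- Each `h` in `U` separates `v` from `w`, so the two indicators differ by 1; the triangle
    -- inequality passes through the coordinates of the images.
    have h4 : (U.card : ℝ) ≤ ∑ h ∈ U, (|(if h ∈ sep hX o v then 1 else 0) - a h| +
        |a h - b h| + |(if h ∈ sep hX o w then 1 else 0) - b h|) := by
      rw [Finset.card_eq_sum_ones, Nat.cast_sum]
      refine Finset.sum_le_sum fun h hh => ?_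
      have hs := (mem_sep_iff hX o v w h).1 (Finset.mem_filter.1 hh).1
      generalize a h = x
      generalize b h = y
      have h5 := abs_sub_abs_le_abs_sub x y
      by_cases hhv : h ∈ sep hX o v
      · have hhw : h ∉ sep hX o w := by tauto
        simp only [hhv, hhw, if_true, if_false, zero_sub, abs_neg, Nat.cast_one]
        linarith [le_abs_self ((1 : ℝ) - x), le_abs_self (x - y), le_abs_self y]
      · have hhw : h ∈ sep hX o w := by tauto
        simp only [hhv, hhw, if_true, if_false, zero_sub, abs_neg, Nat.cast_one]
        linarith [le_abs_self ((1 : ℝ) - y), neg_le_abs (x - y), le_abs_self x]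
    rw [Finset.sum_add_distrib, Finset.sum_add_distrib] at h4
    linarith
  have hd := hc.dist_le (hX := hX) (v := v) (w := w) (Nat.le_floor hU)
  obtain ⟨r, hr⟩ := hX.1.1.exists_walk_length_eq_dist v w
  calc X.pathDist p q ≤ X.pathDist p (X.vertexPoint v) +
        (X.pathDist (X.vertexPoint v) (X.vertexPoint w) + X.pathDist (X.vertexPoint w) q) :=
        (X.pathDist_triangle _ (X.vertexPoint v) _).trans
          (add_le_add_right (X.pathDist_triangle _ (X.vertexPoint w) _) _)
    _ ≤ D + ((2 * ((l + 1) * N + l) : ℕ) + D) := by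
        refine add_le_add hv (add_le_add ((X.pathDist_vertexPoint_le_length r).trans ?_) ?_)
        · rw [hr]
          exact Nat.cast_le.2 hd
        · rw [pathDist_comm]
          exact hw
    _ = _ := by
        rw [ENNReal.ofReal_natCast, Nat.cast_add, Nat.cast_mul 2 D]
        push_cast
        ring

end CubeComplex

theorem mainTheorem5 {V : Type u} (X : CubeComplex V) (hX : X.IsCAT0) (D : ℕ)
    (hD : X.HasDimension D) (x₀ : V) (l : ℕ) (c : X.Hyperplane → Fin 2)
    (hc : X.IsControlledColouring x₀ l c) :
    (X.restrict {h | c h = 0}).IsCAT0 ∧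
    (∃ e : (X.restrict {h | c h = 0}).Hyperplane ≃ {h : X.Hyperplane | c h = 0},
      ∀ (d : (X.restrict {h | c h = 0}).skeleton.Dart) (h : {h : X.Hyperplane | c h = 0}),
        e ((X.restrict {h | c h = 0}).dual d) = h ↔ d.fst.1 h ≠ d.snd.1 h) ∧
    ∃ φ : X.Realization → (X.restrict {h | c h = 0}).Realization,
      LipschitzWith ((l : ℝ≥0) / ((l : ℝ≥0) + 1)) φ ∧ IsCobornologous φ := by
  classical
  refine ⟨(CubeComplex.isMedianModel_restrict hX x₀ _).isCAT0,
    CubeComplex.exists_hyperplane_equiv hX x₀ _, ?_⟩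
  -- For `l = 0` the Lipschitz constant is 0, so the map must be constant; it is cobornologous
  -- because `X` is a single point.
  rcases Nat.eq_zero_or_pos l with rfl | hl
  · have hV := hc.subsingleton hX
    have hR : Subsingleton X.Realization := CubeComplex.subsingleton_realization
    let q := (X.restrict {h | c h = 0}).vertexPoint (X.orientation _ x₀)
    refine ⟨fun _ => q, fun x y => by simp, fun R hR => ⟨R, hR, fun x y _ => ?_⟩⟩
    rw [Subsingleton.elim x y, edist_self]
    exact zero_le
  · exact hc.exists_map (hX := hX) hD hl
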